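/- **Setting.** Let $\mathcal X$ be a finite non-empty set and let $\Omega\subset[0,r]^{d}$ ($d\ge 1$) be compact and convex with non-empty interior. Let $f$ be a sample path, continuous in $w\in\Omega$, of a centered Gaussian process on $\mathcal X\times\Omega$ with covariance kernel $k$, where $k(p,p)\le 1$ for all $p\in\mathcal X\times\Omega$. Let $\varepsilon_t\sim N(0,\sigma^2_{\rm noise})$ with $\sigma^2_{\rm noise}>0$, let $\xi_t\sim\chi^2_2$, and let $f,\varepsilon_1,\varepsilon_2,\dots,\xi_1,\xi_2,\dots$ be mutually independent. Let $\rho$ be a robustness measure, that is, a map from functions on $\Omega$ to $\mathbb R$ that is defined and measurable on the functions used below. Put $F(x)=\rho(f(x,\cdot))$ and $x^*\in\arg\max_{x\in\mathcal X}F(x)$. After observing $y_i=f(x_i,w_i)+\varepsilon_i$ for $i\le n$, let $\mu_n,\sigma_n^2$ be the Gaussian process posterior mean and variance $$\mu_n(p)=\mathbf k_n(p)^\top(\mathbf K_n+\sigma^2_{\rm noise}\mathbf I)^{-1}\mathbf y_n,\qquad \sigma_n^2(p)=k(p,p)-\mathbf k_n(p)^\top(\mathbf K_n+\sigma^2_{\rm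 noise}\mathbf I)^{-1}\mathbf k_n(p),$$ with $\mathbf k_n(p)=(k(p,p_i))_{i\le n}$, $\mathbf K_n=(k(p_i,p_j))_{i,j\le n}$, $p_i=(x_i,w_i)$. **Assumptions and parameters.** Suppose that 1. for each $x\in\mathcal X$ and $j\le d$ the partial derivative $\partial f(x,w)/\partial w_j$ exists almost surely for all $w$ in the interior of $\Omega$, and $\mathbb P(\sup_{w\in\operatorname{int}\Omega}|\partial f(x,w)/\partial w_j|>L)\le a_2\exp(-(L/b_2)^2)$ for all $L>0$, where $a_2,b_2>0$. For $t\ge1$ let $\tau_t=\lceil b_2\,d\,r\,t^2(\sqrt{\log(a_2 d|\mathcal X|)}+\sqrt\pi/2)\rceil$ (the root is read as $0$ if $a_2d|\mathcal X|<1$), $\kappa_t=\tau_t^{d}\,|\mathcal X|$ and $\beta_t=2\log\kappa_t+\xi_t$. Let $\Omega_t\subset\Omega$ be a discretization with each coordinate equally divided into $\tau_t$: for some box with $\Omega\subset\prod_j[\ell_j,h_j]\subset[0,r]^d$, cut into $\tau_t^d$ congruent cells by dividing each side into $\tau_t$ equal parts, $\Omega_t$ has at most $\tau_t^d$ points and contains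 a point of every closed cell that meets $\Omega$. Let $[w]_t$ be a point of $\Omega_t$ closest to $w$ in Euclidean distance, and put $\mu^\dagger_{t-1}(x,w)=\mu_{t-1}(x,[w]_t)$, $f^\dagger_t(x,w)=f(x,[w]_t)$. Let $G^\dagger_{t-1}(x)$ be the set of functions $g$ in the domain of $\rho$ with $|g(w)-\mu_{t-1}(x,[w]_t)|\le\beta_t^{1/2}\sigma_{t-1}(x,[w]_t)$ for all $w\in\Omega$. Suppose further that, almost surely, 2. $\mathrm{lcb}^\dagger_{t-1}(x)\le\inf_{g\in G^\dagger_{t-1}(x)}\rho(g)$ and $\sup_{g\in G^\dagger_{t-1}(x)}\rho(g)\le\mathrm{ucb}^\dagger_{t-1}(x)$ for all $x\in\mathcal X$ and $t\ge 1$; 3. $|\rho(f(x,\cdot))-\rho(f_t^\dagger(x,\cdot))|\le q_2\big(\max_{w\in\Omega}|f(x,w)-f(x,[w]_t)|\big)$ for all $x\in\mathcal X$ and $t\ge1$, where $q_2$ is non-decreasing and concave on $[0,\infty)$ with $q_2(0)=0$; 4. $\mathrm{ucb}^\dagger_{t-1}(x_t)-\mathrm{lcb}^\dagger_{t-1}(x_t)\le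 q^\dagger\big(2\beta_t^{1/2}\max_{w\in\Omega}\sigma_{t-1}(x_t,w)\big)$ for all $t\ge1$, where $q^\dagger(a)=\sum_{i=1}^n\zeta_i h_i^\dagger\big(\sum_{j=1}^{s_i}\lambda_{ij}a^{\nu_{ij}}\big)$ with $\zeta_i,\lambda_{ij}\ge0$, $\nu_{ij}>0$, and every $h^\dagger_i$ non-decreasing and concave on $[0,\infty)$ with $h_i^\dagger(0)=0$. **Algorithm.** In each round $t=1,2,\dots$ one chooses - $\hat x_t^\dagger\in\arg\max_{x\in\mathcal X}\rho(\mu^\dagger_{t-1}(x,\cdot))$, measurably from the data $(\xi_i,y_i)_{i<t}$ of the earlier rounds; - then, measurably from these data and $\xi_t$: $\tilde x^\dagger_t\in\arg\max_{x\in\mathcal X}\big(\mathrm{ucb}^\dagger_{t-1}(x)-\max_{x'}\mathrm{lcb}^\dagger_{t-1}(x')\big)_+$, $\;x_t\in\arg\max_{x\in\{\tilde x_t^\dagger,\hat x_t^\dagger\}}\big(\mathrm{ucb}^\dagger_{t-1}(x)-\mathrm{lcb}^\dagger_{t-1}(x)\big)$ and $w_t\in\arg\max_{w\in\Omega}\sigma^2_{t-1}(x_t,w)$;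 and observes $y_t=f(x_t,w_t)+\varepsilon_t$. **Theorem.** For every $t\ge1$ the cumulative regret $R_t^\dagger=\sum_{i=1}^t\big(F(x^*)-F(\hat x_i^\dagger)\big)$ is integrable and $$\mathbb E[R_t^\dagger]\le 2t\,q_2\Big(\frac{\pi^2}{6t}\Big)+2t\sum_{i=1}^n\zeta_i h_i^\dagger\Big(\frac1t\sum_{j=1}^{s_i}2^{\nu_{ij}}\lambda_{ij}\,(t\,C_{2,\nu_{ij},t})^{1-\nu'_{ij}/2}(C_1\gamma_t)^{\nu'_{ij}/2}\Big),$$ where $\nu'_{ij}=\min\{\nu_{ij},1\}$, $C_1=2/\log(1+\sigma_{\rm noise}^{-2})$, $C_{2,\nu_{ij},t}=\mathbb E\big[\beta_t^{\nu_{ij}/(2-\nu'_{ij})}\big]$, and $\gamma_t=\frac12\sup\log\det(\mathbf I_t+\sigma_{\rm noise}^{-2}\tilde{\mathbf K}_t)$ is the maximum information gain, the supremum being over all $t$-tuples of points of $\mathcal X\times\Omega$ with kernel matrix $\tilde{\mathbf K}_t$. -/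

import Mathlib

open MeasureTheory ProbabilityTheory

namespace RobustBO

noncomputable section

/-- The chi-squared distribution with `n` degrees of freedom, i.e. `Gamma(n / 2, rate 1 / 2)`. -/
def chiSquared (n : ℕ) : Measure ℝ := gammaMeasure ((n : ℝ) / 2) (1 / 2)

/-! ### Gaussian process regression -/

section Regression

variable {Q : Type*}

/-- Kernel matrix of the points `z 0, …, z (n - 1)`. -/
def gram (k : Q → Q → ℝ) {n : ℕ} (z : Fin n → Q) : Matrix (Fin n) (Fin n) ℝ :=
  Matrix.of fun i j => k (z i) (z j)

/-- Posterior mean at `p` given the observations `y i` at `z i`, with noise variance `v`: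
`k_n(p)ᵀ (K_n + v I)⁻¹ y`. -/
def posteriorMean (k : Q → Q → ℝ) (v : ℝ) {n : ℕ} (z : Fin n → Q) (y : Fin n → ℝ) (p : Q) : ℝ :=
  (fun j => k p (z j)) ⬝ᵥ
    Matrix.mulVec (gram k z + v • (1 : Matrix (Fin n) (Fin n) ℝ))⁻¹ y

/-- Posterior variance at `p`: `k(p, p) - k_n(p)ᵀ (K_n + v I)⁻¹ k_n(p)`. -/
def posteriorVar (k : Q → Q → ℝ) (v : ℝ) {n : ℕ} (z : Fin n → Q) (p : Q) : ℝ :=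
  k p p - (fun j => k p (z j)) ⬝ᵥ
    Matrix.mulVec (gram k z + v • (1 : Matrix (Fin n) (Fin n) ℝ))⁻¹ (fun j => k p (z j))

/-- Maximum information gain
`γ_t = (1 / 2) sup log det (I_t + v⁻¹ K)` over all `t`-tuples of points. -/
def maxInfoGain (k : Q → Q → ℝ) (v : ℝ) (t : ℕ) : ℝ :=
  (1 / 2) * ⨆ z : Fin t → Q,
    Real.log (1 + v⁻¹ • gram k z : Matrix (Fin t) (Fin t) ℝ).det

end Regression

/-! ### Classes of functions -/

/-- `h` is non-decreasing and concave on `[0, ∞)` with `h 0 = 0` (hence non-negative there). -/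
structure IsConcaveModulus (h : ℝ → ℝ) : Prop where
  mono : MonotoneOn h (Set.Ici 0)
  concave : ConcaveOn ℝ (Set.Ici 0) h
  zero : h 0 = 0

/-- A function of the class `𝒬`, given by its representation
`q(a) = ∑ i, ζ i * h i (∑ j, lam i j * a ^ ν i j)`. -/
structure QFun where
  n : ℕ
  s : Fin n → ℕ
  ζ : Fin n → ℝ
  h : Fin n → ℝ → ℝ
  lam : (i : Fin n) → Fin (s i) → ℝ
  ν : (i : Fin n) → Fin (s i) → ℝ
  ζ_nonneg : ∀ i, 0 ≤ ζ i
  h_mod : ∀ i, IsConcaveModulus (h i)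
  lam_nonneg : ∀ i j, 0 ≤ lam i j
  ν_pos : ∀ i j, 0 < ν i j

/-- The value `q(a)`. -/
def QFun.eval (q : QFun) (a : ℝ) : ℝ :=
  ∑ i, q.ζ i * q.h i (∑ j, q.lam i j * a ^ q.ν i j)

/-! ### Discretization of the environment -/

/-- `τ_t = ⌈b d r t² (√(log (a d |𝒳|)) + √π / 2)⌉`, where `m = |𝒳|`. -/
def tau (a b r : ℝ) (d m t : ℕ) : ℕ :=
  ⌈b * d * r * (t : ℝ) ^ 2 * (√(Real.log (a * d * m)) + √Real.pi / 2)⌉₊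

/-- `κ_t = τ_t ^ d |𝒳|`. -/
def kappa (a b r : ℝ) (d m t : ℕ) : ℝ := (tau a b r d m t : ℝ) ^ d * m

/-- The cell with multi-index `c` when each coordinate range `[lo j, hi j]` is divided into `τ`
intervals of equal length. -/
def gridCell {d : ℕ} (lo hi : Fin d → ℝ) (τ : ℕ) (c : Fin d → Fin τ) :
    Set (EuclideanSpace ℝ (Fin d)) :=
  {w | ∀ j, lo j + (c j : ℝ) * ((hi j - lo j) / τ) ≤ w j ∧
    w j ≤ lo j + ((c j : ℝ) + 1) * ((hi j - lo j) / τ)}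

/-- `D` is a discretization of `Ω ⊆ [0, r]^d` with each coordinate equally divided into `τ`: for
some box in `[0, r]^d` that contains `Ω`, cut into `τ ^ d` congruent cells, `D` is a set of at most
`τ ^ d` points of `Ω` that represents each cell meeting `Ω`. -/
def IsGridDiscretization {d : ℕ} (Ω : Set (EuclideanSpace ℝ (Fin d))) (r : ℝ) (τ : ℕ)
    (D : Finset Ω) : Prop :=
  ∃ lo hi : Fin d → ℝ,
    (∀ j, 0 ≤ lo j ∧ lo j ≤ hi j ∧ hi j ≤ r) ∧
    (∀ w ∈ Ω, ∀ j, lo j ≤ w j ∧ w j ≤ hi j) ∧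
    D.card ≤ τ ^ d ∧
    ∀ c : Fin d → Fin τ, (Ω ∩ gridCell lo hi τ c).Nonempty →
      ∃ w ∈ D, (w : EuclideanSpace ℝ (Fin d)) ∈ gridCell lo hi τ c

/-- `rnd w` is a point of `D` closest to `w`. -/
def IsNearestPointMap {α : Type*} [PseudoMetricSpace α] (D : Finset α) (rnd : α → α) : Prop :=
  ∀ w, rnd w ∈ D ∧ ∀ w' ∈ D, dist w (rnd w) ≤ dist w w'

/-- Extension of a function on `Ω` by zero; it is only used at interior points of `Ω`. -/
def extendZero {d : ℕ} {Ω : Set (EuclideanSpace ℝ (Fin d))} (g : Ω → ℝ) :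
    EuclideanSpace ℝ (Fin d) → ℝ :=
  Function.extend Subtype.val g 0

/-- The partial derivative of `g : Ω → ℝ` in the `j`-th coordinate exists at `w` (for `w` in the
interior of `Ω`). -/
def HasPartialAt {d : ℕ} {Ω : Set (EuclideanSpace ℝ (Fin d))} (g : Ω → ℝ) (j : Fin d)
    (w : EuclideanSpace ℝ (Fin d)) : Prop :=
  LineDifferentiableAt ℝ (extendZero g) w (EuclideanSpace.single j 1)

/-- The partial derivative of `g : Ω → ℝ` in the `j`-th coordinate. -/
def partialDeriv {d : ℕ} {Ω : Set (EuclideanSpace ℝ (Fin d))} (g : Ω → ℝ) (j : Fin d)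
    (w : EuclideanSpace ℝ (Fin d)) : ℝ :=
  lineDeriv ℝ (extendZero g) w (EuclideanSpace.single j 1)

/-! ### The random objects -/

/-- All random objects of a run of the algorithm on a sample space `S`; rounds are numbered
`t = 1, 2, …` (index `0` is never used).
`f p` is the value of the black-box function at `p = (x, w)`, `ε t` the noise, `ξ t` the algorithm's
random variable, `xhat t` the estimated solution, `xtil t` the optimistic maximizer, `(x t, w t)`
the evaluated point, and `lcb t`, `ucb t` the bounds used in round `t` (computed from the data of
the first `t - 1` rounds and from `ξ t`). -/
structure Run (S X : Type*) {d : ℕ} (Ω : Set (EuclideanSpace ℝ (Fin d))) where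
  f : X × Ω → S → ℝ
  ε : ℕ → S → ℝ
  ξ : ℕ → S → ℝ
  xhat : ℕ → S → X
  xtil : ℕ → S → X
  x : ℕ → S → X
  w : ℕ → S → Ω
  lcb : ℕ → S → X → ℝ
  ucb : ℕ → S → X → ℝ

namespace Run

variable {S X : Type*} {d : ℕ} {Ω : Set (EuclideanSpace ℝ (Fin d))} (T : Run S X Ω)

/-- The function `f(x, ·)` on `Ω`. -/
def path (ω : S) (x : X) : Ω → ℝ := fun w => T.f (x, w) ω

/-- The observation `y_t = f(x_t, w_t) + ε_t`. -/
def y (t : ℕ) (ω : S) : ℝ := T.f (T.x t ω, T.w t ω) ω + T.ε t ω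

/-- `μ_n(x, w)`, computed from the data of the rounds `1, …, n`. -/
def mean (k : X × Ω → X × Ω → ℝ) (v : ℝ) (n : ℕ) (ω : S) (x : X) (w : Ω) : ℝ :=
  posteriorMean k v (fun i : Fin n => (T.x (i + 1) ω, T.w (i + 1) ω))
    (fun i : Fin n => T.y (i + 1) ω) (x, w)

/-- `σ_n²(x, w)`, computed from the data of the rounds `1, …, n`. -/
def var (k : X × Ω → X × Ω → ℝ) (v : ℝ) (n : ℕ) (ω : S) (x : X) (w : Ω) : ℝ :=
  posteriorVar k v (fun i : Fin n => (T.x (i + 1) ω, T.w (i + 1) ω)) (x, w)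

/-- `σ_n(x, w)`. -/
def std (k : X × Ω → X × Ω → ℝ) (v : ℝ) (n : ℕ) (ω : S) (x : X) (w : Ω) : ℝ :=
  √(T.var k v n ω x w)

/-- `β_t = 2 log κ_t + ξ_t`. -/
def beta (κ : ℕ → ℝ) (t : ℕ) (ω : S) : ℝ := 2 * Real.log (κ t) + T.ξ t ω

/-- The set `G†_n(x)` of functions `g` on `Ω` (in the domain `𝒟` of the robustness measure) with
`l†_n(x, w) ≤ g w ≤ u†_n(x, w)` for all `w`, where
`l†_n, u†_n = μ_n(x, [w]) ∓ √β_{n+1} σ_n(x, [w])` and `[·] = rnd (n + 1)`. -/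
def credibleFunctions (k : X × Ω → X × Ω → ℝ) (v : ℝ) (𝒟 : Set (Ω → ℝ)) (rnd : ℕ → Ω → Ω)
    (κ : ℕ → ℝ) (n : ℕ) (ω : S) (x : X) : Set (Ω → ℝ) :=
  {g | g ∈ 𝒟 ∧ ∀ w, g w ∈ Set.Icc
    (T.mean k v n ω x (rnd (n + 1) w) -
      √(T.beta κ (n + 1) ω) * T.std k v n ω x (rnd (n + 1) w))
    (T.mean k v n ω x (rnd (n + 1) w) +
      √(T.beta κ (n + 1) ω) * T.std k v n ω x (rnd (n + 1) w))}

/-- The `σ`-algebra generated by the data of the rounds `1, …, n`. (The points `(x_i, w_i)` are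
themselves functions of `ξ_1, …, ξ_i` and `y_1, …, y_{i-1}`.) -/
def history (n : ℕ) : MeasurableSpace S :=
  ⨆ i : Fin n, MeasurableSpace.comap (T.ξ (i + 1)) inferInstance ⊔
    MeasurableSpace.comap (T.y (i + 1)) inferInstance

/-- The `σ`-algebras generated by `f`, by each `ε_t`, and by each `ξ_t`, `t ≥ 1`. -/
def sources : Option (ℕ ⊕ ℕ) → MeasurableSpace S
  | none => ⨆ p, MeasurableSpace.comap (T.f p) inferInstance
  | some (Sum.inl n) => MeasurableSpace.comap (T.ε (n + 1)) inferInstance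
  | some (Sum.inr n) => MeasurableSpace.comap (T.ξ (n + 1)) inferInstance

/-- The probabilistic model: `f` is a sample path, continuous in `w`, of the centered Gaussian
process with covariance kernel `k`, where `k(p, p) ≤ 1`; the noise is `N(0, v)`; `ξ_t` is
chi-squared with two degrees of freedom; all of these are mutually independent. -/
structure IsModel [MeasurableSpace S] (P : Measure S) (k : X × Ω → X × Ω → ℝ) (v : NNReal) :
    Prop where
  measurable_f : ∀ p, Measurable (T.f p)
  gaussian : IsGaussianProcess T.f P
  mean_zero : ∀ p, ∫ ω, T.f p ω ∂P = 0
  covariance_eq : ∀ p p', covariance (T.f p) (T.f p') P = k p p'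
  kernel_le_one : ∀ p, k p p ≤ 1
  continuous_path : ∀ ω x, Continuous (T.path ω x)
  measurable_noise : ∀ t, 1 ≤ t → Measurable (T.ε t)
  noise_law : ∀ t, 1 ≤ t → HasLaw (T.ε t) (gaussianReal 0 v) P
  measurable_xi : ∀ t, 1 ≤ t → Measurable (T.ξ t)
  xi_law : ∀ t, 1 ≤ t → HasLaw (T.ξ t) (chiSquared 2) P
  indep : iIndep T.sources P

/-- The algorithm is performed. In round `n + 1`, the estimated solution is a maximizer of
`ρ(μ†_n(x, ·))` selected from the data of the first `n` rounds; `xtil`, `x`, `w` are selected from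
these data and `ξ_{n+1}` as maximizers of the respective acquisition functions. -/
structure IsAlgorithm [MeasurableSpace X] (k : X × Ω → X × Ω → ℝ) (v : ℝ) (ρ : (Ω → ℝ) → ℝ)
    (rnd : ℕ → Ω → Ω) : Prop where
  measurable_xhat : ∀ n, Measurable[T.history n] (T.xhat (n + 1))
  xhat_max : ∀ n ω x, ρ (fun w => T.mean k v n ω x (rnd (n + 1) w)) ≤
    ρ (fun w => T.mean k v n ω (T.xhat (n + 1) ω) (rnd (n + 1) w))
  measurable_xtil : ∀ n, Measurable[T.history n ⊔
    MeasurableSpace.comap (T.ξ (n + 1)) inferInstance] (T.xtil (n + 1))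
  xtil_max : ∀ n ω x, max (T.ucb (n + 1) ω x - ⨆ x', T.lcb (n + 1) ω x') 0 ≤
    max (T.ucb (n + 1) ω (T.xtil (n + 1) ω) - ⨆ x', T.lcb (n + 1) ω x') 0
  measurable_x : ∀ n, Measurable[T.history n ⊔
    MeasurableSpace.comap (T.ξ (n + 1)) inferInstance] (T.x (n + 1))
  x_mem : ∀ n ω, T.x (n + 1) ω = T.xtil (n + 1) ω ∨ T.x (n + 1) ω = T.xhat (n + 1) ω
  x_max : ∀ n ω x, x = T.xtil (n + 1) ω ∨ x = T.xhat (n + 1) ω →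
    T.ucb (n + 1) ω x - T.lcb (n + 1) ω x ≤
      T.ucb (n + 1) ω (T.x (n + 1) ω) - T.lcb (n + 1) ω (T.x (n + 1) ω)
  measurable_w : ∀ n, Measurable[T.history n ⊔
    MeasurableSpace.comap (T.ξ (n + 1)) inferInstance] (T.w (n + 1))
  w_max : ∀ n ω w, T.var k v n ω (T.x (n + 1) ω) w ≤
    T.var k v n ω (T.x (n + 1) ω) (T.w (n + 1) ω)

/-- The robustness measure `ρ` is defined (its domain being `𝒟`) and measurable on the functions
at which it is evaluated: the sample paths and, for each `t ≥ 1`, the functions of `[w]_t`. -/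
structure IsAdmissible [MeasurableSpace S] (P : Measure S) (ρ : (Ω → ℝ) → ℝ) (𝒟 : Set (Ω → ℝ))
    (rnd : ℕ → Ω → Ω) : Prop where
  path_mem : ∀ ω x, T.path ω x ∈ 𝒟
  step_mem : ∀ t, 1 ≤ t → ∀ g : Ω → ℝ, g ∘ rnd t ∈ 𝒟
  aemeasurable_path : ∀ x, AEMeasurable (fun ω => ρ (T.path ω x)) P
  measurable_step : ∀ t, 1 ≤ t → Measurable fun g : Ω → ℝ => ρ (g ∘ rnd t)

/-- `lcb` and `ucb` are a lower bound of the infimum and an upper bound of the supremum of `ρ` over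
`G†_n(x)`. -/
def IsBound [MeasurableSpace S] (P : Measure S) (k : X × Ω → X × Ω → ℝ) (v : ℝ)
    (ρ : (Ω → ℝ) → ℝ) (𝒟 : Set (Ω → ℝ)) (rnd : ℕ → Ω → Ω) (κ : ℕ → ℝ) : Prop :=
  ∀ᵐ ω ∂P, ∀ n x,
    T.lcb (n + 1) ω x ∈ lowerBounds (ρ '' T.credibleFunctions k v 𝒟 rnd κ n ω x) ∧
    T.ucb (n + 1) ω x ∈ upperBounds (ρ '' T.credibleFunctions k v 𝒟 rnd κ n ω x)

/-- The partial derivatives of `f(x, ·)` exist in the interior of `Ω`, and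
`P(sup_w |∂f(x, w)/∂w_j| > L) ≤ a exp(-(L / b)²)`. -/
structure HasDerivTail [MeasurableSpace S] (P : Measure S) (a b : ℝ) : Prop where
  differentiable : ∀ᵐ ω ∂P, ∀ x j, ∀ w ∈ interior Ω, HasPartialAt (T.path ω x) j w
  tail : ∀ x j, ∀ L : ℝ, 0 < L →
    P {ω | ∃ w ∈ interior Ω, L < |partialDeriv (T.path ω x) j w|} ≤
      ENNReal.ofReal (a * Real.exp (-(L / b) ^ 2))

/-- `|ρ(f(x, ·)) - ρ(f†_t(x, ·))| ≤ q₂(max_w |f(x, w) - f(x, [w]_t)|)` along the sample paths. -/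
def DiscretizationBound [MeasurableSpace S] (P : Measure S) (ρ : (Ω → ℝ) → ℝ)
    (rnd : ℕ → Ω → Ω) (q₂ : ℝ → ℝ) : Prop :=
  ∀ᵐ ω ∂P, ∀ t, 1 ≤ t → ∀ x,
    |ρ (T.path ω x) - ρ (T.path ω x ∘ rnd t)| ≤
      q₂ (⨆ w, |T.path ω x w - T.path ω x (rnd t w)|)

/-- `ucb_n(x_{n+1}) - lcb_n(x_{n+1}) ≤ q(2 √β_{n+1} max_w σ_n(x_{n+1}, w))`. -/
def WidthBound [MeasurableSpace S] (P : Measure S) (k : X × Ω → X × Ω → ℝ) (v : ℝ)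
    (κ : ℕ → ℝ) (q : QFun) : Prop :=
  ∀ᵐ ω ∂P, ∀ n,
    T.ucb (n + 1) ω (T.x (n + 1) ω) - T.lcb (n + 1) ω (T.x (n + 1) ω) ≤
      q.eval (2 * √(T.beta κ (n + 1) ω) * ⨆ w, T.std k v n ω (T.x (n + 1) ω) w)

/-- Cumulative regret `R†_t = ∑_{i=1}^t (F(x*) - F(xhat_i))`, where `F(x) = ρ(f(x, ·))`. -/
def cumRegret (ρ : (Ω → ℝ) → ℝ) (xstar : S → X) (t : ℕ) (ω : S) : ℝ :=
  ∑ i ∈ Finset.Icc 1 t, (ρ (T.path ω (xstar ω)) - ρ (T.path ω (T.xhat i ω)))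

end Run

end

end RobustBO

/-! In one round the regret is at most twice the error made by replacing `f(x, ·)` with `f(x,
[·]_t)`, plus the gap of the discretized problem (`Run.regret_le_gap`). Both parts are bounded in
expectation. Sums over the rounds pass through the concave functions by Jensen's inequality in
supporting-line form: `IsConcaveModulus.exists_affine_majorant` replaces a concave function by an
affine one touching it at the claimed argument, after which only linear estimates of expectations
are needed.

Discretization error. A continuous function on a convex body whose partial derivatives are bounded
by `L` in the interior is `L`-Lipschitz for the `ℓ¹` distance (`abs_sub_le_of_partialDeriv_le`), and
rounding moves a point by at most `d r / τ_t` in that distance. The common Lipschitz constant of the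
functions `f(x, ·)` inherits the sub-Gaussian tail with prefactor `a₂ d |𝒳|`, so its mean is at most
`b₂ (√(log (a₂ d |𝒳|)) + √π / 2)`. The choice of `τ_t` makes the mean error argument at most `1 /
t²`, and `∑ 1 / t² ≤ π² / 6`.

Gap. With the earlier data held fixed, the posterior probability that `f` leaves the band of
half-width `√(2 log κ_t + s) σ_{t-1}` at one of at most `κ_t` points is at most `κ_t exp(-(2 log κ_t
+ s) / 2) = exp(-s / 2)`. This is exactly the probability that `ξ_t > s`. Inside the band the gap is
at most twice the width of the bounds at the evaluated point (`Run.IsAlgorithm.gap_le`). Since the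
estimated solution depends on the history only, the gap does not involve `ξ_t`; it is therefore
stochastically dominated by the bound at the random level `ξ_t`, and no failure probability remains
(`lintegral_le_of_chiSquared_domination`, `IsAdaptiveExperiment.lintegral_le`).

Adaptivity. The law of the unknown function together with the data has the likelihood as density
with respect to the law of `f` times a reference measure for the data
(`IsAdaptiveExperiment.lintegral_data`). Once the data are fixed the evaluation points are fixed
too, and the fixed-design tail bound `lintegral_posterior_tail_le` applies. It must hold for every
vector of observed values, because the design varies with the data.

Widths. Hölder's inequality separates `β_t` from the posterior variances at the evaluated points.
Their sum is at most `C₁ γ_t`, by the chain rule for the determinant of the information matrix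
(`IsPosSemidefKernel.sum_posteriorVar_le`). -/

section

open MeasureTheory ProbabilityTheory Set Filter Topology
open scoped ENNReal NNReal

namespace RobustBO

/-! ### Concave moduli -/

/-- A concave modulus lies below an affine function touching it at `M`. -/
lemma IsConcaveModulus.exists_affine_majorant {h : ℝ → ℝ} (hh : IsConcaveModulus h) {M : ℝ}
    (hM : 0 ≤ M) : ∃ c, 0 ≤ c ∧ ∀ x, 0 ≤ x → (M = 0 → x = 0) → h x ≤ h M + c * (x - M) := by
  rcases hM.eq_or_lt with rfl | hM
  -- At `0` a concave modulus such as the square root has no finite supporting slope, so for `M = 0`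
  -- only `x = 0` is covered.
  · refine ⟨0, le_rfl, fun x _ h0 => ?_⟩
    simp [h0 rfl]
  -- The infimum of the secant slopes to the left of `M` is a supergradient at `M`; monotonicity
  -- makes it non-negative.
  set A : Set ℝ := (fun x => (h M - h x) / (M - x)) '' Ico 0 M
  have hA : A.Nonempty := ⟨_, 0, ⟨le_rfl, hM⟩, rfl⟩
  have h0 : ∀ y ∈ A, 0 ≤ y := by
    rintro _ ⟨x, ⟨hx0, hxM⟩, rfl⟩
    exact div_nonneg (sub_nonneg.2 (hh.mono hx0 hM.le hxM.le)) (sub_nonneg.2 hxM.le)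
  refine ⟨sInf A, Real.sInf_nonneg h0, fun x hx _ => ?_⟩
  rcases lt_trichotomy x M with hlt | rfl | hlt
  · have h1 : sInf A ≤ (h M - h x) / (M - x) := csInf_le ⟨0, h0⟩ ⟨x, ⟨hx, hlt⟩, rfl⟩
    rw [le_div_iff₀ (sub_pos.2 hlt)] at h1
    linarith
  · simp
  · have h1 : (h x - h M) / (x - M) ≤ sInf A := by
      refine le_csInf hA ?_
      rintro _ ⟨z, ⟨hz0, hzM⟩, rfl⟩
      exact hh.concave.slope_anti_adjacent hz0 hx hzM hlt
    rw [div_le_iff₀ (sub_pos.2 hlt)] at h1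
    linarith

lemma IsConcaveModulus.nonneg {h : ℝ → ℝ} (hh : IsConcaveModulus h) {x : ℝ} (hx : 0 ≤ x) :
    0 ≤ h x := hh.zero ▸ hh.mono (Set.mem_Ici.2 le_rfl) hx hx

lemma QFun.inner_nonneg (q : QFun) {a : ℝ} (ha : 0 ≤ a) (i : Fin q.n) :
    0 ≤ ∑ j, q.lam i j * a ^ q.ν i j :=
  Finset.sum_nonneg fun j _ => mul_nonneg (q.lam_nonneg i j) (Real.rpow_nonneg ha _)

lemma QFun.eval_nonneg (q : QFun) {a : ℝ} (ha : 0 ≤ a) : 0 ≤ q.eval a :=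
  Finset.sum_nonneg fun i _ => mul_nonneg (q.ζ_nonneg i) ((q.h_mod i).nonneg (q.inner_nonneg ha i))

/-! ### Gaussian tails -/

/-- Shift by `a` and use `(x + a)² ≥ x² + a²` for `x, a ≥ 0`. -/
lemma setLIntegral_Ioi_exp_neg_sq_le {a b : ℝ} (ha : 0 ≤ a) (hb : 0 < b) :
    ∫⁻ x in Ioi a, ENNReal.ofReal (Real.exp (-b * x ^ 2)) ≤
      ENNReal.ofReal (Real.exp (-b * a ^ 2)) *
        ∫⁻ x in Ioi (0 : ℝ), ENNReal.ofReal (Real.exp (-b * x ^ 2)) := by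
  rw [← lintegral_indicator measurableSet_Ioi, ← lintegral_add_right_eq_self _ a,
    ← lintegral_const_mul' _ _ ENNReal.ofReal_ne_top, ← lintegral_indicator measurableSet_Ioi]
  refine lintegral_mono fun x => ?_
  by_cases hx : 0 < x
  · have h1 : x + a ∈ Ioi a := by simpa using hx
    rw [indicator_of_mem h1, indicator_of_mem (mem_Ioi.2 hx),
      ← ENNReal.ofReal_mul (Real.exp_nonneg _), ← Real.exp_add]
    refine ENNReal.ofReal_le_ofReal (Real.exp_le_exp.2 ?_)
    have : 0 ≤ b * (x * a) := by positivity
    nlinarith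
  · have h1 : x + a ∉ Ioi a := by simpa using hx
    rw [indicator_of_notMem h1]
    exact zero_le

lemma setLIntegral_Ioi_zero_exp_neg_sq {b : ℝ} (hb : 0 < b) :
    ∫⁻ x in Ioi (0 : ℝ), ENNReal.ofReal (Real.exp (-b * x ^ 2)) =
      ENNReal.ofReal (√(Real.pi / b) / 2) := by
  rw [← integral_gaussian_Ioi, ofReal_integral_eq_lintegral_ofReal]
  · exact (integrable_exp_neg_mul_sq hb).integrableOn
  · exact ae_of_all _ fun x => Real.exp_nonneg _

/-- Keeping the mass of the half-line as a factor lets the two-sided bound below have constant `1`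
instead of `2`. This matters because the tail has to match `exp (-s / 2)` exactly. -/
lemma gaussianReal_Ioi_le {w : ℝ≥0} (hw : w ≠ 0) {a : ℝ} (ha : 0 ≤ a) :
    gaussianReal 0 w (Ioi a) ≤
      ENNReal.ofReal (Real.exp (-a ^ 2 / (2 * w))) * gaussianReal 0 w (Ioi 0) := by
  have hw' : (0 : ℝ) < w := by positivity
  have key : ∀ s : ℝ, gaussianReal 0 w (Ioi s) = ENNReal.ofReal (√(2 * Real.pi * w))⁻¹ *
      ∫⁻ x in Ioi s, ENNReal.ofReal (Real.exp (-(1 / (2 * (w : ℝ))) * x ^ 2)) := by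
    intro s
    rw [gaussianReal_apply _ hw, ← lintegral_const_mul' _ _ ENNReal.ofReal_ne_top]
    refine lintegral_congr fun x => ?_
    rw [gaussianPDF, gaussianPDFReal, ← ENNReal.ofReal_mul (by positivity)]
    congr 3
    field_simp
    ring
  rw [key, key, mul_left_comm]
  gcongr
  refine (setLIntegral_Ioi_exp_neg_sq_le ha (by positivity)).trans (le_of_eq ?_)
  congr 3
  field_simp

lemma gaussianReal_abs_gt_le (w : ℝ≥0) {c : ℝ} (hc : 0 ≤ c) :
    gaussianReal 0 w {x | c * √w < |x|} ≤ ENNReal.ofReal (Real.exp (-c ^ 2 / 2)) := by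
  rcases eq_or_ne w 0 with rfl | hw
  · simp
  have hw' : (0 : ℝ) < w := by positivity
  have hneg : ∀ s : ℝ, gaussianReal 0 w (Iio (-s)) = gaussianReal 0 w (Ioi s) := by
    intro s
    have h := gaussianReal_map_neg (μ := 0) (v := w)
    rw [neg_zero] at h
    conv_rhs => rw [← h, Measure.map_apply measurable_neg measurableSet_Ioi]
    congr 1
    ext x
    simp
  have hset : {x : ℝ | c * √w < |x|} = Ioi (c * √w) ∪ Iio (-(c * √w)) := by
    ext x
    simp [lt_abs, lt_neg]
  have hhalf : gaussianReal 0 w (Ioi 0) + gaussianReal 0 w (Ioi 0) ≤ 1 := by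
    have h0 := hneg 0
    rw [neg_zero] at h0
    nth_rewrite 2 [← h0]
    rw [← measure_union _ measurableSet_Iio]
    · exact prob_le_one
    · exact Set.disjoint_left.2 fun x hx hx' => lt_asymm (mem_Ioi.1 hx) (mem_Iio.1 hx')
  have he : Real.exp (-(c * √(w : ℝ)) ^ 2 / (2 * w)) = Real.exp (-c ^ 2 / 2) := by
    rw [mul_pow, Real.sq_sqrt hw'.le]
    congr 1
    field_simp
  have h1 := gaussianReal_Ioi_le hw (a := c * √w) (by positivity)
  rw [he] at h1
  calc gaussianReal 0 w {x | c * √w < |x|}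
      ≤ gaussianReal 0 w (Ioi (c * √w)) + gaussianReal 0 w (Iio (-(c * √w))) := by
        rw [hset]; exact measure_union_le _ _
    _ ≤ ENNReal.ofReal (Real.exp (-c ^ 2 / 2)) *
          (gaussianReal 0 w (Ioi 0) + gaussianReal 0 w (Ioi 0)) := by
        rw [hneg, mul_add]
        exact add_le_add h1 h1
    _ ≤ _ := mul_le_of_le_one_right' hhalf

/-! ### The chi-squared distribution with two degrees of freedom -/

lemma chiSquared_two : chiSquared 2 = expMeasure (1 / 2) := by
  simp [chiSquared, expMeasure]

instance : IsProbabilityMeasure (chiSquared 2) := by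
  rw [chiSquared_two]
  exact isProbabilityMeasure_expMeasure (by norm_num)

/-- Two degrees of freedom give the exponential law of rate `1 / 2`, whose tail coincides with the
failure probability of the confidence band at level `s`. -/
lemma chiSquared_two_Ioi {s : ℝ} (hs : 0 ≤ s) :
    chiSquared 2 (Ioi s) = ENNReal.ofReal (Real.exp (-s / 2)) := by
  have h1 := cdf_expMeasure_eq (r := 1 / 2) (by norm_num) s
  rw [← chiSquared_two, cdf_eq_real, if_pos hs] at h1
  rw [← ofReal_measureReal, ← compl_Iic, probReal_compl_eq_one_sub measurableSet_Iic, h1]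
  congr 1
  ring_nf

lemma chiSquared_two_ae_nonneg : ∀ᵐ s ∂chiSquared 2, 0 ≤ s := by
  have h1 := chiSquared_two_Ioi le_rfl
  simp only [neg_zero, zero_div, Real.exp_zero, ENNReal.ofReal_one] at h1
  have h2 : ∀ᵐ s ∂chiSquared 2, s ∈ Ioi (0 : ℝ) := (prob_compl_eq_zero_iff measurableSet_Ioi).2 h1
  filter_upwards [h2] with s hs using le_of_lt hs

lemma integrable_rpow_chiSquared_two {p : ℝ} (hp : 0 ≤ p) :
    Integrable (fun s => s ^ p) (chiSquared 2) := by
  rw [chiSquared_two, expMeasure, gammaMeasure]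
  rw [integrable_withDensity_iff_integrable_smul' (f := gammaPDF 1 (1 / 2))
    (measurable_gammaPDFReal 1 (1 / 2)).ennreal_ofReal (ae_of_all _ fun x => ENNReal.ofReal_lt_top)]
  have h1 : IntegrableOn (fun x : ℝ => x ^ p * Real.exp (-(1 / 2) * x)) (Ioi 0) := by
    have := integrableOn_rpow_mul_exp_neg_mul_rpow (p := 1) (s := p) (b := 1 / 2)
      (by linarith) one_pos (by norm_num)
    simpa using this
  have h2 := ((integrable_indicator_iff measurableSet_Ioi).2 h1).const_mul (1 / 2 : ℝ)
  refine h2.congr ?_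
  have h3 : ∀ᵐ x : ℝ, x ≠ 0 := by simp [ae_iff]
  filter_upwards [h3] with x hx
  rcases lt_or_gt_of_ne hx with hx | hx
  · rw [indicator_of_notMem (by simpa using hx.le), gammaPDF_of_neg hx]
    simp
  · rw [indicator_of_mem (mem_Ioi.2 hx), gammaPDF_of_nonneg hx.le, ENNReal.toReal_ofReal]
    · simp
      ring
    · simp
      positivity

lemma integrable_add_rpow_chiSquared_two {a p : ℝ} (ha : 0 ≤ a) (hp : 0 ≤ p) :
    Integrable (fun s => (a + s) ^ p) (chiSquared 2) := by
  have h1 : Integrable (fun s : ℝ => (2 * a) ^ p + 2 ^ p * s ^ p) (chiSquared 2) :=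
    (integrable_const _).add ((integrable_rpow_chiSquared_two hp).const_mul _)
  refine h1.mono' (by fun_prop) ?_
  filter_upwards [chiSquared_two_ae_nonneg] with s hs
  rw [Real.norm_of_nonneg (by positivity), ← Real.mul_rpow zero_le_two hs]
  rcases le_total a s with h | h
  · exact (Real.rpow_le_rpow (by positivity) (by linarith : a + s ≤ 2 * s) hp).trans
      (le_add_of_nonneg_left (by positivity))
  · exact (Real.rpow_le_rpow (by positivity) (by linarith : a + s ≤ 2 * a) hp).trans
      (le_add_of_nonneg_right (by positivity))

/-- If `W` exceeds `B s` with relative mass at most `exp (-s / 2)`, then `W` is stochastically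
dominated by `B ξ`, where `ξ` is chi-squared with two degrees of freedom. -/
lemma lintegral_le_of_chiSquared_domination {E : Type*} [MeasurableSpace E] (m : Measure E)
    [IsFiniteMeasure m] {W : E → ℝ} (hW : Measurable W) {B : ℝ → ℝ}
    (hB : Measurable B)
    (h : ∀ᵐ s ∂chiSquared 2, m {e | B s < W e} ≤ ENNReal.ofReal (Real.exp (-s / 2)) * m univ) :
    ∫⁻ e, ENNReal.ofReal (W e) ∂m ≤ m univ * ∫⁻ s, ENNReal.ofReal (B s) ∂chiSquared 2 := by
  have e1 : ∫⁻ e, ENNReal.ofReal (W e) ∂m = ∫⁻ e, ENNReal.ofReal (max (W e) 0) ∂m := by simp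
  have e2 : ∫⁻ s, ENNReal.ofReal (B s) ∂chiSquared 2 =
    ∫⁻ s, ENNReal.ofReal (max (B s) 0) ∂chiSquared 2 := by simp
  rw [e1, e2, lintegral_eq_lintegral_meas_lt (f := fun e => max (W e) 0) _
      (ae_of_all _ fun _ => le_max_right _ _) (by fun_prop),
    lintegral_eq_lintegral_meas_lt (f := fun s => max (B s) 0) _
      (ae_of_all _ fun _ => le_max_right _ _) (by fun_prop), ← lintegral_const_mul' _ _ (measure_ne_top _ _)]
  -- By the layer-cake formula it suffices to compare the tails at each level `c > 0`.
  refine setLIntegral_mono' measurableSet_Ioi fun c (hc : 0 < c) => ?_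
  have hcW : {e | c < max (W e) 0} = {e | c < W e} := by ext; simp [hc.not_gt]
  have hcB : {e | c < max (B e) 0} = {e | c < B e} := by ext; simp [hc.not_gt]
  rw [hcW, hcB]
  set α := m {e | c < W e} with hα
  set Z := m univ with hZ
  rcases eq_or_ne α 0 with h0 | h0
  · rw [h0]; exact zero_le
  have hαZ : α ≤ Z := measure_mono (subset_univ _)
  have hZtop : Z ≠ ⊤ := measure_ne_top _ _
  have hαtop : α ≠ ⊤ := measure_ne_top _ _
  have hZ0 : Z ≠ 0 := fun h => h0 (le_antisymm (h ▸ hαZ) zero_le)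
  have hαr : 0 < α.toReal := ENNReal.toReal_pos h0 hαtop
  have hZr : 0 < Z.toReal := ENNReal.toReal_pos hZ0 hZtop
  set u := α.toReal / Z.toReal with hu
  have hu0 : 0 < u := div_pos hαr hZr
  have hu1 : u ≤ 1 := (div_le_one hZr).2 ((ENNReal.toReal_le_toReal hαtop hZtop).2 hαZ)
  have hlog : Real.log u ≤ 0 := Real.log_nonpos hu0.le hu1
  -- Here `u` is the relative mass of `{c < W}`. If `B s ≤ c`, this mass is at most `exp (-s / 2)`,
  -- hence `s ≤ -2 log u`. The chi-squared tail at `-2 log u` is exactly `u`.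
  have hs : ∀ᵐ s ∂chiSquared 2, s ∈ Ioi (-2 * Real.log u) → s ∈ {s | c < B s} := by
    filter_upwards [h] with s hs1 hs2
    by_contra hcon
    have hcon : B s ≤ c := not_lt.1 hcon
    have h3 : α ≤ ENNReal.ofReal (Real.exp (-s / 2)) * Z :=
      le_trans (measure_mono fun e he => lt_of_le_of_lt hcon he) hs1
    have h4 : α.toReal ≤ Real.exp (-s / 2) * Z.toReal := by
      have := ENNReal.toReal_mono (ENNReal.mul_ne_top ENNReal.ofReal_ne_top hZtop) h3
      rwa [ENNReal.toReal_mul, ENNReal.toReal_ofReal (Real.exp_nonneg _)] at this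
    have h5 : u ≤ Real.exp (-s / 2) := (div_le_iff₀ hZr).2 h4
    have h6 := (Real.log_le_iff_le_exp hu0).2 h5
    have h7 : -2 * Real.log u < s := hs2
    linarith
  have h1 : ENNReal.ofReal u ≤ chiSquared 2 {s | c < B s} := by
    have h2 := measure_mono_ae (s := Ioi (-2 * Real.log u)) (t := {s | c < B s}) hs
    rwa [chiSquared_two_Ioi (by linarith), show -(-2 * Real.log u) / 2 = Real.log u by ring,
      Real.exp_log hu0] at h2
  calc α = Z * ENNReal.ofReal u := by
        rw [hu, ENNReal.ofReal_div_of_pos hZr, ENNReal.ofReal_toReal hαtop,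
          ENNReal.ofReal_toReal hZtop, ENNReal.mul_div_cancel hZ0 hZtop]
    _ ≤ _ := by gcongr

end RobustBO

namespace RobustBO

/-! ### Posterior variances and information gain. -/

section Kernel

variable {Q : Type*}

/-- `k` is a positive semidefinite kernel. -/
structure IsPosSemidefKernel (k : Q → Q → ℝ) : Prop where
  symm : ∀ p p', k p p' = k p' p
  gram_posSemidef : ∀ {n : ℕ} (z : Fin n → Q), (gram k z).PosSemidef

variable {k : Q → Q → ℝ}

lemma IsPosSemidefKernel.posDef_gram_add (hk : IsPosSemidefKernel k) {v : ℝ} (hv : 0 < v) {n : ℕ}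
    (z : Fin n → Q) : (gram k z + v • (1 : Matrix (Fin n) (Fin n) ℝ)).PosDef :=
  Matrix.PosDef.posSemidef_add (hk.gram_posSemidef z) (Matrix.PosDef.one.smul hv)

lemma posteriorVar_eq_schur (k : Q → Q → ℝ) (v : ℝ) {n : ℕ} (z : Fin n → Q) (p : Q) (i j : Fin 1) :
    (Matrix.of (fun _ _ => k p p) - (Matrix.of fun (_ : Fin 1) j => k p (z j)) *
      (gram k z + v • (1 : Matrix (Fin n) (Fin n) ℝ))⁻¹ *
      (Matrix.of fun i (_ : Fin 1) => k p (z i)) : Matrix (Fin 1) (Fin 1) ℝ) i j =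
    posteriorVar k v z p := by
  rw [posteriorVar, Matrix.mul_assoc]
  rfl

lemma gram_snoc_submatrix (hsymm : ∀ p p', k p p' = k p' p) {n : ℕ} (z : Fin n → Q) (p : Q) :
    (gram k (Fin.snoc z p : Fin (n + 1) → Q)).submatrix finSumFinEquiv finSumFinEquiv =
      Matrix.fromBlocks (gram k z) (Matrix.of fun i (_ : Fin 1) => k p (z i))
        (Matrix.of fun (_ : Fin 1) j => k p (z j)) (Matrix.of fun _ _ => k p p) := by
  ext i j
  rcases i with i | i <;> rcases j with j | j
  · have h1 : ∀ i : Fin n, (Fin.snoc z p : Fin (n + 1) → Q) (Fin.castAdd 1 i) = z i :=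
      fun i => Fin.snoc_castSucc (α := fun _ => Q) p z i
    simp [gram, h1]
  · have h1 : ∀ i : Fin n, (Fin.snoc z p : Fin (n + 1) → Q) (Fin.castAdd 1 i) = z i :=
      fun i => Fin.snoc_castSucc (α := fun _ => Q) p z i
    have h2 : ∀ i : Fin 1, (Fin.snoc z p : Fin (n + 1) → Q) (Fin.natAdd n i) = p := by
      intro i
      rw [Subsingleton.elim i 0]
      exact Fin.snoc_last (α := fun _ => Q) p z
    simpa [gram, h1, h2] using hsymm _ _
  · have h1 : ∀ i : Fin n, (Fin.snoc z p : Fin (n + 1) → Q) (Fin.castAdd 1 i) = z i :=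
      fun i => Fin.snoc_castSucc (α := fun _ => Q) p z i
    have h2 : ∀ i : Fin 1, (Fin.snoc z p : Fin (n + 1) → Q) (Fin.natAdd n i) = p := by
      intro i
      rw [Subsingleton.elim i 0]
      exact Fin.snoc_last (α := fun _ => Q) p z
    simp [gram, h1, h2]
  · have h2 : ∀ i : Fin 1, (Fin.snoc z p : Fin (n + 1) → Q) (Fin.natAdd n i) = p := by
      intro i
      rw [Subsingleton.elim i 0]
      exact Fin.snoc_last (α := fun _ => Q) p z
    simp [gram, h2]

/-- The posterior variance is the Schur complement of the observed block in the kernel matrix of the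
design extended by `p`. -/
lemma IsPosSemidefKernel.posteriorVar_nonneg (hk : IsPosSemidefKernel k) {v : ℝ} (hv : 0 < v)
    {n : ℕ} (z : Fin n → Q) (p : Q) : 0 ≤ posteriorVar k v z p := by
  have hA := hk.posDef_gram_add hv z
  have := hA.isUnit.invertible
  have h1 := (hk.gram_posSemidef (Fin.snoc z p : Fin (n + 1) → Q)).submatrix finSumFinEquiv
  rw [gram_snoc_submatrix hk.symm] at h1
  -- The noise variance is added on the observed block only, so the corner entry stays `k p p`.
  have h2 : (Matrix.fromBlocks (v • (1 : Matrix (Fin n) (Fin n) ℝ)) 0 0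
      (0 : Matrix (Fin 1) (Fin 1) ℝ)).PosSemidef := by
    have : Matrix.fromBlocks (v • (1 : Matrix (Fin n) (Fin n) ℝ)) 0 0
        (0 : Matrix (Fin 1) (Fin 1) ℝ) =
        Matrix.diagonal (Sum.elim (fun _ => v) (fun _ => 0)) := by
      ext i j
      rcases i with i | i <;> rcases j with j | j <;>
        simp [Matrix.diagonal_apply, Matrix.one_apply]
    rw [this, Matrix.posSemidef_diagonal_iff]
    rintro (i | i) <;> simp [hv.le]
  have h3 := h1.add h2
  rw [Matrix.fromBlocks_add, add_zero, add_zero, add_zero] at h3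
  have h4 := (Matrix.PosDef.fromBlocks₁₁ (m := Fin n) (n := Fin 1)
    (Matrix.of fun i (_ : Fin 1) => k p (z i)) (Matrix.of fun _ _ => k p p) hA).1 h3
  have h5 := h4.diag_nonneg (i := 0)
  rwa [← posteriorVar_eq_schur k v z p 0 0]

lemma IsPosSemidefKernel.posteriorVar_le (hk : IsPosSemidefKernel k) {v : ℝ} (hv : 0 < v)
    {n : ℕ} (z : Fin n → Q) (p : Q) : posteriorVar k v z p ≤ k p p := by
  have h := (hk.posDef_gram_add hv z).inv.posSemidef.dotProduct_mulVec_nonneg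
    (fun j => k p (z j))
  rw [posteriorVar]
  simp only [star_trivial] at h
  linarith

lemma one_add_inv_smul_gram {v : ℝ} (hv : 0 < v) {n : ℕ} (z : Fin n → Q) :
    (1 + v⁻¹ • gram k z : Matrix (Fin n) (Fin n) ℝ) =
      v⁻¹ • (gram k z + v • (1 : Matrix (Fin n) (Fin n) ℝ)) := by
  rw [smul_add, smul_smul, inv_mul_cancel₀ hv.ne', one_smul, add_comm]

lemma IsPosSemidefKernel.det_pos (hk : IsPosSemidefKernel k) {v : ℝ} (hv : 0 < v) {n : ℕ}
    (z : Fin n → Q) : 0 < (1 + v⁻¹ • gram k z : Matrix (Fin n) (Fin n) ℝ).det := by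
  rw [one_add_inv_smul_gram hv]
  exact ((hk.posDef_gram_add hv z).smul (inv_pos.2 hv)).det_pos

/-- Chain rule for the determinant of the information matrix. -/
lemma IsPosSemidefKernel.det_snoc (hk : IsPosSemidefKernel k) {v : ℝ} (hv : 0 < v) {n : ℕ}
    (z : Fin n → Q) (p : Q) :
    (1 + v⁻¹ • gram k (Fin.snoc z p : Fin (n + 1) → Q) : Matrix (Fin (n + 1)) (Fin (n + 1)) ℝ).det =
      (1 + v⁻¹ • gram k z : Matrix (Fin n) (Fin n) ℝ).det * (1 + posteriorVar k v z p / v) := by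
  have hA := hk.posDef_gram_add hv z
  have := hA.isUnit.invertible
  have hblock : (gram k (Fin.snoc z p : Fin (n + 1) → Q) +
      v • (1 : Matrix (Fin (n + 1)) (Fin (n + 1)) ℝ)).submatrix finSumFinEquiv finSumFinEquiv =
      Matrix.fromBlocks (gram k z + v • (1 : Matrix (Fin n) (Fin n) ℝ))
        (Matrix.of fun i (_ : Fin 1) => k p (z i))
        (Matrix.of fun (_ : Fin 1) j => k p (z j))
        (Matrix.of (fun _ _ => k p p) + v • (1 : Matrix (Fin 1) (Fin 1) ℝ)) := by
    rw [Matrix.submatrix_add, Pi.add_apply, Pi.add_apply, gram_snoc_submatrix hk.symm,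
      Matrix.submatrix_smul, Pi.smul_apply, Pi.smul_apply, Matrix.submatrix_one_equiv,
      ← Matrix.fromBlocks_one, Matrix.fromBlocks_smul, Matrix.fromBlocks_add]
    simp
  -- With `v` on the whole diagonal the Schur complement of the observed block becomes the posterior
  -- variance plus `v`.
  have h1 : (gram k (Fin.snoc z p : Fin (n + 1) → Q) +
      v • (1 : Matrix (Fin (n + 1)) (Fin (n + 1)) ℝ)).det =
      (gram k z + v • (1 : Matrix (Fin n) (Fin n) ℝ)).det * (posteriorVar k v z p + v) := by
    rw [← Matrix.det_submatrix_equiv_self (finSumFinEquiv (m := n) (n := 1)), hblock,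
      Matrix.det_fromBlocks₁₁, Matrix.det_fin_one, ← posteriorVar_eq_schur k v z p 0 0,
      Matrix.invOf_eq_nonsing_inv]
    simp
    ring_nf
    tauto
  rw [one_add_inv_smul_gram hv, one_add_inv_smul_gram hv, Matrix.det_smul, Matrix.det_smul, h1]
  simp only [Fintype.card_fin, pow_succ]
  field_simp
  ring

lemma IsPosSemidefKernel.log_det_eq_sum (hk : IsPosSemidefKernel k) {v : ℝ} (hv : 0 < v)
    (pt : ℕ → Q) (n : ℕ) :
    Real.log (1 + v⁻¹ • gram k (fun i : Fin n => pt i) : Matrix (Fin n) (Fin n) ℝ).det =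
      ∑ i ∈ Finset.range n,
        Real.log (1 + posteriorVar k v (fun j : Fin i => pt j) (pt i) / v) := by
  induction n with
  | zero => simp
  | succ n ih =>
    have h1 : (fun i : Fin (n + 1) => pt i) = Fin.snoc (fun i : Fin n => pt i) (pt n) := by
      ext i
      refine Fin.lastCases ?_ (fun j => ?_) i <;> simp
    have h2 := hk.posteriorVar_nonneg hv (fun j : Fin n => pt j) (pt n)
    rw [Finset.sum_range_succ, ← ih, h1, hk.det_snoc hv, Real.log_mul (hk.det_pos hv _).ne']
    positivity

/-- Needed because a real supremum over an unbounded family has the default value `0`. Each factor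
of the chain rule contributes at most `log (1 + 1 / v) ≤ 1 / v`. -/
lemma IsPosSemidefKernel.bddAbove_log_det (hk : IsPosSemidefKernel k) (hk1 : ∀ p, k p p ≤ 1)
    {v : ℝ} (hv : 0 < v) (n : ℕ) :
    BddAbove (range fun z : Fin n → Q =>
      Real.log (1 + v⁻¹ • gram k z : Matrix (Fin n) (Fin n) ℝ).det) := by
  refine ⟨n * (1 / v), ?_⟩
  rintro _ ⟨z, rfl⟩
  rcases isEmpty_or_nonempty Q with hQ | ⟨⟨q0⟩⟩
  · cases n with
    | zero => simp
    | succ n => exact hQ.elim (z 0)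
  obtain ⟨pt, hpt⟩ : ∃ pt : ℕ → Q, z = fun i : Fin n => pt i :=
    ⟨fun m => if h : m < n then z ⟨m, h⟩ else q0, by ext i; simp⟩
  dsimp only
  rw [hpt, hk.log_det_eq_sum hv]
  refine (Finset.sum_le_card_nsmul _ _ (1 / v) fun i _ => ?_).trans (by simp)
  have h2 := hk.posteriorVar_nonneg hv (fun j : Fin i => pt j) (pt i)
  have h3 := (hk.posteriorVar_le hv (fun j : Fin i => pt j) (pt i)).trans (hk1 _)
  refine (Real.log_le_sub_one_of_pos (by positivity)).trans ?_
  rw [add_sub_cancel_left]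
  gcongr

/-- By concavity of the logarithm, `s ↦ log (1 + s / v)` lies above its chord on `[0, 1]`. This is
where `k(p, p) ≤ 1` enters the constant `C₁`. -/
lemma le_log_div_log {s v : ℝ} (hv : 0 < v) (hs0 : 0 ≤ s) (hs1 : s ≤ 1) :
    s ≤ Real.log (1 + s / v) / Real.log (1 + v⁻¹) := by
  have hv' : 0 < v⁻¹ := inv_pos.2 hv
  have hlog : 0 < Real.log (1 + v⁻¹) := Real.log_pos (by linarith)
  rw [le_div_iff₀ hlog]
  have h := strictConcaveOn_log_Ioi.concaveOn.2 (mem_Ioi.2 one_pos)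
    (mem_Ioi.2 (by linarith : 0 < 1 + v⁻¹)) (sub_nonneg.2 hs1) hs0 (by ring)
  simp only [smul_eq_mul, Real.log_one, mul_zero, zero_add] at h
  refine h.trans (le_of_eq ?_)
  congr 1
  field_simp
  ring

/-- The posterior variances of the evaluated points are bounded by the information gain. -/
lemma IsPosSemidefKernel.sum_posteriorVar_le (hk : IsPosSemidefKernel k) (hk1 : ∀ p, k p p ≤ 1)
    {v : ℝ} (hv : 0 < v) (pt : ℕ → Q) (n : ℕ) :
    ∑ i ∈ Finset.range n, posteriorVar k v (fun j : Fin i => pt j) (pt i) ≤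
      2 / Real.log (1 + v⁻¹) * maxInfoGain k v n := by
  have hlog : 0 < Real.log (1 + v⁻¹) := Real.log_pos (by have := inv_pos.2 hv; linarith)
  calc ∑ i ∈ Finset.range n, posteriorVar k v (fun j : Fin i => pt j) (pt i)
      ≤ ∑ i ∈ Finset.range n, Real.log (1 + posteriorVar k v (fun j : Fin i => pt j) (pt i) / v) /
          Real.log (1 + v⁻¹) :=
        Finset.sum_le_sum fun i _ => le_log_div_log hv (hk.posteriorVar_nonneg hv _ _)
          ((hk.posteriorVar_le hv _ _).trans (hk1 _))
    _ = Real.log (1 + v⁻¹ • gram k (fun i : Fin n => pt i) : Matrix (Fin n) (Fin n) ℝ).det /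
          Real.log (1 + v⁻¹) := by rw [hk.log_det_eq_sum hv, Finset.sum_div]
    _ ≤ (⨆ z : Fin n → Q, Real.log (1 + v⁻¹ • gram k z : Matrix (Fin n) (Fin n) ℝ).det) /
          Real.log (1 + v⁻¹) := by
        gcongr
        exact le_ciSup (hk.bddAbove_log_det hk1 hv n) fun i : Fin n => pt i
    _ = _ := by rw [maxInfoGain]; ring

end Kernel

end RobustBO

namespace RobustBO

/-! ### Products of Gaussian densities -/

lemma lintegral_pi_fin_prod_mul {α : Type*} [MeasurableSpace α] (μ : Measure α) [SigmaFinite μ]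
    (n : ℕ) {g : Fin n → α → ℝ≥0∞} (hg : ∀ i, Measurable (g i)) :
    ∫⁻ x, ∏ i, g i (x i) ∂Measure.pi (fun _ : Fin n => μ) = ∏ i, ∫⁻ x, g i x ∂μ := by
  induction n with
  | zero => simp
  | succ n ih =>
    have hmp := (measurePreserving_piFinSuccAbove (fun _ : Fin (n + 1) => μ) 0).symm
    have hm : Measurable fun x : Fin (n + 1) → α => ∏ i, g i (x i) :=
      Finset.measurable_prod _ fun i _ => (hg i).comp (measurable_pi_apply i)
    have hm' : Measurable fun x : Fin n → α => ∏ i : Fin n, g i.succ (x i) :=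
      Finset.measurable_prod _ fun i _ => (hg i.succ).comp (measurable_pi_apply i)
    rw [← hmp.lintegral_comp hm]
    simp only [Fin.prod_univ_succ]
    rw [← ih (fun i => hg i.succ), ← lintegral_prod_mul (hg 0).aemeasurable hm'.aemeasurable]
    refine lintegral_congr fun z => ?_
    simp [MeasurableEquiv.piFinSuccAbove_symm_apply, Fin.insertNthEquiv]

/-- The likelihood of the observations `y` given the means `m`, for noise variance `v`. -/
noncomputable def likelihood {n : ℕ} (v : ℝ≥0) (m y : Fin n → ℝ) : ℝ≥0∞ :=
  ∏ i, gaussianPDF (m i) v (y i)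

lemma measurable_gaussianPDF_uncurry (v : ℝ≥0) :
    Measurable fun z : ℝ × ℝ => gaussianPDF z.1 v z.2 := by
  unfold gaussianPDF gaussianPDFReal
  fun_prop

lemma measurable_gaussianPDF_comp {α : Type*} [MeasurableSpace α] {v : ℝ≥0} {f g : α → ℝ}
    (hf : Measurable f) (hg : Measurable g) : Measurable fun a => gaussianPDF (f a) v (g a) :=
  (measurable_gaussianPDF_uncurry v).comp (g := fun z : ℝ × ℝ => gaussianPDF z.1 v z.2)
    (f := fun a => (f a, g a)) (hf.prodMk hg)

lemma measurable_likelihood {α : Type*} [MeasurableSpace α] {v : ℝ≥0} {n : ℕ}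
    {f g : α → Fin n → ℝ} (hf : Measurable f) (hg : Measurable g) :
    Measurable fun a => likelihood v (f a) (g a) := by
  have h1 : ∀ i, Measurable fun a => gaussianPDF (f a i) v (g a i) := fun i =>
    measurable_gaussianPDF_comp hf.eval hg.eval
  exact Finset.measurable_fun_prod Finset.univ fun i _ => h1 i

lemma gaussianPDF_le (m : ℝ) (v : ℝ≥0) (x : ℝ) :
    gaussianPDF m v x ≤ ENNReal.ofReal (√(2 * Real.pi * v))⁻¹ := by
  refine ENNReal.ofReal_le_ofReal ?_
  rw [gaussianPDFReal]
  refine mul_le_of_le_one_right (by positivity) (Real.exp_le_one_iff.2 ?_)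
  rw [neg_div]
  exact neg_nonpos.2 (by positivity)

lemma likelihood_le {n : ℕ} (v : ℝ≥0) (m y : Fin n → ℝ) :
    likelihood v m y ≤ ENNReal.ofReal (√(2 * Real.pi * v))⁻¹ ^ n := by
  refine (Finset.prod_le_prod' fun i _ => gaussianPDF_le (m i) v (y i)).trans ?_
  simp

lemma continuous_likelihood {n : ℕ} (v : ℝ≥0) (m : Fin n → ℝ) : Continuous (likelihood v m) := by
  have h : ∀ i, Continuous fun y : Fin n → ℝ => gaussianPDFReal (m i) v (y i) := by
    intro i
    unfold gaussianPDFReal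
    fun_prop
  have h2 : likelihood v m = fun y => ENNReal.ofReal (∏ i, gaussianPDFReal (m i) v (y i)) := by
    ext y
    rw [ENNReal.ofReal_prod_of_nonneg fun i _ => gaussianPDFReal_nonneg _ _ _]
    rfl
  rw [h2]
  exact ENNReal.continuous_ofReal.comp (continuous_finsetProd _ fun i _ => h i)

lemma pi_gaussianReal_eq_withDensity {n : ℕ} {v : ℝ≥0} (hv : v ≠ 0) (m : Fin n → ℝ) :
    Measure.pi (fun i => gaussianReal (m i) v) =
      (Measure.pi fun _ : Fin n => (volume : Measure ℝ)).withDensity (likelihood v m) := by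
  refine Measure.pi_eq fun s hs => ?_
  rw [withDensity_apply _ (MeasurableSet.univ_pi hs),
    ← lintegral_indicator (MeasurableSet.univ_pi hs)]
  have h : ∀ y : Fin n → ℝ, (univ.pi s).indicator (likelihood v m) y =
      ∏ i, (s i).indicator (gaussianPDF (m i) v) (y i) := by
    intro y
    by_cases hy : y ∈ univ.pi s
    · rw [indicator_of_mem hy]
      refine Finset.prod_congr rfl fun i _ => ?_
      rw [indicator_of_mem (hy i (mem_univ i))]
    · rw [indicator_of_notMem hy]
      simp only [Set.mem_pi, mem_univ, true_implies, not_forall] at hy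
      obtain ⟨i, hi⟩ := hy
      rw [Finset.prod_eq_zero (Finset.mem_univ i)]
      rw [indicator_of_notMem hi]
  simp_rw [h]
  rw [lintegral_pi_fin_prod_mul _ _ fun i => (measurable_gaussianPDF _ _).indicator (hs i)]
  refine Finset.prod_congr rfl fun i _ => ?_
  rw [gaussianReal_apply _ hv, lintegral_indicator (hs i)]

/-! ### Gaussian process regression with fixed design -/

section FixedDesign

variable {Q S : Type*} [MeasurableSpace S] {P : Measure S} {f : Q → S → ℝ} {k : Q → Q → ℝ}

/-- The weights `(K + v I)⁻¹ k(p)` of the posterior mean. -/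
noncomputable def posteriorWeights (k : Q → Q → ℝ) (v : ℝ) {n : ℕ} (z : Fin n → Q) (p : Q) :
    Fin n → ℝ :=
  Matrix.vecMul (fun j => k p (z j)) (gram k z + v • (1 : Matrix (Fin n) (Fin n) ℝ))⁻¹

lemma posteriorMean_eq (k : Q → Q → ℝ) (v : ℝ) {n : ℕ} (z : Fin n → Q) (y : Fin n → ℝ) (p : Q) :
    posteriorMean k v z y p = ∑ i, posteriorWeights k v z p i * y i := by
  rw [posteriorMean, Matrix.dotProduct_mulVec]
  rfl

lemma posteriorVar_eq (k : Q → Q → ℝ) (v : ℝ) {n : ℕ} (z : Fin n → Q) (p : Q) :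
    posteriorVar k v z p = k p p - ∑ i, posteriorWeights k v z p i * k p (z i) := by
  rw [posteriorVar, Matrix.dotProduct_mulVec]
  rfl

/-- The normal equations: they say that the residual of the posterior mean is uncorrelated with
every observation. -/
lemma sum_posteriorWeights_mul (hk : IsPosSemidefKernel k) {v : ℝ} (hv : 0 < v) {n : ℕ}
    (z : Fin n → Q) (p : Q) (j : Fin n) :
    ∑ i, posteriorWeights k v z p i * (k (z i) (z j) + if i = j then v else 0) = k p (z j) := by
  have h1 : Matrix.vecMul (posteriorWeights k v z p)
      (gram k z + v • (1 : Matrix (Fin n) (Fin n) ℝ)) = fun j => k p (z j) := by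
    rw [posteriorWeights, Matrix.vecMul_vecMul,
      Matrix.nonsing_inv_mul _ ((Matrix.isUnit_iff_isUnit_det _).1 (hk.posDef_gram_add hv z).isUnit),
      Matrix.vecMul_one]
  have h2 := congrFun h1 j
  simp only [Matrix.vecMul, dotProduct, Matrix.add_apply, Matrix.smul_apply, Matrix.one_apply,
    gram, Matrix.of_apply, smul_eq_mul, mul_ite, mul_one, mul_zero] at h2
  simpa using h2

lemma isPosSemidefKernel_covariance (hf : IsGaussianProcess f P)
    (hcov : ∀ p p', covariance (f p) (f p') P = k p p') : IsPosSemidefKernel k where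
  symm p p' := by rw [← hcov, ← hcov, covariance_comm]
  gram_posSemidef {n} z := by
    have := hf.hasGaussianLaw ∅ |>.isProbabilityMeasure
    refine Matrix.PosSemidef.of_dotProduct_mulVec_nonneg ?_ fun x => ?_
    · ext i j
      simp [gram, ← hcov, covariance_comm]
    · have hm : ∀ i, MemLp (fun ω => x i * f (z i) ω) 2 P :=
        fun i => ((hf.hasGaussianLaw_eval (z i)).memLp_two).const_mul _
      have h1 := variance_nonneg (fun ω => ∑ i, x i * f (z i) ω) P
      rw [← covariance_self (memLp_finsetSum _ fun i _ => hm i).aestronglyMeasurable.aemeasurable,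
        covariance_fun_sum_fun_sum hm hm] at h1
      refine h1.trans (le_of_eq ?_)
      simp only [dotProduct, Matrix.mulVec, star_trivial, gram, Matrix.of_apply, Finset.mul_sum]
      refine Finset.sum_congr rfl fun i _ => Finset.sum_congr rfl fun j _ => ?_
      rw [covariance_const_mul_left, covariance_const_mul_right, hcov]
      ring

/-- The residual of the posterior mean is independent of the observations. -/
lemma residual_law [IsProbabilityMeasure P] (hfm : ∀ p, Measurable (f p))
    (hf : IsGaussianProcess f P)
    (hmean : ∀ p, ∫ ω, f p ω ∂P = 0) (hcov : ∀ p p', covariance (f p) (f p') P = k p p')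
    {v : ℝ≥0} (hv : 0 < v) {n : ℕ} (z : Fin n → Q) (p : Q) :
    let P' := P.prod (Measure.pi fun _ : Fin n => gaussianReal 0 v)
    let Y : S × (Fin n → ℝ) → Fin n → ℝ := fun ω j => f (z j) ω.1 + ω.2 j
    let R : S × (Fin n → ℝ) → ℝ := fun ω => f p ω.1 - posteriorMean k v z (Y ω) p
    IndepFun R Y P' ∧ P'.map R = gaussianReal 0 (posteriorVar k v z p).toNNReal := by
  intro P' Y R
  classical
  have hk := isPosSemidefKernel_covariance hf hcov
  have hv' : (0 : ℝ) < v := hv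
  set c := posteriorWeights k v z p with hc
  have hR : R = fun ω => f p ω.1 - ∑ i, c i * Y ω i := by
    ext ω
    simp only [R, posteriorMean_eq, hc]
  -- Only the values of `f` at these finitely many points matter; with the noise they form a
  -- Gaussian vector.
  let I : Finset Q := insert p (Finset.univ.image z)
  have hzI : ∀ j, z j ∈ I := fun j =>
    Finset.mem_insert_of_mem (Finset.mem_image_of_mem _ (Finset.mem_univ j))
  have hpI : p ∈ I := Finset.mem_insert_self _ _
  have hfst : MeasurePreserving (Prod.fst : S × (Fin n → ℝ) → S) P' P := measurePreserving_fst
  have hsnd : MeasurePreserving (Prod.snd : S × (Fin n → ℝ) → (Fin n → ℝ)) P'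
      (Measure.pi fun _ : Fin n => gaussianReal 0 v) := measurePreserving_snd
  have hN : HasGaussianLaw (fun ω : S × (Fin n → ℝ) => ω.2) P' := by
    have h1 : HasGaussianLaw (fun (e : Fin n → ℝ) i => e i)
        (Measure.pi fun _ : Fin n => gaussianReal 0 v) := by
      refine iIndepFun.hasGaussianLaw (X := fun i (e : Fin n → ℝ) => e i) (fun i => ?_)
        (iIndepFun_pi (X := fun _ => id) fun i => aemeasurable_id)
      constructor
      rw [(measurePreserving_eval (fun _ : Fin n => gaussianReal 0 v) i).map_eq]
      infer_instance
    constructor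
    rw [hsnd.map_eq]
    simpa using h1.isGaussian_map
  have hF : HasGaussianLaw (fun ω : S × (Fin n → ℝ) => I.restrict (f · ω.1)) P' := by
    have h1 := (hf.hasGaussianLaw I).isGaussian_map
    constructor
    rw [← hfst.map_eq, Measure.map_map _ hfst.measurable] at h1
    · exact h1
    · exact measurable_pi_lambda _ fun i => hfm i
  have hjoint : HasGaussianLaw
      (fun ω : S × (Fin n → ℝ) => (I.restrict (f · ω.1), ω.2)) P' := by
    refine IndepFun.hasGaussianLaw hF hN ?_
    exact indepFun_prod (X := fun ω : S => I.restrict (f · ω)) (Y := id)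
      (measurable_pi_lambda _ fun i => hfm i) measurable_id
  -- Residual and observations are a linear image of a Gaussian vector, hence jointly Gaussian, and
  -- vanishing covariance will give independence.
  have hRY : HasGaussianLaw (fun ω => (fun _ : Fin 1 => R ω, fun j => Y ω j)) P' := by
    let L : ((I → ℝ) × (Fin n → ℝ)) →L[ℝ] ((Fin 1 → ℝ) × (Fin n → ℝ)) :=
      { toFun x := (fun _ => x.1 ⟨p, hpI⟩ - ∑ i, c i * (x.1 ⟨z i, hzI i⟩ + x.2 i),
          fun j => x.1 ⟨z j, hzI j⟩ + x.2 j)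
        map_add' x y := by
          ext j
          · simp only [Prod.fst_add, Prod.snd_add, Pi.add_apply, mul_add, Finset.sum_add_distrib]
            ring
          · simp only [Prod.fst_add, Prod.snd_add, Pi.add_apply]
            ring
        map_smul' a x := by
          ext j
          · simp only [Prod.smul_fst, Prod.smul_snd, Pi.smul_apply, smul_eq_mul,
              RingHom.id_apply, mul_sub, Finset.mul_sum]
            congr 1
            refine Finset.sum_congr rfl fun i _ => ?_
            ring
          · simp only [Prod.smul_fst, Prod.smul_snd, Pi.smul_apply, smul_eq_mul,
              RingHom.id_apply]
            ring
        cont := by fun_prop }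
    have := hjoint.map_fun L
    rw [hR]
    exact this
  have hFm : ∀ q, MemLp (fun ω : S × (Fin n → ℝ) => f q ω.1) 2 P' :=
    fun q => (hf.hasGaussianLaw_eval q).memLp_two.comp_measurePreserving hfst
  have hYm : ∀ j, MemLp (fun ω => Y ω j) 2 P' := fun j => (hRY.snd.eval j).memLp_two
  have hRm : MemLp R 2 P' := (hRY.fst.eval 0).memLp_two
  have hNm : ∀ j, MemLp (fun ω : S × (Fin n → ℝ) => ω.2 j) 2 P' := fun j =>
    (hN.eval j).memLp_two
  have hcFF : ∀ q q', covariance (fun ω : S × (Fin n → ℝ) => f q ω.1)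
      (fun ω => f q' ω.1) P' = k q q' := by
    intro q q'
    rw [← hcov, ← hfst.map_eq, covariance_map_fun (by fun_prop) (by fun_prop) (by fun_prop)]
  have hcFN : ∀ q j, covariance (fun ω : S × (Fin n → ℝ) => f q ω.1)
      (fun ω => ω.2 j) P' = 0 := by
    intro q j
    refine IndepFun.covariance_eq_zero ?_ (hFm q) (hNm j)
    exact indepFun_prod (X := f q) (Y := fun e : Fin n → ℝ => e j) (hfm q) (by fun_prop)
  have hcNN : ∀ i j, covariance (fun ω : S × (Fin n → ℝ) => ω.2 i)
      (fun ω => ω.2 j) P' = if i = j then (v : ℝ) else 0 := by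
    intro i j
    have h1 : covariance (fun ω : S × (Fin n → ℝ) => ω.2 i) (fun ω => ω.2 j) P' =
        covariance (fun e : Fin n → ℝ => e i) (fun e => e j)
          (Measure.pi fun _ : Fin n => gaussianReal 0 v) := by
      rw [← hsnd.map_eq, covariance_map_fun (measurable_pi_apply i).aestronglyMeasurable
        (measurable_pi_apply j).aestronglyMeasurable hsnd.measurable.aemeasurable]
    rw [h1]
    have hev := fun i => measurePreserving_eval (fun _ : Fin n => gaussianReal 0 v) i
    split_ifs with hij
    · subst hij
      rw [covariance_self (measurable_pi_apply i).aemeasurable]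
      have h2 := variance_id_gaussianReal (μ := 0) (v := v)
      rw [← (hev i).map_eq, variance_map aemeasurable_id (hev i).measurable.aemeasurable] at h2
      exact h2
    · have hm : ∀ i, MemLp (fun e : Fin n → ℝ => e i) 2
          (Measure.pi fun _ : Fin n => gaussianReal 0 v) := fun i =>
        (memLp_id_gaussianReal 2 (μ := 0) (v := v)).comp_measurePreserving (hev i)
      exact ((iIndepFun_pi (X := fun _ => id) fun i => aemeasurable_id).indepFun
        hij).covariance_eq_zero (hm i) (hm j)
  have hcFY : ∀ q j, covariance (fun ω : S × (Fin n → ℝ) => f q ω.1)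
      (fun ω => Y ω j) P' = k q (z j) := by
    intro q j
    have : (fun ω => Y ω j) = (fun ω : S × (Fin n → ℝ) => f (z j) ω.1) + fun ω => ω.2 j := rfl
    rw [this, covariance_add_right (hFm _) (hFm _) (hNm _), hcFF, hcFN, add_zero]
  have hcNY : ∀ i j, covariance (fun ω : S × (Fin n → ℝ) => ω.2 i)
      (fun ω => Y ω j) P' = if i = j then (v : ℝ) else 0 := by
    intro i j
    have : (fun ω => Y ω j) = (fun ω : S × (Fin n → ℝ) => f (z j) ω.1) + fun ω => ω.2 j := rfl
    rw [this, covariance_add_right (hNm _) (hFm _) (hNm _), hcNN, covariance_comm, hcFN, zero_add]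
  have hcYY : ∀ i j, covariance (fun ω => Y ω i) (fun ω => Y ω j) P' =
      k (z i) (z j) + if i = j then (v : ℝ) else 0 := by
    intro i j
    have : (fun ω => Y ω i) = (fun ω : S × (Fin n → ℝ) => f (z i) ω.1) + fun ω => ω.2 i := rfl
    rw [this, covariance_add_left (hFm _) (hNm _) (hYm _), hcFY, hcNY]
  have hcYm : ∀ i, MemLp (fun ω => c i * Y ω i) 2 P' := fun i => (hYm i).const_mul _
  have hcRY : ∀ j, covariance R (fun ω => Y ω j) P' = 0 := by
    intro j
    rw [hR, covariance_fun_sub_left (hFm p) (memLp_finsetSum _ fun i _ => hcYm i) (hYm j), hcFY,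
      covariance_fun_sum_left hcYm (hYm j)]
    simp_rw [covariance_const_mul_left, hcYY]
    rw [sum_posteriorWeights_mul hk hv', sub_self]
  -- As `R` is uncorrelated with the observations, `Var R = Cov(R, f p)`, which is the posterior
  -- variance.
  have hvar : variance R P' = posteriorVar k v z p := by
    have h0 : covariance R (fun ω => ∑ i, c i * Y ω i) P' = 0 := by
      rw [covariance_fun_sum_right hcYm hRm]
      simp [covariance_const_mul_right, hcRY]
    rw [← covariance_self hRm.aestronglyMeasurable.aemeasurable]
    conv_lhs => arg 2; rw [hR]
    rw [covariance_fun_sub_right hRm (hFm p) (memLp_finsetSum _ fun i _ => hcYm i), h0, sub_zero,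
      hR, covariance_fun_sub_left (hFm p) (memLp_finsetSum _ fun i _ => hcYm i) (hFm p), hcFF,
      covariance_fun_sum_left hcYm (hFm p), posteriorVar_eq]
    congr 1
    refine Finset.sum_congr rfl fun i _ => ?_
    rw [covariance_const_mul_left, covariance_comm, hcFY]
  have hmF : ∀ q, ∫ ω : S × (Fin n → ℝ), f q ω.1 ∂P' = 0 := by
    intro q
    rw [← hmean q, ← hfst.map_eq, integral_map hfst.measurable.aemeasurable
      (hfm q).aestronglyMeasurable]
  have hmN : ∀ j, ∫ ω : S × (Fin n → ℝ), ω.2 j ∂P' = 0 := by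
    intro j
    have h1 := integral_id_gaussianReal (μ := 0) (v := v)
    rw [← (measurePreserving_eval (fun _ : Fin n => gaussianReal 0 v) j).map_eq,
      ← hsnd.map_eq, integral_map (measurable_pi_apply j).aemeasurable (by fun_prop),
      integral_map hsnd.measurable.aemeasurable (measurable_pi_apply j).aestronglyMeasurable] at h1
    exact h1
  have hmR : ∫ ω, R ω ∂P' = 0 := by
    have hi := fun q => (hFm q).integrable one_le_two
    have hiN := fun q => (hNm q).integrable one_le_two
    have hiY := fun q => (hcYm q).integrable one_le_two
    rw [hR, integral_sub (hi p) (integrable_finsetSum _ fun i _ => hiY i), hmF,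
      integral_finsetSum _ fun i _ => hiY i, zero_sub, neg_eq_zero]
    refine Finset.sum_eq_zero fun i _ => ?_
    rw [integral_const_mul]
    simp only [Y]
    rw [integral_add (hi _) (hiN _), hmF, hmN]
    simp
  constructor
  · have h1 := HasGaussianLaw.indepFun_of_covariance_eval (X := fun (_ : Fin 1) ω => R ω)
      (Y := fun j ω => Y ω j) hRY fun _ j => hcRY j
    exact h1.comp (φ := fun x : Fin 1 → ℝ => x 0) (ψ := id) (by fun_prop) measurable_id
  · have h1 := (hRY.fst.eval 0).map_eq_gaussianReal
    rw [hmR, hvar] at h1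
    exact h1

end FixedDesign

end RobustBO

namespace RobustBO

/-! ### Posterior tail bounds for a fixed design. -/

section FixedDesign

variable {Q S : Type*} [MeasurableSpace S] {P : Measure S} {f : Q → S → ℝ} {k : Q → Q → ℝ}

lemma pi_gaussianReal_map_add {n : ℕ} (v : ℝ≥0) (m : Fin n → ℝ) :
    (Measure.pi fun _ : Fin n => gaussianReal 0 v).map (fun e i => m i + e i) =
      Measure.pi fun i => gaussianReal (m i) v := by
  have h := Measure.pi_map_pi (μ := fun _ : Fin n => gaussianReal 0 v)
    (f := fun (i : Fin n) (x : ℝ) => m i + x) (fun i => by fun_prop)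
  rw [h]
  congr 1
  ext1 i
  rw [gaussianReal_map_const_add, zero_add]

/-- Integrals over noisy observations, expressed through the likelihood. -/
lemma lintegral_add_noise [IsProbabilityMeasure P] {v : ℝ≥0} (hv : v ≠ 0) {n : ℕ}
    {m : S → Fin n → ℝ} (hm : Measurable m) {Φ : S × (Fin n → ℝ) → ℝ≥0∞} (hΦ : Measurable Φ) :
    ∫⁻ ω, Φ (ω.1, fun i => m ω.1 i + ω.2 i)
        ∂(P.prod (Measure.pi fun _ : Fin n => gaussianReal 0 v)) =
      ∫⁻ y : Fin n → ℝ, ∫⁻ ω, Φ (ω, y) * likelihood v (m ω) y ∂P := by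
  have hm' : Measurable fun z : S × (Fin n → ℝ) => m z.1 := hm.comp measurable_fst
  have hadd : Measurable fun ω : S × (Fin n → ℝ) => (ω.1, fun i => m ω.1 i + ω.2 i) :=
    measurable_fst.prodMk (measurable_pi_lambda _ fun i =>
      (hm'.eval).add ((measurable_pi_apply i).comp measurable_snd))
  have hlik : Measurable fun z : S × (Fin n → ℝ) => likelihood v (m z.1) z.2 :=
    measurable_likelihood hm' measurable_snd
  rw [lintegral_prod (fun ω : S × (Fin n → ℝ) => Φ (ω.1, fun i => m ω.1 i + ω.2 i))
      (hΦ.comp hadd).aemeasurable,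
    lintegral_lintegral_swap (f := fun y ω => Φ (ω, y) * likelihood v (m ω) y)
      ((hΦ.mul hlik).comp measurable_swap).aemeasurable]
  refine lintegral_congr fun ω => ?_
  have hΦω : Measurable fun y => Φ (ω, y) := hΦ.comp measurable_prodMk_left
  have hl : Measurable fun y => likelihood v (m ω) y :=
    measurable_likelihood measurable_const measurable_id
  have h1 : ∫⁻ e : Fin n → ℝ, Φ (ω, fun i => m ω i + e i) ∂(Measure.pi fun _ => gaussianReal 0 v) =
      ∫⁻ y, Φ (ω, y) ∂(Measure.pi fun _ : Fin n => gaussianReal 0 v).map (fun e i => m ω i + e i) :=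
    (lintegral_map hΦω (by fun_prop)).symm
  rw [h1, pi_gaussianReal_map_add, pi_gaussianReal_eq_withDensity hv,
    lintegral_withDensity_eq_lintegral_mul _ hl hΦω]
  exact lintegral_congr fun y => mul_comm _ _

/-- Posterior tail bound for fixed evaluation points and arbitrary observed values. -/
lemma lintegral_posterior_tail_le [IsProbabilityMeasure P] (hfm : ∀ p, Measurable (f p))
    (hf : IsGaussianProcess f P)
    (hmean : ∀ p, ∫ ω, f p ω ∂P = 0) (hcov : ∀ p p', covariance (f p) (f p') P = k p p')
    {v : ℝ≥0} (hv : 0 < v) {n : ℕ} (z : Fin n → Q) (p : Q) {c : ℝ} (hc : 0 ≤ c)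
    (y : Fin n → ℝ) :
    ∫⁻ ω in {ω | c * √(posteriorVar k v z p) < |f p ω - posteriorMean k v z y p|},
        likelihood v (fun i => f (z i) ω) y ∂P ≤
      ENNReal.ofReal (Real.exp (-c ^ 2 / 2)) *
        ∫⁻ ω, likelihood v (fun i => f (z i) ω) y ∂P := by
  have hk := isPosSemidefKernel_covariance hf hcov
  have hvar := hk.posteriorVar_nonneg (v := v) hv z p
  obtain ⟨hind, hlaw⟩ := residual_law hfm hf hmean hcov hv z p
  have hmv : Measurable fun ω i => f (z i) ω := measurable_pi_lambda _ fun i => hfm (z i)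
  have hmc : Continuous fun y => posteriorMean k v z y p := by
    simp only [posteriorMean_eq]
    fun_prop
  set A : (Fin n → ℝ) → Set S :=
    fun y => {ω | c * √(posteriorVar k v z p) < |f p ω - posteriorMean k v z y p|} with hA
  set G : Set (S × (Fin n → ℝ)) := {z | z.1 ∈ A z.2} with hG
  have hGm : MeasurableSet G := by
    refine measurableSet_lt (f := fun _ : S × (Fin n → ℝ) => c * √(posteriorVar k v z p))
      measurable_const ?_
    exact (((hfm p).comp measurable_fst).sub (hmc.measurable.comp measurable_snd)).abs
  have hAm : ∀ y, MeasurableSet (A y) := fun y => hGm.preimage measurable_prodMk_right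
  have hlik : Measurable fun ω : S × (Fin n → ℝ) => likelihood v (fun i => f (z i) ω.1) ω.2 :=
    measurable_likelihood (hmv.comp measurable_fst) measurable_snd
  set C := ENNReal.ofReal (Real.exp (-c ^ 2 / 2)) with hC
  -- For almost every `y` the bound follows by integrating both sides over an arbitrary measurable
  -- set of observations, which turns them into probabilities in the experiment with noise.
  have hae : ∀ᵐ y : Fin n → ℝ, ∫⁻ ω in A y, likelihood v (fun i => f (z i) ω) y ∂P ≤
      C * ∫⁻ ω, likelihood v (fun i => f (z i) ω) y ∂P := by
    have hL : ∀ y, ∫⁻ ω in A y, likelihood v (fun i => f (z i) ω) y ∂P =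
        ∫⁻ ω, G.indicator 1 (ω, y) * likelihood v (fun i => f (z i) ω) y ∂P := by
      intro y
      rw [← lintegral_indicator (hAm y)]
      refine lintegral_congr fun ω => ?_
      by_cases h : ω ∈ A y
      · rw [indicator_of_mem h, indicator_of_mem (show (ω, y) ∈ G from h), Pi.one_apply, one_mul]
      · rw [indicator_of_notMem h, indicator_of_notMem (show (ω, y) ∉ G from h), zero_mul]
    have hLm : Measurable fun y : Fin n → ℝ =>
        ∫⁻ ω, G.indicator 1 (ω, y) * likelihood v (fun i => f (z i) ω) y ∂P :=
      Measurable.lintegral_prod_left' (f := fun z' : S × (Fin n → ℝ) =>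
        G.indicator 1 z' * likelihood v (fun i => f (z i) z'.1) z'.2)
        ((measurable_one.indicator hGm).mul hlik)
    have hZm : Measurable fun y : Fin n → ℝ => ∫⁻ ω, likelihood v (fun i => f (z i) ω) y ∂P :=
      Measurable.lintegral_prod_left' hlik
    simp_rw [hL]
    refine ae_le_of_forall_setLIntegral_le_of_sigmaFinite hLm fun s hs _ => ?_
    set P' := P.prod (Measure.pi fun _ : Fin n => gaussianReal 0 v)
    have hsm : MeasurableSet {ω : S × (Fin n → ℝ) | ω.2 ∈ s} := measurable_snd hs
    have e1 : ∫⁻ y in s, ∫⁻ ω, G.indicator 1 (ω, y) * likelihood v (fun i => f (z i) ω) y ∂P =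
        P' ({ω | c * √(posteriorVar k v z p) <
          |f p ω.1 - posteriorMean k v z (fun j => f (z j) ω.1 + ω.2 j) p|} ∩
          {ω | (fun j => f (z j) ω.1 + ω.2 j) ∈ s}) := by
      have h := lintegral_add_noise (P := P) hv.ne' hmv
        (Φ := (G ∩ {ω | ω.2 ∈ s}).indicator 1) (measurable_one.indicator (hGm.inter hsm))
      have hadd : Measurable fun ω : S × (Fin n → ℝ) =>
          (ω.1, fun i => f (z i) ω.1 + ω.2 i) := by
        refine measurable_fst.prodMk (measurable_pi_lambda _ fun i => ?_)
        exact ((hfm _).comp measurable_fst).add ((measurable_pi_apply i).comp measurable_snd)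
      refine Eq.trans ?_ (h.symm.trans (lintegral_indicator_one ((hGm.inter hsm).preimage hadd)))
      rw [← lintegral_indicator hs]
      refine lintegral_congr fun y => ?_
      by_cases hy : y ∈ s
      · rw [indicator_of_mem hy]
        refine lintegral_congr fun ω => ?_
        congr 1
        by_cases hg : (ω, y) ∈ G
        · rw [indicator_of_mem hg, indicator_of_mem (show (ω, y) ∈ G ∩ {ω | ω.2 ∈ s} from ⟨hg, hy⟩)]
        · rw [indicator_of_notMem hg, indicator_of_notMem fun h => hg h.1]
      · rw [indicator_of_notMem hy]
        symm
        rw [lintegral_eq_zero_iff' (by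
          exact ((measurable_one.indicator (hGm.inter hsm)).mul hlik).comp
            measurable_prodMk_right |>.aemeasurable)]
        refine ae_of_all _ fun ω => ?_
        dsimp only
        rw [indicator_of_notMem fun h => hy h.2, zero_mul]
        rfl
    have e2 : ∫⁻ y in s, C * ∫⁻ ω, likelihood v (fun i => f (z i) ω) y ∂P =
        C * P' {ω | (fun j => f (z j) ω.1 + ω.2 j) ∈ s} := by
      have h := lintegral_add_noise (P := P) hv.ne' hmv
        (Φ := {ω : S × (Fin n → ℝ) | ω.2 ∈ s}.indicator 1) (measurable_one.indicator hsm)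
      have hadd : Measurable fun ω : S × (Fin n → ℝ) =>
          (ω.1, fun i => f (z i) ω.1 + ω.2 i) := by
        refine measurable_fst.prodMk (measurable_pi_lambda _ fun i => ?_)
        exact ((hfm _).comp measurable_fst).add ((measurable_pi_apply i).comp measurable_snd)
      rw [lintegral_const_mul _ hZm]
      congr 1
      refine Eq.trans ?_ (h.symm.trans (lintegral_indicator_one (hsm.preimage hadd)))
      rw [← lintegral_indicator hs]
      refine lintegral_congr fun y => ?_
      by_cases hy : y ∈ s
      · rw [indicator_of_mem hy]
        refine lintegral_congr fun ω => ?_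
        rw [indicator_of_mem (show (ω, y) ∈ {ω : S × (Fin n → ℝ) | ω.2 ∈ s} from hy),
          Pi.one_apply, one_mul]
      · rw [indicator_of_notMem hy]
        symm
        rw [lintegral_eq_zero_iff' (by
          exact ((measurable_one.indicator hsm).mul hlik).comp
            measurable_prodMk_right |>.aemeasurable)]
        refine ae_of_all _ fun ω => ?_
        dsimp only
        rw [indicator_of_notMem (show (ω, y) ∉ {ω : S × (Fin n → ℝ) | ω.2 ∈ s} from hy), zero_mul]
        rfl
    rw [e1, e2]
    have hRm : Measurable fun ω : S × (Fin n → ℝ) =>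
        f p ω.1 - posteriorMean k v z (fun j => f (z j) ω.1 + ω.2 j) p := by
      refine ((hfm p).comp measurable_fst).sub (hmc.measurable.comp ?_)
      refine measurable_pi_lambda _ fun i => ?_
      exact ((hfm _).comp measurable_fst).add ((measurable_pi_apply i).comp measurable_snd)
    have hset : MeasurableSet {x : ℝ | c * √(posteriorVar k v z p) < |x|} :=
      measurableSet_lt measurable_const measurable_abs
    -- Independence of the residual from the observations leaves the unconditional Gaussian tail of
    -- the residual.
    have h3 := hind.measure_inter_preimage_eq_mul _ _ hset hs
    refine (le_of_eq h3).trans (mul_le_mul_left ?_ _)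
    rw [← Measure.map_apply hRm hset, hlaw]
    have := gaussianReal_abs_gt_le (posteriorVar k v z p).toNNReal hc
    rwa [Real.coe_toNNReal _ hvar] at this
  -- A property valid almost everywhere holds on a dense set, so an arbitrary `y` is approached by
  -- values satisfying the bound. An exceptional null set could not be tolerated later, since it
  -- would depend on the design and the design on `y`.
  obtain ⟨u, hu, hulim⟩ := mem_closure_iff_seq_limit.1
    ((Measure.dense_of_ae hae).closure_eq ▸ mem_univ y)
  have hZlim : Tendsto (fun j => ∫⁻ ω, likelihood v (fun i => f (z i) ω) (u j) ∂P) atTop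
      (𝓝 (∫⁻ ω, likelihood v (fun i => f (z i) ω) y ∂P)) := by
    refine tendsto_lintegral_of_dominated_convergence
      (fun _ => ENNReal.ofReal (√(2 * Real.pi * v))⁻¹ ^ n)
      (fun j => measurable_likelihood hmv measurable_const)
      (fun j => ae_of_all _ fun ω => likelihood_le _ _ _) ?_ (ae_of_all _ fun ω => ?_)
    · simp only [lintegral_const, measure_univ, mul_one]
      exact ENNReal.pow_ne_top ENNReal.ofReal_ne_top
    · exact ((continuous_likelihood v _).tendsto y).comp hulim
  calc ∫⁻ ω in A y, likelihood v (fun i => f (z i) ω) y ∂P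
      = ∫⁻ ω, (A y).indicator (fun ω => likelihood v (fun i => f (z i) ω) y) ω ∂P :=
        (lintegral_indicator (hAm y) _).symm
    -- The tail event is given by a strict inequality, hence open in `y`: the indicator is lower
    -- semicontinuous, as Fatou's lemma requires. The right-hand side passes to the limit by
    -- dominated convergence.
    _ ≤ ∫⁻ ω, liminf (fun j => (A (u j)).indicator
          (fun ω => likelihood v (fun i => f (z i) ω) (u j)) ω) atTop ∂P := by
        refine lintegral_mono fun ω => ?_
        by_cases hω : ω ∈ A y
        · rw [indicator_of_mem hω]
          have h1 : ∀ᶠ j in atTop, ω ∈ A (u j) := by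
            have h2 : Tendsto (fun j => |f p ω - posteriorMean k v z (u j) p|) atTop
                (𝓝 |f p ω - posteriorMean k v z y p|) :=
              ((tendsto_const_nhds.sub ((hmc.tendsto y).comp hulim)).abs)
            exact h2.eventually (lt_mem_nhds hω)
          have h3 : Tendsto (fun j => (A (u j)).indicator
              (fun ω => likelihood v (fun i => f (z i) ω) (u j)) ω) atTop
              (𝓝 (likelihood v (fun i => f (z i) ω) y)) := by
            refine Tendsto.congr' ?_ (((continuous_likelihood v _).tendsto y).comp hulim)
            filter_upwards [h1] with j hj
            rw [indicator_of_mem hj]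
            rfl
          exact h3.liminf_eq.ge
        · rw [indicator_of_notMem hω]
          exact zero_le
    _ ≤ liminf (fun j => ∫⁻ ω, (A (u j)).indicator
          (fun ω => likelihood v (fun i => f (z i) ω) (u j)) ω ∂P) atTop :=
        lintegral_liminf_le fun j =>
          (measurable_likelihood hmv measurable_const).indicator (hAm _)
    _ ≤ liminf (fun j => C * ∫⁻ ω, likelihood v (fun i => f (z i) ω) (u j) ∂P) atTop := by
        refine liminf_le_liminf (Eventually.of_forall fun j => ?_)
        rw [lintegral_indicator (hAm _)]
        exact hu j
    _ = C * ∫⁻ ω, likelihood v (fun i => f (z i) ω) y ∂P :=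
        (ENNReal.Tendsto.const_mul hZlim (Or.inr ENNReal.ofReal_ne_top)).liminf_eq

end FixedDesign

end RobustBO

namespace RobustBO

/-! ### Adaptive designs -/

section Adaptive

variable {E Z : Type*} [MeasurableSpace E] [MeasurableSpace Z]

/-- The data of the rounds before the last one, followed by the last round. -/
def snocData {n : ℕ} (d : Fin n → ℝ × ℝ) (z : ℝ × ℝ) : Fin (n + 1) → ℝ × ℝ :=
  Fin.snoc (α := fun _ => ℝ × ℝ) d z

/-- Evaluation points determined from the data `d i = (ξ i, y i)` by the policies `π`. -/
def policyPoints (π : ∀ n, (Fin n → ℝ × ℝ) × ℝ → Z) {n : ℕ} (d : Fin n → ℝ × ℝ) (i : Fin n) : Z :=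
  π i (fun j : Fin i => d ⟨j, j.2.trans i.2⟩, (d i).1)

omit [MeasurableSpace Z] in
lemma policyPoints_snoc_castSucc (π : ∀ n, (Fin n → ℝ × ℝ) × ℝ → Z) {n : ℕ} (d : Fin n → ℝ × ℝ)
    (z : ℝ × ℝ) (i : Fin n) :
    policyPoints π (snocData d z) i.castSucc = policyPoints π d i := by
  have h : ∀ j : Fin n, snocData d z j.castSucc = d j := fun j => Fin.snoc_castSucc _ _ _
  simp only [policyPoints]
  rw [h]
  congr 2
  ext1 j
  exact h ⟨j, j.2.trans i.2⟩

omit [MeasurableSpace Z] in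
lemma policyPoints_snoc_last (π : ∀ n, (Fin n → ℝ × ℝ) × ℝ → Z) {n : ℕ} (d : Fin n → ℝ × ℝ)
    (z : ℝ × ℝ) : policyPoints π (snocData d z) (Fin.last n) = π n (d, z.1) := by
  have h : ∀ j : Fin n, snocData d z j.castSucc = d j := fun j => Fin.snoc_castSucc _ _ _
  have h' : snocData d z (Fin.last n) = z := Fin.snoc_last _ _
  simp only [policyPoints]
  rw [h']
  congr 2
  ext1 j
  exact h j

lemma measurable_policyPoints {π : ∀ n, (Fin n → ℝ × ℝ) × ℝ → Z} (hπ : ∀ n, Measurable (π n))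
    {n : ℕ} (i : Fin n) : Measurable fun d : Fin n → ℝ × ℝ => policyPoints π d i :=
  (hπ i).comp ((measurable_pi_lambda _ fun _ => measurable_pi_apply _).prodMk
    (measurable_pi_apply i).fst)

lemma measurePreserving_snocData (μ : Measure (ℝ × ℝ)) [SigmaFinite μ] (n : ℕ) :
    MeasurePreserving (fun z : (ℝ × ℝ) × (Fin n → ℝ × ℝ) => snocData z.2 z.1)
      (μ.prod (Measure.pi fun _ => μ)) (Measure.pi fun _ : Fin (n + 1) => μ) := by
  have h := (measurePreserving_piFinSuccAbove (fun _ : Fin (n + 1) => μ) (Fin.last n)).symm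
  convert! h using 1
  ext1 z
  simp [MeasurableEquiv.piFinSuccAbove_symm_apply, snocData, Fin.insertNthEquiv,
    Fin.insertNth_last']

lemma measurable_snocData (n : ℕ) :
    Measurable fun z : (ℝ × ℝ) × (Fin n → ℝ × ℝ) => snocData z.2 z.1 :=
  (measurePreserving_snocData (volume.prod volume) n).measurable

/-- The likelihood of the data `d` if the unknown function is `G a`. -/
noncomputable def dataLikelihood (G : E → Z → ℝ) (v : ℝ≥0) (π : ∀ n, (Fin n → ℝ × ℝ) × ℝ → Z)
    {n : ℕ} (a : E) (d : Fin n → ℝ × ℝ) : ℝ≥0∞ :=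
  likelihood v (fun i => G a (policyPoints π d i)) fun i => (d i).2

variable {G : E → Z → ℝ} {v : ℝ≥0} {π : ∀ n, (Fin n → ℝ × ℝ) × ℝ → Z}

lemma measurable_dataLikelihood (hG : Measurable fun z : E × Z => G z.1 z.2)
    (hπ : ∀ n, Measurable (π n)) (n : ℕ) :
    Measurable fun z : E × (Fin n → ℝ × ℝ) => dataLikelihood G v π z.1 z.2 := by
  have h1 : Measurable fun (z : E × (Fin n → ℝ × ℝ)) i => G z.1 (policyPoints π z.2 i) :=
    measurable_pi_lambda _ fun i =>
      hG.comp (measurable_fst.prodMk ((measurable_policyPoints hπ i).comp measurable_snd))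
  have h2 : Measurable fun (z : E × (Fin n → ℝ × ℝ)) i => (z.2 i).2 :=
    measurable_pi_lambda _ fun i => ((measurable_pi_apply i).comp measurable_snd).snd
  unfold dataLikelihood
  exact measurable_likelihood (v := v) h1 h2

omit [MeasurableSpace E] [MeasurableSpace Z] in
-- Since a policy sees only the past and the current `ξ`, appending a round leaves the earlier
-- points unchanged and multiplies the likelihood by one Gaussian density.
lemma dataLikelihood_snoc {n : ℕ} (a : E) (d : Fin n → ℝ × ℝ) (z : ℝ × ℝ) :
    dataLikelihood G v π a (snocData d z) =
      dataLikelihood G v π a d * gaussianPDF (G a (π n (d, z.1))) v z.2 := by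
  have h : ∀ j : Fin n, snocData d z j.castSucc = d j := fun j => Fin.snoc_castSucc _ _ _
  have h' : snocData d z (Fin.last n) = z := Fin.snoc_last _ _
  simp only [dataLikelihood, likelihood]
  rw [Fin.prod_univ_castSucc]
  simp only [policyPoints_snoc_castSucc, policyPoints_snoc_last, h, h']

omit [MeasurableSpace E] [MeasurableSpace Z] in
lemma dataLikelihood_zero (a : E) (d : Fin 0 → ℝ × ℝ) : dataLikelihood G v π a d = 1 := by
  simp [dataLikelihood, likelihood]

omit [MeasurableSpace E] [MeasurableSpace Z] in
lemma dataLikelihood_le {n : ℕ} (a : E) (d : Fin n → ℝ × ℝ) :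
    dataLikelihood G v π a d ≤ ENNReal.ofReal (√(2 * Real.pi * v))⁻¹ ^ n := likelihood_le _ _ _

attribute [irreducible] dataLikelihood snocData policyPoints

lemma measurable_dataLikelihood_comp (hG : Measurable fun z : E × Z => G z.1 z.2)
    (hπ : ∀ n, Measurable (π n)) {n : ℕ} {α : Type*} [MeasurableSpace α] {f : α → E}
    {g : α → Fin n → ℝ × ℝ} (hf : Measurable f) (hg : Measurable g) :
    Measurable fun a => dataLikelihood G v π (f a) (g a) :=
  (measurable_dataLikelihood hG hπ n).comp (hf.prodMk hg)

/-- Reference measure for the data of one round. -/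
noncomputable abbrev roundMeasure : Measure (ℝ × ℝ) := (chiSquared 2).prod volume

variable {S : Type*} [MeasurableSpace S] {P : Measure S} [IsProbabilityMeasure P]

/-- A run of an adaptive experiment: in round `n + 1` the unknown function `G (e ω)` is observed
with noise `ε (n + 1)` at the point selected by `π n` from the data of the first `n` rounds and
from `ξ (n + 1)`. -/
structure IsAdaptiveExperiment (P : Measure S) (G : E → Z → ℝ) (v : ℝ≥0)
    (π : ∀ n, (Fin n → ℝ × ℝ) × ℝ → Z) (e : S → E) (ξ ε : ℕ → S → ℝ)
    (data : ∀ n, S → Fin n → ℝ × ℝ) : Prop where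
  measurable_G : Measurable fun z : E × Z => G z.1 z.2
  measurable_π : ∀ n, Measurable (π n)
  measurable_e : Measurable e
  measurable_data : ∀ n, Measurable (data n)
  data_succ : ∀ n ω, data (n + 1) ω = snocData (data n ω)
    (ξ (n + 1) ω, G (e ω) (π n (data n ω, ξ (n + 1) ω)) + ε (n + 1) ω)
  measurable_ξ : ∀ n, Measurable (ξ (n + 1))
  measurable_ε : ∀ n, Measurable (ε (n + 1))
  law : ∀ n, P.map (fun ω => ((e ω, data n ω), (ξ (n + 1) ω, ε (n + 1) ω))) =
    (P.map fun ω => (e ω, data n ω)).prod ((chiSquared 2).prod (gaussianReal 0 v))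

variable {e : S → E} {ξ ε : ℕ → S → ℝ} {data : ∀ n, S → Fin n → ℝ × ℝ}

lemma lintegral_gaussianReal_eq (hv : v ≠ 0) (m : ℝ) {Φ : ℝ → ℝ≥0∞} (hΦ : Measurable Φ) :
    ∫⁻ x, Φ (m + x) ∂gaussianReal 0 v = ∫⁻ y, Φ y * gaussianPDF m v y := by
  rw [← lintegral_map (f := Φ) hΦ (by fun_prop : Measurable fun x => m + x),
    gaussianReal_map_const_add, zero_add, gaussianReal_of_var_ne_zero _ hv,
    lintegral_withDensity_eq_lintegral_mul _ (measurable_gaussianPDF _ _) hΦ]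
  exact lintegral_congr fun y => mul_comm _ _

/-- The joint law of the unknown function and the data has the likelihood as its density. -/
lemma IsAdaptiveExperiment.lintegral_data (h : IsAdaptiveExperiment P G v π e ξ ε data)
    (hv : v ≠ 0) (n : ℕ) {Φ : E × (Fin n → ℝ × ℝ) → ℝ≥0∞} (hΦ : Measurable Φ) :
    ∫⁻ ω, Φ (e ω, data n ω) ∂P =
      ∫⁻ d, ∫⁻ a, Φ (a, d) * dataLikelihood G v π a d ∂(P.map e)
        ∂(Measure.pi fun _ => roundMeasure) := by
  have hP : IsProbabilityMeasure (P.map e) :=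
    Measure.isProbabilityMeasure_map h.measurable_e.aemeasurable
  induction n with
  | zero =>
    rw [Measure.pi_of_empty, lintegral_dirac' _ (by
      exact Measurable.lintegral_prod_left' (f := fun z : E × (Fin 0 → ℝ × ℝ) =>
        Φ z * dataLikelihood G v π z.1 z.2)
        (hΦ.mul (measurable_dataLikelihood h.measurable_G h.measurable_π 0))),
      lintegral_map (f := fun a => Φ (a, isEmptyElim) * dataLikelihood G v π a isEmptyElim)
        ((hΦ.comp measurable_prodMk_right).mul
          (measurable_dataLikelihood_comp h.measurable_G h.measurable_π measurable_id
            measurable_const)) h.measurable_e]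
    refine lintegral_congr fun ω => ?_
    rw [dataLikelihood_zero, mul_one]
    congr 2
    exact Subsingleton.elim _ _
  | succ n ih =>
    have hsnoc := measurable_snocData n
    have hπ := h.measurable_π n
    -- the integrand as a function of `(a, d)` and of the last round
    set Ψ : (E × (Fin n → ℝ × ℝ)) × (ℝ × ℝ) → ℝ≥0∞ := fun z => Φ (z.1.1, snocData z.1.2 z.2) with hΨ
    have hΨm : Measurable Ψ := hΦ.comp ((measurable_fst.fst).prodMk
      (hsnoc.comp (measurable_snd.prodMk measurable_fst.snd)))
    have hm : Measurable fun z : (E × (Fin n → ℝ × ℝ)) × ℝ => G z.1.1 (π n (z.1.2, z.2)) :=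
      h.measurable_G.comp ((measurable_fst.fst).prodMk
        (hπ.comp (measurable_fst.snd.prodMk measurable_snd)))
    have hpdf : Measurable fun z : (E × (Fin n → ℝ × ℝ)) × (ℝ × ℝ) =>
        gaussianPDF (G z.1.1 (π n (z.1.2, z.2.1))) v z.2.2 :=
      measurable_gaussianPDF_comp (hm.comp (measurable_fst.prodMk measurable_snd.fst))
        measurable_snd.snd
    -- Integrating out the last round against its Gaussian density reduces the claim to `n` rounds,
    -- where the induction hypothesis applies to `Φ'`.
    set Φ' : E × (Fin n → ℝ × ℝ) → ℝ≥0∞ := fun c => ∫⁻ z, Ψ (c, z) *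
      gaussianPDF (G c.1 (π n (c.2, z.1))) v z.2 ∂roundMeasure with hΦ'
    have hΦ'm : Measurable Φ' := (hΨm.mul hpdf).lintegral_prod_right'
    have step : ∫⁻ ω, Φ (e ω, data (n + 1) ω) ∂P = ∫⁻ ω, Φ' (e ω, data n ω) ∂P := by
      have hΘm : Measurable fun z : (E × (Fin n → ℝ × ℝ)) × (ℝ × ℝ) =>
          Ψ (z.1, (z.2.1, G z.1.1 (π n (z.1.2, z.2.1)) + z.2.2)) :=
        hΨm.comp (measurable_fst.prodMk (measurable_snd.fst.prodMk
          ((hm.comp (measurable_fst.prodMk measurable_snd.fst)).add measurable_snd.snd)))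
      have hdm : Measurable fun ω => (e ω, data n ω) :=
        h.measurable_e.prodMk (h.measurable_data n)
      have e1 : ∫⁻ ω, Φ (e ω, data (n + 1) ω) ∂P =
          ∫⁻ z, Ψ (z.1, (z.2.1, G z.1.1 (π n (z.1.2, z.2.1)) + z.2.2))
            ∂(P.map fun ω => ((e ω, data n ω), (ξ (n + 1) ω, ε (n + 1) ω))) := by
        rw [lintegral_map hΘm (hdm.prodMk ((h.measurable_ξ n).prodMk (h.measurable_ε n)))]
        refine lintegral_congr fun ω => ?_
        rw [h.data_succ]
      rw [e1, h.law, lintegral_prod _ hΘm.aemeasurable, lintegral_map _ hdm]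
      · refine lintegral_congr fun ω => ?_
        rw [hΦ']
        dsimp only
        have hω : Measurable fun z : ℝ × ℝ => ((e ω, data n ω), z) := measurable_prodMk_left
        rw [lintegral_prod (fun z : ℝ × ℝ =>
            Ψ ((e ω, data n ω), (z.1, G (e ω) (π n (data n ω, z.1)) + z.2)))
            (hΘm.comp hω).aemeasurable,
          lintegral_prod (fun z : ℝ × ℝ => Ψ ((e ω, data n ω), z) *
            gaussianPDF (G (e ω) (π n (data n ω, z.1))) v z.2)
            ((hΨm.mul hpdf).comp hω).aemeasurable]
        refine lintegral_congr fun s => ?_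
        exact lintegral_gaussianReal_eq hv (G (e ω) (π n (data n ω, s)))
          (Φ := fun y => Ψ ((e ω, data n ω), (s, y)))
          (hΨm.comp (measurable_const.prodMk (measurable_const.prodMk measurable_id)))
      · exact hΘm.lintegral_prod_right'
    rw [step, ih hΦ'm, ← (measurePreserving_snocData roundMeasure n).lintegral_comp,
      lintegral_prod_symm']
    · refine lintegral_congr fun d => ?_
      have hmd : Measurable fun z : E × (ℝ × ℝ) =>
          Φ (z.1, snocData d z.2) * dataLikelihood G v π z.1 (snocData d z.2) := by
        have h1 : Measurable fun z : E × (ℝ × ℝ) => (z.1, snocData d z.2) :=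
          measurable_fst.prodMk (hsnoc.comp (measurable_snd.prodMk measurable_const))
        exact (hΦ.comp h1).mul
          ((measurable_dataLikelihood h.measurable_G h.measurable_π (n + 1)).comp h1)
      rw [← lintegral_lintegral_swap (f := fun a z =>
        Φ (a, snocData d z) * dataLikelihood G v π a (snocData d z)) hmd.aemeasurable]
      refine lintegral_congr fun a => ?_
      rw [hΦ']
      dsimp only
      have hmz : Measurable fun z : ℝ × ℝ => ((a, d), z) := measurable_prodMk_left
      rw [← lintegral_mul_const _ (by exact (hΨm.mul hpdf).comp hmz)]
      refine lintegral_congr fun z => ?_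
      rw [dataLikelihood_snoc, hΨ]
      dsimp only
      ring
    · refine Measurable.comp (g := fun d : Fin (n + 1) → ℝ × ℝ =>
        ∫⁻ a, Φ (a, d) * dataLikelihood G v π a d ∂(P.map e)) ?_ hsnoc
      exact Measurable.lintegral_prod_left' (f := fun z : E × (Fin (n + 1) → ℝ × ℝ) =>
        Φ z * dataLikelihood G v π z.1 z.2)
        (hΦ.mul (measurable_dataLikelihood h.measurable_G h.measurable_π (n + 1)))
    · exact Measurable.lintegral_prod_left' (f := fun z : E × (Fin (n + 1) → ℝ × ℝ) =>
        Φ z * dataLikelihood G v π z.1 z.2)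
        (hΦ.mul (measurable_dataLikelihood h.measurable_G h.measurable_π (n + 1)))

/-- The fresh `ξ (n + 1)` is independent of the unknown function and of the data so far, so it
contributes a separate chi-squared integral which may be placed outside the integral over the
unknown function. -/
lemma IsAdaptiveExperiment.lintegral_data_next (h : IsAdaptiveExperiment P G v π e ξ ε data)
    (hv : v ≠ 0) (n : ℕ) {Φ : (E × (Fin n → ℝ × ℝ)) × ℝ → ℝ≥0∞} (hΦ : Measurable Φ) :
    ∫⁻ ω, Φ ((e ω, data n ω), ξ (n + 1) ω) ∂P =
      ∫⁻ d, ∫⁻ s, ∫⁻ a, Φ ((a, d), s) * dataLikelihood G v π a d ∂(P.map e) ∂(chiSquared 2)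
        ∂(Measure.pi fun _ => roundMeasure) := by
  have hP : IsProbabilityMeasure (P.map e) :=
    Measure.isProbabilityMeasure_map h.measurable_e.aemeasurable
  have hdm : Measurable fun ω => (e ω, data n ω) := h.measurable_e.prodMk (h.measurable_data n)
  have hΘm : Measurable fun z : (E × (Fin n → ℝ × ℝ)) × (ℝ × ℝ) => Φ (z.1, z.2.1) :=
    hΦ.comp (measurable_fst.prodMk measurable_snd.fst)
  have e1 : ∫⁻ ω, Φ ((e ω, data n ω), ξ (n + 1) ω) ∂P =
      ∫⁻ z, Φ (z.1, z.2.1)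
        ∂(P.map fun ω => ((e ω, data n ω), (ξ (n + 1) ω, ε (n + 1) ω))) := by
    rw [lintegral_map hΘm (hdm.prodMk ((h.measurable_ξ n).prodMk (h.measurable_ε n)))]
  have hΦ' : Measurable fun c : E × (Fin n → ℝ × ℝ) => ∫⁻ s, Φ (c, s) ∂chiSquared 2 :=
    hΦ.lintegral_prod_right'
  have e2 : ∫⁻ ω, Φ ((e ω, data n ω), ξ (n + 1) ω) ∂P =
      ∫⁻ ω, (∫⁻ s, Φ ((e ω, data n ω), s) ∂chiSquared 2) ∂P := by
    rw [e1, h.law, lintegral_prod _ hΘm.aemeasurable, lintegral_map hΘm.lintegral_prod_right' hdm]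
    refine lintegral_congr fun ω => ?_
    rw [lintegral_prod (fun y : ℝ × ℝ => Φ ((e ω, data n ω), y.1))
      (hΦ.comp (measurable_const.prodMk measurable_fst)).aemeasurable]
    simp
  rw [e2, h.lintegral_data hv n hΦ']
  refine lintegral_congr fun d => ?_
  have hL := measurable_dataLikelihood (v := v) h.measurable_G h.measurable_π n
  have hmd : Measurable fun z : E × ℝ => Φ ((z.1, d), z.2) * dataLikelihood G v π z.1 d :=
    (hΦ.comp ((measurable_fst.prodMk measurable_const).prodMk measurable_snd)).mul
      (hL.comp (measurable_fst.prodMk measurable_const))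
  rw [← lintegral_lintegral_swap (f := fun a s =>
        Φ ((a, d), s) * dataLikelihood G v π a d) hmd.aemeasurable]
  refine lintegral_congr fun a => ?_
  have hΦs : Measurable fun s => Φ ((a, d), s) := hΦ.comp measurable_prodMk_left
  rw [lintegral_mul_const _ hΦs]

/-- If `W` is bounded by `B` outside of an event whose posterior probability is at most
`exp (-ξ / 2)`, then the mean of `W` is bounded by the mean of `B`. -/
lemma IsAdaptiveExperiment.lintegral_le (h : IsAdaptiveExperiment P G v π e ξ ε data)
    (hv : v ≠ 0) (n : ℕ) {W : E × (Fin n → ℝ × ℝ) → ℝ} (hW : Measurable W)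
    {B : (Fin n → ℝ × ℝ) × ℝ → ℝ} (hB : Measurable B)
    {bad : Set ((E × (Fin n → ℝ × ℝ)) × ℝ)} (hbadm : MeasurableSet bad)
    (hbad : ∀ d s, 0 ≤ s → ∫⁻ a in {a | ((a, d), s) ∈ bad}, dataLikelihood G v π a d ∂(P.map e) ≤
      ENNReal.ofReal (Real.exp (-s / 2)) * ∫⁻ a, dataLikelihood G v π a d ∂(P.map e))
    (hWB : ∀ᵐ ω ∂P, ((e ω, data n ω), ξ (n + 1) ω) ∉ bad →
      W (e ω, data n ω) ≤ B (data n ω, ξ (n + 1) ω)) :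
    ∫⁻ ω, ENNReal.ofReal (W (e ω, data n ω)) ∂P ≤
      ∫⁻ ω, ENNReal.ofReal (B (data n ω, ξ (n + 1) ω)) ∂P := by
  have hP : IsProbabilityMeasure (P.map e) :=
    Measure.isProbabilityMeasure_map h.measurable_e.aemeasurable
  have hL := measurable_dataLikelihood (v := v) h.measurable_G h.measurable_π n
  have hLd : ∀ d, Measurable fun a => dataLikelihood G v π a d := fun d =>
    hL.comp (measurable_id.prodMk measurable_const)
  -- The set where the implication `hWB` is violated. It has probability zero, hence zero likelihood
  -- mass for almost all data and levels.
  set N : Set ((E × (Fin n → ℝ × ℝ)) × ℝ) := badᶜ ∩ {z | B (z.1.2, z.2) < W z.1} with hN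
  have hNm : MeasurableSet N := hbadm.compl.inter (measurableSet_lt
    (hB.comp (measurable_fst.snd.prodMk measurable_snd)) (hW.comp measurable_fst))
  have hNd : ∀ d s, MeasurableSet {a | ((a, d), s) ∈ N} := fun d s => hNm.preimage
    ((measurable_id.prodMk measurable_const).prodMk measurable_const)
  have hN0 : ∀ᵐ d ∂(Measure.pi fun _ : Fin n => roundMeasure), ∀ᵐ s ∂chiSquared 2,
      ∫⁻ a in {a | ((a, d), s) ∈ N}, dataLikelihood G v π a d ∂(P.map e) = 0 := by
    have h1 := h.lintegral_data_next hv n (measurable_one.indicator hNm)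
    have h2 : ∫⁻ ω, N.indicator 1 ((e ω, data n ω), ξ (n + 1) ω) ∂P = 0 := by
      rw [lintegral_eq_zero_iff']
      · filter_upwards [hWB] with ω hω
        refine indicator_of_notMem (fun hmem => ?_) _
        exact absurd (hω hmem.1) (not_le.2 hmem.2)
      · exact ((measurable_one.indicator hNm).comp ((h.measurable_e.prodMk
          (h.measurable_data n)).prodMk (h.measurable_ξ n))).aemeasurable
    have hm1 : Measurable fun z : (E × (Fin n → ℝ × ℝ)) × ℝ =>
        N.indicator 1 z * dataLikelihood G v π z.1.1 z.1.2 :=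
      (measurable_one.indicator hNm).mul (hL.comp measurable_fst)
    have hm2 : Measurable fun z : (Fin n → ℝ × ℝ) × ℝ =>
        ∫⁻ a, N.indicator 1 ((a, z.1), z.2) * dataLikelihood G v π a z.1 ∂(P.map e) :=
      Measurable.lintegral_prod_left' (f := fun y : E × ((Fin n → ℝ × ℝ) × ℝ) =>
        N.indicator 1 ((y.1, y.2.1), y.2.2) * dataLikelihood G v π y.1 y.2.1)
        (hm1.comp ((measurable_fst.prodMk measurable_snd.fst).prodMk measurable_snd.snd))
    rw [h2, eq_comm, lintegral_eq_zero_iff' hm2.lintegral_prod_right'.aemeasurable] at h1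
    filter_upwards [h1] with d hd
    rw [Pi.zero_apply, lintegral_eq_zero_iff' (by
      exact (hm2.comp measurable_prodMk_left).aemeasurable)] at hd
    filter_upwards [hd] with s hs
    rw [← lintegral_indicator (hNd d s)]
    refine Eq.trans (lintegral_congr fun a => ?_) hs
    by_cases ha : ((a, d), s) ∈ N
    · rw [indicator_of_mem (show a ∈ {a | ((a, d), s) ∈ N} from ha), indicator_of_mem ha,
        Pi.one_apply, one_mul]
    · rw [indicator_of_notMem (show a ∉ {a | ((a, d), s) ∈ N} from ha), indicator_of_notMem ha,
        zero_mul]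
  rw [h.lintegral_data hv n (Φ := fun c => ENNReal.ofReal (W c)) hW.ennreal_ofReal,
    h.lintegral_data_next hv n (Φ := fun c => ENNReal.ofReal (B (c.1.2, c.2)))
      (hB.comp (measurable_fst.snd.prodMk measurable_snd)).ennreal_ofReal]
  refine lintegral_mono_ae ?_
  filter_upwards [hN0] with d hd
  -- The unnormalized posterior of the unknown function given the data `d`; working without
  -- normalization avoids dividing by a possibly vanishing evidence.
  set m : Measure E := (P.map e).withDensity fun a => dataLikelihood G v π a d with hm
  have hmuniv : m univ = ∫⁻ a, dataLikelihood G v π a d ∂(P.map e) := by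
    rw [hm, withDensity_apply _ MeasurableSet.univ, Measure.restrict_univ]
  have hmfin : IsFiniteMeasure m := by
    constructor
    rw [hmuniv]
    refine (lintegral_mono fun a => dataLikelihood_le _ _).trans_lt ?_
    simp only [lintegral_const, measure_univ, mul_one]
    exact (ENNReal.pow_ne_top ENNReal.ofReal_ne_top).lt_top
  have hWd : Measurable fun a => W (a, d) := hW.comp (measurable_id.prodMk measurable_const)
  have hBd : Measurable fun s => B (d, s) := hB.comp measurable_prodMk_left
  -- Up to the null part `N`, the event `B < W` lies in `bad`, whose relative mass is at most `exp
  -- (-s / 2)`. The domination needs `W` to be independent of the level `s`.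
  have key := lintegral_le_of_chiSquared_domination m hWd hBd (by
    filter_upwards [hd, chiSquared_two_ae_nonneg] with s hs hs0
    have hsub : {a | B (d, s) < W (a, d)} ⊆
        {a | ((a, d), s) ∈ N} ∪ {a | ((a, d), s) ∈ bad} := by
      intro a ha
      by_cases hb : ((a, d), s) ∈ bad
      · exact Or.inr hb
      · exact Or.inl ⟨hb, ha⟩
    have hbm : MeasurableSet {a | ((a, d), s) ∈ bad} := hbadm.preimage
      ((measurable_id.prodMk measurable_const).prodMk measurable_const)
    refine (measure_mono hsub).trans ((measure_union_le _ _).trans ?_)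
    rw [hm, withDensity_apply _ (hNd d s), hs, zero_add, withDensity_apply _ hbm, ← hm, hmuniv]
    exact hbad d s hs0)
  refine le_trans (le_of_eq ?_) (key.trans (le_of_eq ?_))
  · rw [hm, lintegral_withDensity_eq_lintegral_mul _ (hLd d) hWd.ennreal_ofReal]
    exact lintegral_congr fun a => mul_comm _ _
  · rw [hmuniv, ← lintegral_const_mul _ hBd.ennreal_ofReal]
    refine lintegral_congr fun s => ?_
    rw [lintegral_const_mul _ (hLd d), mul_comm]

end Adaptive

end RobustBO

namespace RobustBO

/-! ### Lipschitz estimates from partial derivatives -/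

section Lipschitz

variable {d : ℕ}

/-- The `ℓ¹` distance. -/
noncomputable def l1dist (a b : EuclideanSpace ℝ (Fin d)) : ℝ := ∑ j, |a j - b j|

lemma l1dist_nonneg (a b : EuclideanSpace ℝ (Fin d)) : 0 ≤ l1dist a b :=
  Finset.sum_nonneg fun _ _ => abs_nonneg _

lemma continuous_l1dist :
    Continuous fun p : EuclideanSpace ℝ (Fin d) × EuclideanSpace ℝ (Fin d) => l1dist p.1 p.2 := by
  unfold l1dist
  fun_prop

lemma norm_le_norm_of_abs_le {x y : EuclideanSpace ℝ (Fin d)} (h : ∀ j, |x j| ≤ |y j|) :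
    ‖x‖ ≤ ‖y‖ := by
  rw [EuclideanSpace.norm_eq, EuclideanSpace.norm_eq]
  refine Real.sqrt_le_sqrt (Finset.sum_le_sum fun j _ => ?_)
  simpa [sq_abs] using sq_le_sq.2 (by simpa using h j)

lemma l1dist_le_sqrt_mul_dist (a b : EuclideanSpace ℝ (Fin d)) :
    l1dist a b ≤ √d * dist a b := by
  rw [EuclideanSpace.dist_eq, ← Real.sqrt_mul (by positivity)]
  refine Real.le_sqrt_of_sq_le ?_
  have h := sq_sum_le_card_mul_sum_sq (s := Finset.univ) (f := fun j => |a j - b j|)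
  simpa [l1dist, Real.dist_eq] using h

variable {G : EuclideanSpace ℝ (Fin d) → ℝ} {U : Set (EuclideanSpace ℝ (Fin d))} {L : ℝ}

/-- Move from the centre to `a` by changing one coordinate at a time and apply the mean value
inequality on each axis-parallel segment. Every intermediate point is coordinatewise no farther from
the centre than `a`, so the path stays in the ball. -/
lemma abs_sub_le_of_lineDeriv_le_ball {u a : EuclideanSpace ℝ (Fin d)} {ε : ℝ}
    (hG : ∀ w ∈ Metric.ball u ε, ∀ j, LineDifferentiableAt ℝ G w (EuclideanSpace.single j 1) ∧
      |lineDeriv ℝ G w (EuclideanSpace.single j 1)| ≤ L)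
    (ha : a ∈ Metric.ball u ε) : |G a - G u| ≤ L * l1dist a u := by
  classical
  let p : Finset (Fin d) → EuclideanSpace ℝ (Fin d) :=
    fun J => WithLp.toLp 2 fun j => if j ∈ J then a j else u j
  have hball : ∀ x : EuclideanSpace ℝ (Fin d), (∀ j, |x j - u j| ≤ |a j - u j|) →
      x ∈ Metric.ball u ε := by
    intro x hx
    rw [Metric.mem_ball, dist_eq_norm] at ha ⊢
    exact (norm_le_norm_of_abs_le fun j => by simpa using hx j).trans_lt ha
  have key : ∀ J : Finset (Fin d), |G (p J) - G u| ≤ L * ∑ j ∈ J, |a j - u j| := by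
    intro J
    induction J using Finset.induction_on with
    | empty =>
      have : p ∅ = u := by ext j; simp [p]
      simp [this]
    | insert j J hj ih =>
      set δ := a j - u j with hδ
      set v : EuclideanSpace ℝ (Fin d) := EuclideanSpace.single j 1 with hv
      have hend : p (insert j J) = p J + δ • v := by
        ext i
        by_cases hi : i = j
        · subst hi
          simp [p, hj, v, hδ]
        · simp [p, hi, v]
      have hmem : ∀ t ∈ uIcc 0 δ, p J + t • v ∈ Metric.ball u ε := by
        intro t ht
        refine hball _ fun i => ?_
        by_cases hi : i = j
        · subst hi
          have h1 : |t - 0| ≤ |δ - 0| := abs_sub_left_of_mem_uIcc ht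
          simpa [p, hj, v, hδ] using h1
        · by_cases hiJ : i ∈ J <;> simp [p, hi, hiJ, v]
      have hder : ∀ t ∈ uIcc 0 δ, HasDerivWithinAt (fun t : ℝ => G (p J + t • v))
          (lineDeriv ℝ G (p J + t • v) v) (uIcc 0 δ) t := by
        intro t ht
        have h1 := (hG _ (hmem t ht) j).1.hasLineDerivAt
        have h2 : HasDerivAt (fun s : ℝ => G (p J + t • v + s • v))
          (lineDeriv ℝ G (p J + t • v) v) 0 := h1
        have h3 := HasDerivAt.comp_sub_const t t (by simpa using h2)
        refine HasDerivAt.hasDerivWithinAt (h3.congr_of_eventuallyEq ?_)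
        refine Eventually.of_forall fun s => ?_
        dsimp only
        rw [add_assoc, ← add_smul]
        congr 3
        ring
      have hmv := (convex_uIcc (𝕜 := ℝ) 0 δ).norm_image_sub_le_of_norm_hasDerivWithin_le hder
        (C := L) (fun t ht => (hG _ (hmem t ht) j).2) left_mem_uIcc right_mem_uIcc
      rw [Real.norm_eq_abs, Real.norm_eq_abs, sub_zero, zero_smul, add_zero, ← hend] at hmv
      rw [Finset.sum_insert hj, mul_add]
      calc |G (p (insert j J)) - G u|
          ≤ |G (p (insert j J)) - G (p J)| + |G (p J) - G u| := abs_sub_le _ _ _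
        _ ≤ _ := add_le_add hmv ih
  have hfull := key Finset.univ
  have : p Finset.univ = a := by ext j; simp [p]
  rwa [this] at hfull

/-- Existence of partial derivatives does not give a derivative along the segment from `a` to `b`.
Instead, the local estimate on balls is propagated along the segment by continuous induction: the
parameters `t` with `|G (γ t) - G a| ≤ C t` form a closed set that can be extended to the right. The
local estimates add up because the `ℓ¹` distance is additive along a segment. -/
lemma abs_sub_le_of_lineDeriv_le (hU : IsOpen U) (hconv : Convex ℝ U) (hGc : ContinuousOn G U)
    (hG : ∀ w ∈ U, ∀ j, LineDifferentiableAt ℝ G w (EuclideanSpace.single j 1) ∧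
      |lineDeriv ℝ G w (EuclideanSpace.single j 1)| ≤ L)
    {a b : EuclideanSpace ℝ (Fin d)} (ha : a ∈ U) (hb : b ∈ U) :
    |G b - G a| ≤ L * l1dist b a := by
  set γ : ℝ → EuclideanSpace ℝ (Fin d) := fun t => a + t • (b - a) with hγ
  set C := L * l1dist b a with hC
  have hγU : ∀ t ∈ Icc (0 : ℝ) 1, γ t ∈ U := fun t ht =>
    hconv.add_smul_sub_mem ha hb ht
  have hγc : Continuous γ := by fun_prop
  have hφc : ContinuousOn (fun t => |G (γ t) - G a|) (Icc 0 1) :=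
    ((hGc.comp hγc.continuousOn hγU).sub continuousOn_const).abs
  have hdist : ∀ s t : ℝ, l1dist (γ s) (γ t) = |s - t| * l1dist b a := by
    intro s t
    simp only [l1dist, Finset.mul_sum, hγ]
    refine Finset.sum_congr rfl fun j _ => ?_
    rw [← abs_mul]
    congr 1
    simp
    ring
  have hclosed : IsClosed ({t | |G (γ t) - G a| ≤ C * t} ∩ Icc (0 : ℝ) 1) := by
    have := isClosed_Icc.isClosed_le hφc ((continuousOn_const (c := C)).mul continuousOn_id)
    convert! this using 1
    ext t
    simp [and_comm]
  have hsub := hclosed.Icc_subset_of_forall_mem_nhdsWithin (by simp [hγ]) (by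
    rintro t ⟨ht, ht0, ht1⟩
    obtain ⟨ε, hε, hball⟩ := Metric.isOpen_iff.1 hU _ (hγU t ⟨ht0, ht1.le⟩)
    have h1 : ∀ᶠ s in 𝓝 t, γ s ∈ Metric.ball (γ t) ε :=
      hγc.continuousAt (Metric.ball_mem_nhds _ hε)
    filter_upwards [h1.filter_mono nhdsWithin_le_nhds, self_mem_nhdsWithin] with s hs hst
    have h2 := abs_sub_le_of_lineDeriv_le_ball (fun w hw => hG w (hball hw)) hs
    rw [hdist, abs_of_pos (a := s - t) (sub_pos.2 (mem_Ioi.1 hst))] at h2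
    have h3 := abs_sub_le (G (γ s)) (G (γ t)) (G a)
    have h4 : |G (γ t) - G a| ≤ C * t := ht
    show |G (γ s) - G a| ≤ C * s
    rw [hC] at *
    linarith)
  have h1 := hsub (right_mem_Icc.2 zero_le_one)
  simpa [hγ] using h1

variable {Ω : Set (EuclideanSpace ℝ (Fin d))}

lemma extendZero_apply (g : Ω → ℝ) (w : Ω) : extendZero g w = g w :=
  Subtype.val_injective.extend_apply g 0 w

/-- A continuous function on a convex body is Lipschitz for the `ℓ¹` distance if its partial
derivatives in the interior are bounded. -/
lemma abs_sub_le_of_partialDeriv_le (hΩ_convex : Convex ℝ Ω) (hΩ_int : (interior Ω).Nonempty)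
    {g : Ω → ℝ} (hg : Continuous g) (hdiff : ∀ j, ∀ w ∈ interior Ω, HasPartialAt g j w)
    (hL : ∀ j, ∀ w ∈ interior Ω, |partialDeriv g j w| ≤ L) (w w' : Ω) :
    |g w - g w'| ≤ L * l1dist (w : EuclideanSpace ℝ (Fin d)) w' := by
  have hcont : ContinuousOn (extendZero g) (interior Ω) := by
    refine ContinuousOn.mono ?_ interior_subset
    rw [continuousOn_iff_continuous_domRestrict]
    convert! hg using 1
    ext w
    exact extendZero_apply g w
  -- The interior of a convex body is dense in it, so by continuity the estimate extends to the
  -- boundary, where no derivatives are assumed.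
  have hdense : Dense {w : Ω | (w : EuclideanSpace ℝ (Fin d)) ∈ interior Ω} := by
    rw [Subtype.dense_iff]
    intro w hw
    have h1 : Subtype.val '' {w : Ω | (w : EuclideanSpace ℝ (Fin d)) ∈ interior Ω} =
        interior Ω := by
      ext x
      simp only [mem_image, mem_ofPred_eq, Subtype.exists, exists_and_left, exists_prop,
        exists_eq_right_right]
      exact ⟨fun h => h.1, fun h => ⟨h, interior_subset h⟩⟩
    rw [h1, hΩ_convex.closure_interior_eq_closure_of_nonempty_interior hΩ_int]
    exact subset_closure hw
  have hclosed : IsClosed {p : Ω × Ω | |g p.1 - g p.2| ≤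
      L * l1dist (p.1 : EuclideanSpace ℝ (Fin d)) p.2} := by
    refine isClosed_le (by fun_prop) (continuous_const.mul ?_)
    exact continuous_l1dist.comp (f := fun p : Ω × Ω =>
      ((p.1 : EuclideanSpace ℝ (Fin d)), (p.2 : EuclideanSpace ℝ (Fin d)))) (by fun_prop)
  have hsub : {w : Ω | (w : EuclideanSpace ℝ (Fin d)) ∈ interior Ω} ×ˢ
      {w : Ω | (w : EuclideanSpace ℝ (Fin d)) ∈ interior Ω} ⊆ {p : Ω × Ω | |g p.1 - g p.2| ≤
      L * l1dist (p.1 : EuclideanSpace ℝ (Fin d)) p.2} := by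
    rintro ⟨a, b⟩ ⟨ha, hb⟩
    have h := abs_sub_le_of_lineDeriv_le isOpen_interior hΩ_convex.interior hcont
      (fun w hw j => ⟨hdiff j w hw, hL j w hw⟩) hb ha
    rwa [extendZero_apply, extendZero_apply] at h
  exact hclosed.closure_subset_iff.2 hsub ((hdense.prod hdense) (w, w'))

/-- The least common Lipschitz constant (for the `ℓ¹` distance) of the functions `F x`, tested on a
countable dense set. -/
noncomputable def lipConst {X : Type*} [Nonempty Ω] (F : X → Ω → ℝ) : ℝ≥0∞ :=
  ⨆ x, ⨆ i : ℕ, ⨆ j : ℕ,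
    ENNReal.ofReal |F x (TopologicalSpace.denseSeq Ω i) - F x (TopologicalSpace.denseSeq Ω j)| /
      ENNReal.ofReal (l1dist (TopologicalSpace.denseSeq Ω i : EuclideanSpace ℝ (Fin d))
        (TopologicalSpace.denseSeq Ω j))

lemma lipConst_le {X : Type*} [Nonempty Ω] {F : X → Ω → ℝ}
    (hF : ∀ x w w', |F x w - F x w'| ≤ L * l1dist (w : EuclideanSpace ℝ (Fin d)) w') :
    lipConst F ≤ ENNReal.ofReal L := by
  refine iSup_le fun x => iSup_le fun i => iSup_le fun j => ENNReal.div_le_of_le_mul ?_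
  rw [← ENNReal.ofReal_mul' (l1dist_nonneg _ _)]
  exact ENNReal.ofReal_le_ofReal (hF x _ _)

lemma abs_sub_le_lipConst {X : Type*} [Nonempty Ω] {F : X → Ω → ℝ}
    (hF : ∀ x, Continuous (F x)) (hfin : lipConst F ≠ ⊤) (x : X) (w w' : Ω) :
    |F x w - F x w'| ≤ (lipConst F).toReal * l1dist (w : EuclideanSpace ℝ (Fin d)) w' := by
  have hclosed : IsClosed {p : Ω × Ω | |F x p.1 - F x p.2| ≤
      (lipConst F).toReal * l1dist (p.1 : EuclideanSpace ℝ (Fin d)) p.2} := by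
    have := hF x
    refine isClosed_le (by fun_prop) (continuous_const.mul ?_)
    exact continuous_l1dist.comp (f := fun p : Ω × Ω =>
      ((p.1 : EuclideanSpace ℝ (Fin d)), (p.2 : EuclideanSpace ℝ (Fin d)))) (by fun_prop)
  refine isClosed_property2 (p := fun w w' => |F x w - F x w'| ≤
    (lipConst F).toReal * l1dist (w : EuclideanSpace ℝ (Fin d)) w')
    (TopologicalSpace.denseRange_denseSeq Ω) hclosed (fun i j => ?_) w w'
  set a := TopologicalSpace.denseSeq Ω i
  set b := TopologicalSpace.denseSeq Ω j
  have h1 : ENNReal.ofReal |F x a - F x b| /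
      ENNReal.ofReal (l1dist (a : EuclideanSpace ℝ (Fin d)) b) ≤ lipConst F :=
    le_iSup_of_le x (le_iSup_of_le i (le_iSup_of_le j le_rfl))
  rcases (l1dist_nonneg (a : EuclideanSpace ℝ (Fin d)) b).eq_or_lt with h0 | h0
  · have hab : a = b := by
      ext1; ext1 j
      have := (Finset.sum_eq_zero_iff_of_nonneg fun j _ => abs_nonneg _).1 h0.symm j
        (Finset.mem_univ j)
      exact sub_eq_zero.1 (abs_eq_zero.1 this)
    rw [hab, sub_self, abs_zero]
    exact mul_nonneg ENNReal.toReal_nonneg (l1dist_nonneg _ _)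
  · rw [ENNReal.div_le_iff (by simpa using h0) ENNReal.ofReal_ne_top, ← ENNReal.ofReal_toReal hfin,
      ← ENNReal.ofReal_mul ENNReal.toReal_nonneg] at h1
    exact (ENNReal.ofReal_le_ofReal_iff (by positivity)).1 h1

lemma measurable_lipConst {X S : Type*} [Countable X] [MeasurableSpace S] [Nonempty Ω]
    {F : S → X → Ω → ℝ} (hF : ∀ x w, Measurable fun ω => F ω x w) :
    Measurable fun ω => lipConst (F ω) := by
  unfold lipConst
  refine .iSup fun x => .iSup fun i => .iSup fun j => ?_
  have h1 := hF x (TopologicalSpace.denseSeq Ω i)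
  have h2 := hF x (TopologicalSpace.denseSeq Ω j)
  fun_prop

end Lipschitz

/-! ### Sub-Gaussian tails -/

section Tail

variable {S : Type*} [MeasurableSpace S] {P : Measure S} [IsProbabilityMeasure P]

-- Finiteness almost surely is recorded separately because the error bound uses the real value of
-- the Lipschitz constant, and `ENNReal.toReal` sends `⊤` to `0`.
omit [IsProbabilityMeasure P] in
lemma ae_ne_top_of_tail {Z : S → ℝ≥0∞} {A b : ℝ} (hb : 0 < b)
    (hZ : ∀ L, 0 < L → P {ω | ENNReal.ofReal L < Z ω} ≤
      ENNReal.ofReal (A * Real.exp (-(L / b) ^ 2))) : ∀ᵐ ω ∂P, Z ω ≠ ⊤ := by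
  have hlim : Tendsto (fun L : ℝ => ENNReal.ofReal (A * Real.exp (-(L / b) ^ 2))) atTop (𝓝 0) := by
    have h1 : Tendsto (fun L : ℝ => (L / b) ^ 2) atTop atTop :=
      (tendsto_pow_atTop two_ne_zero).comp (tendsto_id.atTop_div_const hb)
    have h2 := (Real.tendsto_exp_neg_atTop_nhds_zero.comp h1).const_mul A
    rw [mul_zero] at h2
    have h3 := (ENNReal.continuous_ofReal.tendsto 0).comp h2
    rwa [ENNReal.ofReal_zero] at h3
  have h0 : P {ω | Z ω = ⊤} ≤ 0 := by
    refine ge_of_tendsto hlim ?_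
    filter_upwards [eventually_gt_atTop 0] with L hL
    refine (measure_mono fun ω hω => ?_).trans (hZ L hL)
    rw [mem_ofPred_eq, show Z ω = ⊤ from hω]
    exact ENNReal.ofReal_lt_top
  exact measure_eq_zero_iff_ae_notMem.1 (le_antisymm h0 zero_le)

lemma lintegral_le_of_tail {Z : S → ℝ≥0∞} (hZm : Measurable Z) {A b : ℝ} (hA : 0 < A) (hb : 0 < b)
    (hZ : ∀ L, 0 < L → P {ω | ENNReal.ofReal L < Z ω} ≤
      ENNReal.ofReal (A * Real.exp (-(L / b) ^ 2))) :
    ∫⁻ ω, Z ω ∂P ≤ ENNReal.ofReal (b * (√(Real.log A) + √Real.pi / 2)) := by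
  have hfin := ae_ne_top_of_tail hb hZ
  have e1 : ∫⁻ ω, Z ω ∂P = ∫⁻ ω, ENNReal.ofReal (Z ω).toReal ∂P :=
    lintegral_congr_ae (hfin.mono fun ω hω => (ENNReal.ofReal_toReal hω).symm)
  -- Above `L₀` the tail bound `A exp (-(L / b)²)` is at most `1`; below it the trivial bound `1` is
  -- used. For `A < 1` the root is `0`, and so is `L₀`.
  set L₀ := b * √(Real.log A) with hL₀
  have hL₀0 : 0 ≤ L₀ := by positivity
  rw [e1, lintegral_eq_lintegral_meas_lt P (ae_of_all _ fun _ => ENNReal.toReal_nonneg)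
    (hZm.ennreal_toReal.aemeasurable), ← Ioc_union_Ioi_eq_Ioi hL₀0,
    lintegral_union measurableSet_Ioi (Ioc_disjoint_Ioi le_rfl)]
  have h1 : ∫⁻ t in Ioc 0 L₀, P {ω | t < (Z ω).toReal} ≤ ENNReal.ofReal L₀ := by
    refine (lintegral_mono fun t => prob_le_one).trans ?_
    simp
  have hb2 : 0 < 1 / b ^ 2 := by positivity
  have h2 : ∫⁻ t in Ioi L₀, P {ω | t < (Z ω).toReal} ≤ ENNReal.ofReal (b * (√Real.pi / 2)) := by
    calc ∫⁻ t in Ioi L₀, P {ω | t < (Z ω).toReal}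
        ≤ ∫⁻ t in Ioi L₀, ENNReal.ofReal A * ENNReal.ofReal (Real.exp (-(1 / b ^ 2) * t ^ 2)) := by
          refine setLIntegral_mono' measurableSet_Ioi fun t ht => ?_
          have ht0 : 0 < t := hL₀0.trans_lt ht
          refine (measure_mono fun ω hω => ?_).trans ((hZ t ht0).trans (le_of_eq ?_))
          · exact ENNReal.ofReal_lt_iff_lt_toReal ht0.le (fun h => by
              rw [mem_ofPred_eq, h] at hω
              exact absurd hω (by simpa using ht0.le)) |>.2 hω
          · rw [← ENNReal.ofReal_mul hA.le]
            congr 3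
            field_simp
      _ ≤ ENNReal.ofReal A * (ENNReal.ofReal (Real.exp (-(1 / b ^ 2) * L₀ ^ 2)) *
            ENNReal.ofReal (√(Real.pi / (1 / b ^ 2)) / 2)) := by
          rw [lintegral_const_mul' _ _ ENNReal.ofReal_ne_top, ← setLIntegral_Ioi_zero_exp_neg_sq hb2]
          gcongr
          exact setLIntegral_Ioi_exp_neg_sq_le hL₀0 hb2
      _ ≤ _ := by
          rw [← mul_assoc, ← ENNReal.ofReal_mul hA.le, ← ENNReal.ofReal_mul (by positivity)]
          refine ENNReal.ofReal_le_ofReal ?_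
          have hpi : √(Real.pi / (1 / b ^ 2)) = b * √Real.pi := by
            rw [div_div_eq_mul_div, div_one, mul_comm, Real.sqrt_mul (by positivity),
              Real.sqrt_sq hb.le]
          have hexp : A * Real.exp (-(1 / b ^ 2) * L₀ ^ 2) ≤ 1 := by
            have h3 : -(1 / b ^ 2) * L₀ ^ 2 = -√(Real.log A) ^ 2 := by
              rw [hL₀]
              field_simp
            rw [h3]
            rcases le_total 0 (Real.log A) with h | h
            · rw [Real.sq_sqrt h, Real.exp_neg, Real.exp_log hA, mul_inv_cancel₀ hA.ne']
            · rw [Real.sqrt_eq_zero_of_nonpos h]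
              simpa using (Real.log_nonpos_iff hA.le).1 h
          rw [hpi, mul_div_assoc]
          exact mul_le_of_le_one_left (by positivity) hexp
  refine (add_le_add h1 h2).trans (le_of_eq ?_)
  rw [← ENNReal.ofReal_add hL₀0 (by positivity)]
  congr 1
  rw [hL₀]
  ring

end Tail

/-! ### Discretization -/

section Grid

variable {d : ℕ} {Ω : Set (EuclideanSpace ℝ (Fin d))}

lemma exists_gridIndex {τ : ℕ} (hτ : 0 < τ) {u δ : ℝ} (hu : 0 ≤ u) (hu' : u ≤ τ * δ) :
    ∃ c : Fin τ, (c : ℝ) * δ ≤ u ∧ u ≤ ((c : ℝ) + 1) * δ := by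
  induction τ with
  | zero => exact absurd hτ (lt_irrefl _)
  | succ n ih =>
    rcases Nat.eq_zero_or_pos n with rfl | hn
    · exact ⟨0, by simpa using hu, by simpa using hu'⟩
    rcases le_total u (n * δ) with h | h
    · obtain ⟨c, hc⟩ := ih hn h
      exact ⟨c.castSucc, by simpa using hc⟩
    · exact ⟨Fin.last n, by simpa using h, by simpa using hu'⟩

lemma exists_gridCell {τ : ℕ} (hτ : 0 < τ) {lo hi : Fin d → ℝ} {w : EuclideanSpace ℝ (Fin d)}
    (hw : ∀ j, lo j ≤ w j ∧ w j ≤ hi j) : ∃ c : Fin d → Fin τ, w ∈ gridCell lo hi τ c := by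
  have hτ' : (0 : ℝ) < τ := by exact_mod_cast hτ
  have h : ∀ j, ∃ c : Fin τ, (c : ℝ) * ((hi j - lo j) / τ) ≤ w j - lo j ∧
      w j - lo j ≤ ((c : ℝ) + 1) * ((hi j - lo j) / τ) := fun j =>
    exists_gridIndex hτ (sub_nonneg.2 (hw j).1) (by
      rw [mul_div_cancel₀ _ hτ'.ne']
      linarith [(hw j).2])
  choose c hc using h
  exact ⟨c, fun j => ⟨by linarith [(hc j).1], by linarith [(hc j).2]⟩⟩

/-- Rounding to a grid discretization moves points by at most `d r / τ` in the `ℓ¹` distance. -/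
lemma l1dist_rnd_le {r : ℝ} {τ : ℕ} (hτ : 0 < τ) {D : Finset Ω}
    (hD : IsGridDiscretization Ω r τ D) {rnd : Ω → Ω} (hrnd : IsNearestPointMap D rnd) (w : Ω) :
    l1dist (w : EuclideanSpace ℝ (Fin d)) (rnd w) ≤ d * r / τ := by
  obtain ⟨lo, hi, hbox, hΩ, -, hcell⟩ := hD
  have hτ' : (0 : ℝ) < τ := by exact_mod_cast hτ
  obtain ⟨c, hc⟩ := exists_gridCell hτ (hΩ w w.2)
  obtain ⟨w', hw', hw'c⟩ := hcell c ⟨w, w.2, hc⟩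
  rcases Nat.eq_zero_or_pos d with rfl | hd
  · simp [l1dist]
  have hr : 0 ≤ r := (hbox ⟨0, hd⟩).1.trans ((hbox ⟨0, hd⟩).2.1.trans (hbox ⟨0, hd⟩).2.2)
  have hcoord : ∀ j, |(w : EuclideanSpace ℝ (Fin d)) j - (w' : EuclideanSpace ℝ (Fin d)) j| ≤
      r / τ := by
    intro j
    have h1 : (hi j - lo j) / τ ≤ r / τ := by
      gcongr
      linarith [(hbox j).1, (hbox j).2.2]
    have h2 := hc j
    have h3 := hw'c j
    rw [add_mul] at h2 h3
    rw [abs_le]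
    constructor <;> linarith
  have hdist : dist (w : EuclideanSpace ℝ (Fin d)) w' ≤ √d * (r / τ) := by
    rw [EuclideanSpace.dist_eq]
    calc √(∑ j, dist ((w : EuclideanSpace ℝ (Fin d)) j) ((w' : EuclideanSpace ℝ (Fin d)) j) ^ 2)
        ≤ √(∑ _j : Fin d, (r / τ) ^ 2) := by
          refine Real.sqrt_le_sqrt (Finset.sum_le_sum fun j _ => ?_)
          rw [Real.dist_eq]
          exact pow_le_pow_left₀ (abs_nonneg _) (hcoord j) 2
      _ = √d * (r / τ) := by
          rw [Finset.sum_const, Finset.card_univ, Fintype.card_fin, nsmul_eq_mul,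
            Real.sqrt_mul (by positivity), Real.sqrt_sq (by positivity)]
  have hnear : dist (w : EuclideanSpace ℝ (Fin d)) (rnd w) ≤ √d * (r / τ) :=
    ((hrnd w).2 w' hw').trans hdist
  -- The nearest point is chosen for the Euclidean distance, so the comparison with `w'` passes
  -- through it. The two factors `√d` give `d r / τ`.
  calc l1dist (w : EuclideanSpace ℝ (Fin d)) (rnd w)
      ≤ √d * dist (w : EuclideanSpace ℝ (Fin d)) (rnd w) := l1dist_le_sqrt_mul_dist _ _
    _ ≤ √d * (√d * (r / τ)) := by gcongr
    _ = d * r / τ := by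
        rw [← mul_assoc, Real.mul_self_sqrt (by positivity)]
        ring

end Grid

end RobustBO

namespace RobustBO

/-! ### Measurability of the posterior -/

section MatrixMeasurability

variable {α : Type*} [MeasurableSpace α]

lemma measurable_det {n : ℕ} {M : α → Matrix (Fin n) (Fin n) ℝ}
    (hM : ∀ i j, Measurable fun a => M a i j) : Measurable fun a => (M a).det := by
  simp only [Matrix.det_apply]
  exact Finset.measurable_fun_sum _ fun σ _ =>
    (Finset.measurable_fun_prod _ fun i _ => hM _ _).const_smul _

lemma measurable_inv_apply {n : ℕ} {M : α → Matrix (Fin n) (Fin n) ℝ}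
    (hM : ∀ i j, Measurable fun a => M a i j) (i j : Fin n) :
    Measurable fun a => (M a)⁻¹ i j := by
  simp only [Matrix.inv_def, Ring.inverse_eq_inv', Matrix.smul_apply, Matrix.adjugate_apply,
    smul_eq_mul]
  refine (measurable_det hM).inv.mul (measurable_det fun i' j' => ?_)
  by_cases h : i' = j
  · subst h
    simp only [Matrix.updateRow_self]
    exact measurable_const
  · simp only [Matrix.updateRow_ne h]
    exact hM i' j'

variable {Q : Type*} [MeasurableSpace Q] {k : Q → Q → ℝ}

lemma measurable_posteriorWeights (hk : Measurable fun z : Q × Q => k z.1 z.2) (v : ℝ) {n : ℕ}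
    {z : α → Fin n → Q} {p : α → Q} (hz : ∀ i, Measurable fun a => z a i) (hp : Measurable p)
    (i : Fin n) : Measurable fun a => posteriorWeights k v (z a) (p a) i := by
  simp only [posteriorWeights, Matrix.vecMul, dotProduct]
  refine Finset.measurable_fun_sum _ fun j _ => ?_
  refine (hk.comp (hp.prodMk (hz j))).mul (measurable_inv_apply (fun i' j' => ?_) j i)
  exact (hk.comp ((hz i').prodMk (hz j'))).add measurable_const

lemma measurable_posteriorVar (hk : Measurable fun z : Q × Q => k z.1 z.2) (v : ℝ) {n : ℕ}
    {z : α → Fin n → Q} {p : α → Q} (hz : ∀ i, Measurable fun a => z a i) (hp : Measurable p) :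
    Measurable fun a => posteriorVar k v (z a) (p a) := by
  simp only [posteriorVar_eq]
  exact (hk.comp (hp.prodMk hp)).sub (Finset.measurable_fun_sum _ fun i _ =>
    (measurable_posteriorWeights hk v hz hp i).mul (hk.comp (hp.prodMk (hz i))))

lemma measurable_posteriorMean (hk : Measurable fun z : Q × Q => k z.1 z.2) (v : ℝ) {n : ℕ}
    {z : α → Fin n → Q} {y : α → Fin n → ℝ} {p : α → Q} (hz : ∀ i, Measurable fun a => z a i)
    (hy : ∀ i, Measurable fun a => y a i) (hp : Measurable p) :
    Measurable fun a => posteriorMean k v (z a) (y a) (p a) := by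
  simp only [posteriorMean_eq]
  exact Finset.measurable_fun_sum _ fun i _ =>
    (measurable_posteriorWeights hk v hz hp i).mul (hy i)

end MatrixMeasurability

/-! ### The run of the algorithm as an adaptive experiment -/

namespace Run

variable {S X : Type*} {d : ℕ} {Ω : Set (EuclideanSpace ℝ (Fin d))}

/-- The sample space with the `σ`-algebra generated by the unknown function. -/
def PathSpace (_T : Run S X Ω) : Type _ := S

instance (T : Run S X Ω) : MeasurableSpace T.PathSpace := T.sources none

/-- The sample point, as an element of the path space. -/
def toPath (T : Run S X Ω) (ω : S) : T.PathSpace := ω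

/-- The unknown function. -/
def pathFun (T : Run S X Ω) (a : T.PathSpace) (p : X × Ω) : ℝ := T.f p a

/-- The data `(ξ_i, y_i)` of the first `n` rounds. -/
def data (T : Run S X Ω) (n : ℕ) (ω : S) (i : Fin n) : ℝ × ℝ := (T.ξ (i + 1) ω, T.y (i + 1) ω)

variable {T : Run S X Ω}

lemma history_le_comap_data (T : Run S X Ω) (n : ℕ) :
    T.history n ≤ MeasurableSpace.comap (T.data n) inferInstance := by
  refine iSup_le fun i => sup_le ?_ ?_
  · rintro _ ⟨s, hs, rfl⟩
    exact ⟨{g | (g i).1 ∈ s}, (measurable_pi_apply i).fst hs, rfl⟩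
  · rintro _ ⟨s, hs, rfl⟩
    exact ⟨{g | (g i).2 ∈ s}, (measurable_pi_apply i).snd hs, rfl⟩

lemma history_sup_le_comap_data (T : Run S X Ω) (n : ℕ) :
    T.history n ⊔ MeasurableSpace.comap (T.ξ (n + 1)) inferInstance ≤
      MeasurableSpace.comap (fun ω => (T.data n ω, T.ξ (n + 1) ω)) inferInstance := by
  refine sup_le ((T.history_le_comap_data n).trans ?_) ?_
  · rintro _ ⟨s, hs, rfl⟩
    exact ⟨Prod.fst ⁻¹' s, measurable_fst hs, rfl⟩
  · rintro _ ⟨s, hs, rfl⟩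
    exact ⟨Prod.snd ⁻¹' s, measurable_snd hs, rfl⟩

section

variable [MeasurableSpace S] {P : Measure S} [IsProbabilityMeasure P] {k : X × Ω → X × Ω → ℝ}
  {v : ℝ≥0} {ρ : (Ω → ℝ) → ℝ} {rnd : ℕ → Ω → Ω} [MeasurableSpace X]

omit [MeasurableSpace S] [MeasurableSpace X] in
lemma measurable_f_pathSpace (T : Run S X Ω) (p : X × Ω) :
    Measurable fun a : T.PathSpace => T.pathFun a p := by
  intro s hs
  exact (le_iSup (fun p => MeasurableSpace.comap (T.f p) inferInstance) p) _ ⟨s, hs, rfl⟩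

omit [IsProbabilityMeasure P] [MeasurableSpace X] in
lemma IsModel.sources_le (h : T.IsModel P k v) (i : Option (ℕ ⊕ ℕ)) :
    T.sources i ≤ (inferInstance : MeasurableSpace S) := by
  rcases i with _ | i | i
  · exact iSup_le fun p => (h.measurable_f p).comap_le
  · exact (h.measurable_noise _ (by omega)).comap_le
  · exact (h.measurable_xi _ (by omega)).comap_le

omit [IsProbabilityMeasure P] [MeasurableSpace X] in
lemma IsModel.measurable_toPath (h : T.IsModel P k v) : Measurable T.toPath :=
  fun _ hs => h.sources_le none _ hs

-- Joint measurability in function and point: sample paths are continuous in `w`, and `X` is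
-- countable.
omit [IsProbabilityMeasure P] in
lemma IsModel.measurable_pathFun [Countable X] [MeasurableSingletonClass X]
    (h : T.IsModel P k v) :
    Measurable fun z : T.PathSpace × (X × Ω) => T.pathFun z.1 z.2 := by
  have h1 : ∀ x : X, Measurable fun z : T.PathSpace × Ω => T.pathFun z.1 (x, z.2) := by
    intro x
    have h2 := measurable_uncurry_of_continuous_of_measurable
      (u := fun (w : Ω) (a : T.PathSpace) => T.pathFun a (x, w))
      (fun a => h.continuous_path a x) fun w => T.measurable_f_pathSpace (x, w)
    exact h2.comp measurable_swap
  have h2 : Measurable fun z : (T.PathSpace × Ω) × X => T.pathFun z.1.1 (z.2, z.1.2) :=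
    measurable_from_prod_countable_left h1
  exact h2.comp ((measurable_fst.prodMk measurable_snd.snd).prodMk measurable_snd.fst)

lemma IsModel.measurable_kernel [Countable X] [MeasurableSingletonClass X]
    (h : T.IsModel P k v) : Measurable fun z : (X × Ω) × (X × Ω) => k z.1 z.2 := by
  have h1 : Measurable fun z : ((X × Ω) × (X × Ω)) × S => T.f z.1.1 z.2 :=
    h.measurable_pathFun.comp
      ((h.measurable_toPath.comp measurable_snd).prodMk measurable_fst.fst)
  have h2 : Measurable fun z : ((X × Ω) × (X × Ω)) × S => T.f z.1.2 z.2 :=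
    h.measurable_pathFun.comp
      ((h.measurable_toPath.comp measurable_snd).prodMk measurable_fst.snd)
  have h3 : (fun z : (X × Ω) × (X × Ω) => k z.1 z.2) =
      fun z => ∫ ω, T.f z.1 ω * T.f z.2 ω ∂P := by
    ext z
    rw [← h.covariance_eq, covariance]
    simp [h.mean_zero]
  rw [h3]
  exact (h1.mul h2).stronglyMeasurable.integral_prod_right'.measurable

omit [IsProbabilityMeasure P] [MeasurableSpace X] in
lemma IsModel.isPosSemidefKernel (h : T.IsModel P k v) : IsPosSemidefKernel k :=
  isPosSemidefKernel_covariance h.gaussian h.covariance_eq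

-- Doob–Dynkin factorization: a selection measurable with respect to the data is a measurable
-- function of the data, since the target is a standard Borel space.
omit [MeasurableSpace S] in
lemma IsAlgorithm.exists_policy [Countable X] [MeasurableSingletonClass X]
    (h : T.IsAlgorithm k v ρ rnd) (hΩ : MeasurableSet Ω) [Nonempty (X × Ω)] :
    ∃ π : ∀ n, (Fin n → ℝ × ℝ) × ℝ → X × Ω, (∀ n, Measurable (π n)) ∧
      ∀ n ω, (T.x (n + 1) ω, T.w (n + 1) ω) = π n (T.data n ω, T.ξ (n + 1) ω) := by
  have := hΩ.standardBorel
  have hex : ∀ n, ∃ g : (Fin n → ℝ × ℝ) × ℝ → X × Ω, Measurable g ∧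
      (fun ω => (T.x (n + 1) ω, T.w (n + 1) ω)) =
        g ∘ fun ω => (T.data n ω, T.ξ (n + 1) ω) := by
    intro n
    exact Measurable.exists_eq_measurable_comp (Measurable.mono
      ((h.measurable_x n).prodMk (h.measurable_w n)) (T.history_sup_le_comap_data n) le_rfl)
  choose π hπ hπ' using hex
  exact ⟨π, hπ, fun n ω => congrFun (hπ' n) ω⟩

omit [MeasurableSpace S] in
lemma IsAlgorithm.exists_estimator [Countable X] [MeasurableSingletonClass X] [Nonempty X]
    (h : T.IsAlgorithm k v ρ rnd) (n : ℕ) :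
    ∃ g : (Fin n → ℝ × ℝ) → X, Measurable g ∧ ∀ ω, T.xhat (n + 1) ω = g (T.data n ω) := by
  obtain ⟨g, hg, hg'⟩ := Measurable.exists_eq_measurable_comp
    (Measurable.mono (h.measurable_xhat n) (T.history_le_comap_data n) le_rfl)
  exact ⟨g, hg, fun ω => congrFun hg' ω⟩

omit [MeasurableSpace S] [MeasurableSpace X] in
lemma data_succ {π : ∀ n, (Fin n → ℝ × ℝ) × ℝ → X × Ω}
    (hπ : ∀ n ω, (T.x (n + 1) ω, T.w (n + 1) ω) = π n (T.data n ω, T.ξ (n + 1) ω))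
    (n : ℕ) (ω : S) : T.data (n + 1) ω = snocData (T.data n ω)
      (T.ξ (n + 1) ω, T.pathFun (T.toPath ω) (π n (T.data n ω, T.ξ (n + 1) ω)) +
        T.ε (n + 1) ω) := by
  rw [← hπ]
  unfold snocData
  ext1 i
  refine Fin.lastCases ?_ (fun j => ?_) i
  · rw [Fin.snoc_last]
    rfl
  · rw [Fin.snoc_castSucc]
    rfl

omit [MeasurableSpace S] [MeasurableSpace X] in
lemma policyPoints_data {π : ∀ n, (Fin n → ℝ × ℝ) × ℝ → X × Ω}
    (hπ : ∀ n ω, (T.x (n + 1) ω, T.w (n + 1) ω) = π n (T.data n ω, T.ξ (n + 1) ω))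
    (n : ℕ) (ω : S) (i : Fin n) :
    policyPoints π (T.data n ω) i = (T.x (i + 1) ω, T.w (i + 1) ω) := by
  rw [hπ]
  unfold policyPoints
  rfl

omit [MeasurableSpace S] in
lemma measurable_snocData_comp
    (hG : Measurable fun z : T.PathSpace × (X × Ω) => T.pathFun z.1 z.2)
    {α : Type*} [MeasurableSpace α] {n : ℕ} {a : α → T.PathSpace}
    {p : α → (Fin n → ℝ × ℝ)} {z e : α → ℝ} {φ : (Fin n → ℝ × ℝ) × ℝ → X × Ω}
    (hφ : Measurable φ) (ha : Measurable a) (hp : Measurable p) (hz : Measurable z)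
    (he : Measurable e) :
    Measurable fun ω => snocData (p ω) (z ω, T.pathFun (a ω) (φ (p ω, z ω)) + e ω) := by
  have h1 := hG.comp (ha.prodMk (hφ.comp (hp.prodMk hz)))
  exact (measurable_snocData n).comp ((hz.prodMk (h1.add he)).prodMk hp)

omit [MeasurableSpace S] in
/-- The data are measurable for every `σ`-algebra that contains the random sources used. -/
lemma measurable_data_of_le
    (hG : Measurable fun z : T.PathSpace × (X × Ω) => T.pathFun z.1 z.2)
    {π : ∀ n, (Fin n → ℝ × ℝ) × ℝ → X × Ω} (hπm : ∀ n, Measurable (π n))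
    (hπ : ∀ n ω, (T.x (n + 1) ω, T.w (n + 1) ω) = π n (T.data n ω, T.ξ (n + 1) ω))
    (m : MeasurableSpace S) (hf : T.sources none ≤ m) (n : ℕ)
    (hξ : ∀ i < n, T.sources (some (Sum.inr i)) ≤ m)
    (hε : ∀ i < n, T.sources (some (Sum.inl i)) ≤ m) :
    @Measurable _ _ m _ (T.data n) := by
  have hpath : @Measurable _ _ m _ T.toPath := fun _ hs => hf _ hs
  induction n with
  | zero =>
    exact @measurable_pi_lambda _ _ _ m _ _ fun i => i.elim0
  | succ n ih =>
    have h1 := ih (fun i hi => hξ i (by omega)) fun i hi => hε i (by omega)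
    have h2 : @Measurable _ _ m _ (T.ξ (n + 1)) :=
      fun s hs => hξ n (by omega) _ ⟨s, hs, rfl⟩
    have h3 : @Measurable _ _ m _ (T.ε (n + 1)) :=
      fun s hs => hε n (by omega) _ ⟨s, hs, rfl⟩
    have h4 : T.data (n + 1) = fun ω => snocData (T.data n ω) (T.ξ (n + 1) ω,
        T.pathFun (T.toPath ω) (π n (T.data n ω, T.ξ (n + 1) ω)) + T.ε (n + 1) ω) :=
      funext (data_succ hπ n)
    rw [h4]
    exact measurable_snocData_comp hG (hπm n) hpath h1 h2 h3

lemma IsModel.isAdaptiveExperiment [Countable X] [MeasurableSingletonClass X]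
    (h : T.IsModel P k v) {π : ∀ n, (Fin n → ℝ × ℝ) × ℝ → X × Ω} (hπm : ∀ n, Measurable (π n))
    (hπ : ∀ n ω, (T.x (n + 1) ω, T.w (n + 1) ω) = π n (T.data n ω, T.ξ (n + 1) ω)) :
    IsAdaptiveExperiment P T.pathFun v π T.toPath T.ξ T.ε T.data where
  measurable_G := h.measurable_pathFun
  measurable_π := hπm
  measurable_e := h.measurable_toPath
  measurable_data n := measurable_data_of_le h.measurable_pathFun hπm hπ _ (h.sources_le _) n
    (fun _ _ => h.sources_le _) fun _ _ => h.sources_le _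
  data_succ := data_succ hπ
  measurable_ξ n := h.measurable_xi _ (by omega)
  measurable_ε n := h.measurable_noise _ (by omega)
  law n := by
    have hξm := h.measurable_xi (n + 1) (by omega)
    have hεm := h.measurable_noise (n + 1) (by omega)
    have hdm := measurable_data_of_le h.measurable_pathFun hπm hπ _ (h.sources_le _) n
      (fun _ _ => h.sources_le _) fun _ _ => h.sources_le _
    -- Source index `n` belongs to round `n + 1`. The function and the first `n` rounds use only
    -- sources in `I`, the new noise and `ξ` only those in `J`; disjoint families of independent
    -- sources are independent.
    set I : Set (Option (ℕ ⊕ ℕ)) :=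
      {i | i ≠ some (Sum.inl n) ∧ i ≠ some (Sum.inr n)} with hI
    set J : Set (Option (ℕ ⊕ ℕ)) := {some (Sum.inl n), some (Sum.inr n)} with hJ
    have hIJ : Disjoint I J := by
      rw [Set.disjoint_left]
      rintro i ⟨h1, h2⟩ (h3 | h3)
      · exact h1 h3
      · exact h2 h3
    have hind := indep_iSup_of_disjoint h.sources_le h.indep hIJ
    have hleft : MeasurableSpace.comap (fun ω => (T.toPath ω, T.data n ω)) inferInstance ≤
        ⨆ i ∈ I, T.sources i := by
      have hle : ∀ i ∈ I, T.sources i ≤ ⨆ i ∈ I, T.sources i := fun i hi =>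
        le_iSup₂ (f := fun i (_ : i ∈ I) => T.sources i) i hi
      have h1 : @Measurable _ _ (⨆ i ∈ I, T.sources i) _ T.toPath :=
        fun _ hs => hle none (by simp [hI]) _ hs
      have h2 := measurable_data_of_le h.measurable_pathFun hπm hπ (⨆ i ∈ I, T.sources i)
        (hle none (by simp [hI])) n
        (fun i hi => hle _ (by simp [hI]; omega)) fun i hi => hle _ (by simp [hI]; omega)
      exact (h1.prodMk h2).comap_le
    have hright : MeasurableSpace.comap (fun ω => (T.ξ (n + 1) ω, T.ε (n + 1) ω)) inferInstance ≤
        ⨆ i ∈ J, T.sources i := by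
      have hle : ∀ i ∈ J, T.sources i ≤ ⨆ i ∈ J, T.sources i := fun i hi =>
        le_iSup₂ (f := fun i (_ : i ∈ J) => T.sources i) i hi
      have h1 : @Measurable _ _ (⨆ i ∈ J, T.sources i) _ (T.ξ (n + 1)) :=
        fun s hs => hle (some (Sum.inr n)) (by simp [hJ]) _ ⟨s, hs, rfl⟩
      have h2 : @Measurable _ _ (⨆ i ∈ J, T.sources i) _ (T.ε (n + 1)) :=
        fun s hs => hle (some (Sum.inl n)) (by simp [hJ]) _ ⟨s, hs, rfl⟩
      exact (h1.prodMk h2).comap_le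
    have h1 : IndepFun (fun ω => (T.toPath ω, T.data n ω))
        (fun ω => (T.ξ (n + 1) ω, T.ε (n + 1) ω)) P :=
      (IndepFun_iff_Indep _ _ _).2 (indep_of_indep_of_le_left
        (indep_of_indep_of_le_right hind hright) hleft)
    have h2 : IndepFun (T.ξ (n + 1)) (T.ε (n + 1)) P :=
      (IndepFun_iff_Indep _ _ _).2 (h.indep.indep
        (by simp : (some (Sum.inr n) : Option (ℕ ⊕ ℕ)) ≠ some (Sum.inl n)))
    rw [(indepFun_iff_map_prod_eq_prod_map_map (h.measurable_toPath.prodMk hdm).aemeasurable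
      (hξm.prodMk hεm).aemeasurable).1 h1,
      (indepFun_iff_map_prod_eq_prod_map_map hξm.aemeasurable hεm.aemeasurable).1 h2,
      (h.xi_law (n + 1) (by omega)).map_eq, (h.noise_law (n + 1) (by omega)).map_eq]

end

end Run

end RobustBO

namespace RobustBO

namespace Run

variable {S X : Type*} {d : ℕ} {Ω : Set (EuclideanSpace ℝ (Fin d))} {T : Run S X Ω}
  [Fintype X] [MeasurableSpace X] [MeasurableSpace S] {P : Measure S}
  {k : X × Ω → X × Ω → ℝ} {v : ℝ≥0} {ρ : (Ω → ℝ) → ℝ} {𝒟 : Set (Ω → ℝ)} {rnd : ℕ → Ω → Ω}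
  {κ : ℕ → ℝ}

/-! ### One round of the algorithm -/

/-- When the confidence bounds hold, the gap of the estimated solution is at most twice the width
of the bounds at the evaluated point. -/
lemma IsAlgorithm.gap_le (halg : T.IsAlgorithm k v ρ rnd) (hρ : T.IsAdmissible P ρ 𝒟 rnd)
    {n : ℕ} {ω : S}
    (hb : ∀ x, T.lcb (n + 1) ω x ∈ lowerBounds (ρ '' T.credibleFunctions k v 𝒟 rnd κ n ω x) ∧
      T.ucb (n + 1) ω x ∈ upperBounds (ρ '' T.credibleFunctions k v 𝒟 rnd κ n ω x))
    (hgood : ∀ x w, |T.path ω x (rnd (n + 1) w) - T.mean k v n ω x (rnd (n + 1) w)| ≤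
      √(T.beta κ (n + 1) ω) * T.std k v n ω x (rnd (n + 1) w)) (x : X) :
    ρ (T.path ω x ∘ rnd (n + 1)) - ρ (T.path ω (T.xhat (n + 1) ω) ∘ rnd (n + 1)) ≤
      2 * (T.ucb (n + 1) ω (T.x (n + 1) ω) - T.lcb (n + 1) ω (T.x (n + 1) ω)) := by
  have : Nonempty X := ⟨x⟩
  have hpath : ∀ x, T.lcb (n + 1) ω x ≤ ρ (T.path ω x ∘ rnd (n + 1)) ∧
      ρ (T.path ω x ∘ rnd (n + 1)) ≤ T.ucb (n + 1) ω x := by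
    intro x
    have hm : T.path ω x ∘ rnd (n + 1) ∈ T.credibleFunctions k v 𝒟 rnd κ n ω x := by
      refine ⟨hρ.step_mem _ (by omega) _, fun w => ?_⟩
      have := abs_le.1 (hgood x w)
      exact ⟨by simp only [Function.comp]; linarith, by simp only [Function.comp]; linarith⟩
    exact ⟨(hb x).1 ⟨_, hm, rfl⟩, (hb x).2 ⟨_, hm, rfl⟩⟩
  have hmean : ∀ x, T.lcb (n + 1) ω x ≤ ρ (fun w => T.mean k v n ω x (rnd (n + 1) w)) ∧
      ρ (fun w => T.mean k v n ω x (rnd (n + 1) w)) ≤ T.ucb (n + 1) ω x := by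
    intro x
    have hm : (fun w => T.mean k v n ω x (rnd (n + 1) w)) ∈
        T.credibleFunctions k v 𝒟 rnd κ n ω x := by
      refine ⟨hρ.step_mem _ (by omega) (T.mean k v n ω x), fun w => ?_⟩
      have : 0 ≤ √(T.beta κ (n + 1) ω) * T.std k v n ω x (rnd (n + 1) w) :=
        mul_nonneg (Real.sqrt_nonneg _) (Real.sqrt_nonneg _)
      exact ⟨by linarith, by linarith⟩
    exact ⟨(hb x).1 ⟨_, hm, rfl⟩, (hb x).2 ⟨_, hm, rfl⟩⟩
  obtain ⟨x₀, hx₀⟩ := exists_eq_ciSup_of_finite (f := fun x' => T.lcb (n + 1) ω x')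
  have hle : ∀ x, T.lcb (n + 1) ω x ≤ ⨆ x', T.lcb (n + 1) ω x' :=
    fun x => le_ciSup (Set.finite_range _).bddAbove x
  -- With `m = max lcb`, the gap is at most `(ucb x - m) + (m - lcb xhat)`. The first term is at
  -- most the width at `xtil`, the second at most the width at `xhat`, and the evaluated `x` has the
  -- larger of the two widths.
  have h1 := halg.x_max n ω _ (Or.inl rfl)
  have h2 := halg.x_max n ω _ (Or.inr rfl)
  have h3 : max (T.ucb (n + 1) ω (T.xtil (n + 1) ω) - ⨆ x', T.lcb (n + 1) ω x') 0 ≤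
      T.ucb (n + 1) ω (T.xtil (n + 1) ω) - T.lcb (n + 1) ω (T.xtil (n + 1) ω) :=
    max_le (by linarith [hle (T.xtil (n + 1) ω)])
      (by linarith [hmean (T.xtil (n + 1) ω)])
  have h4 := (le_max_left _ _).trans (halg.xtil_max n ω x)
  -- The posterior mean itself is a credible function, so its robustness value lies between the
  -- bounds; maximality of `xhat` for that value links the two.
  have h5 : ⨆ x', T.lcb (n + 1) ω x' ≤ T.ucb (n + 1) ω (T.xhat (n + 1) ω) := by
    rw [← hx₀]
    exact (hmean x₀).1.trans ((halg.xhat_max n ω x₀).trans (hmean _).2)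
  linarith [hpath x, hpath (T.xhat (n + 1) ω)]

omit [Fintype X] [MeasurableSpace S] in
lemma IsAlgorithm.iSup_std (halg : T.IsAlgorithm k v ρ rnd) (n : ℕ) (ω : S) :
    ⨆ w, T.std k v n ω (T.x (n + 1) ω) w =
      T.std k v n ω (T.x (n + 1) ω) (T.w (n + 1) ω) := by
  have : Nonempty Ω := ⟨T.w (n + 1) ω⟩
  have h : ∀ w, T.std k v n ω (T.x (n + 1) ω) w ≤
      T.std k v n ω (T.x (n + 1) ω) (T.w (n + 1) ω) :=
    fun w => Real.sqrt_le_sqrt (halg.w_max n ω w)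
  exact le_antisymm (ciSup_le h) (le_ciSup ⟨_, forall_mem_range.2 h⟩ (T.w (n + 1) ω))

/-- The unknown function, data and level for which the confidence bounds fail at a point of
`X × D`. -/
def badSet (T : Run S X Ω) (k : X × Ω → X × Ω → ℝ) (v κ₀ : ℝ)
    (π : ∀ n, (Fin n → ℝ × ℝ) × ℝ → X × Ω) (D : Finset Ω) (n : ℕ) :
    Set ((T.PathSpace × (Fin n → ℝ × ℝ)) × ℝ) :=
  ⋃ p ∈ (Finset.univ : Finset X) ×ˢ D,
    {z | √(2 * Real.log κ₀ + z.2) * √(posteriorVar k v (policyPoints π z.1.2) p) <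
      |T.pathFun z.1.1 p - posteriorMean k v (policyPoints π z.1.2) (fun i => (z.1.2 i).2) p|}

variable [MeasurableSingletonClass X]

lemma IsModel.measurableSet_badSet [IsProbabilityMeasure P] (h : T.IsModel P k v)
    {π : ∀ n, (Fin n → ℝ × ℝ) × ℝ → X × Ω} (hπm : ∀ n, Measurable (π n)) (κ₀ : ℝ) (D : Finset Ω)
    (n : ℕ) : MeasurableSet (T.badSet k v κ₀ π D n) := by
  refine Finset.measurableSet_biUnion _ fun p _ => ?_
  have hpts : ∀ i, Measurable fun z : (T.PathSpace × (Fin n → ℝ × ℝ)) × ℝ =>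
      policyPoints π z.1.2 i :=
    fun i => (measurable_policyPoints hπm i).comp measurable_fst.snd
  have hy : ∀ i, Measurable fun z : (T.PathSpace × (Fin n → ℝ × ℝ)) × ℝ => (z.1.2 i).2 :=
    fun i => ((measurable_pi_apply i).comp measurable_fst.snd).snd
  refine measurableSet_lt ?_ ?_
  · exact (measurable_snd.const_add _).sqrt.mul
      (measurable_posteriorVar h.measurable_kernel v hpts measurable_const).sqrt
  · have h1 : Measurable fun z : (T.PathSpace × (Fin n → ℝ × ℝ)) × ℝ => T.pathFun z.1.1 p :=
      h.measurable_pathFun.comp (measurable_fst.fst.prodMk measurable_const)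
    exact (h1.sub (measurable_posteriorMean h.measurable_kernel v hpts hy measurable_const)).abs

/-- Union bound over `X × D` of the fixed-design tails at `c² = 2 log κ₀ + s`: the factor `1 / κ₀`
from the Gaussian exponent pays for the number of points. -/
lemma IsModel.lintegral_badSet_le [IsProbabilityMeasure P] (h : T.IsModel P k v) (hv : 0 < v)
    {π : ∀ n, (Fin n → ℝ × ℝ) × ℝ → X × Ω} (hπm : ∀ n, Measurable (π n)) {κ₀ : ℝ} (hκ₀ : 1 ≤ κ₀)
    {D : Finset Ω} (hD : (D.card : ℝ) * Fintype.card X ≤ κ₀) {n : ℕ} (y : Fin n → ℝ × ℝ) {s : ℝ}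
    (hs : 0 ≤ s) :
    ∫⁻ a in {a | ((a, y), s) ∈ T.badSet k v κ₀ π D n}, dataLikelihood T.pathFun v π a y
        ∂(P.map T.toPath) ≤
      ENNReal.ofReal (Real.exp (-s / 2)) *
        ∫⁻ a, dataLikelihood T.pathFun v π a y ∂(P.map T.toPath) := by
  have hlog : 0 ≤ 2 * Real.log κ₀ + s := by linarith [Real.log_nonneg hκ₀]
  have hm : Measurable fun a => dataLikelihood T.pathFun v π a y :=
    measurable_dataLikelihood_comp h.measurable_pathFun hπm measurable_id measurable_const
  have hbm : MeasurableSet {a | ((a, y), s) ∈ T.badSet k v κ₀ π D n} :=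
    (measurable_prodMk_right.comp measurable_prodMk_right) (h.measurableSet_badSet hπm κ₀ D n)
  rw [setLIntegral_map hbm hm h.measurable_toPath, lintegral_map hm h.measurable_toPath]
  set I := ∫⁻ ω, dataLikelihood T.pathFun v π (T.toPath ω) y ∂P with hI
  have hpt : ∀ p : X × Ω,
      ∫⁻ ω in {ω | √(2 * Real.log κ₀ + s) * √(posteriorVar k v (policyPoints π y) p) <
        |T.f p ω - posteriorMean k v (policyPoints π y) (fun i => (y i).2) p|},
        dataLikelihood T.pathFun v π (T.toPath ω) y ∂P ≤
      ENNReal.ofReal (Real.exp (-(2 * Real.log κ₀ + s) / 2)) * I := by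
    intro p
    have := lintegral_posterior_tail_le h.measurable_f h.gaussian h.mean_zero h.covariance_eq hv
      (policyPoints π y) p (Real.sqrt_nonneg (2 * Real.log κ₀ + s)) fun i => (y i).2
    rw [Real.sq_sqrt hlog] at this
    rw [hI]
    unfold dataLikelihood
    exact this
  set A : X × Ω → Set S := fun p =>
    {ω | √(2 * Real.log κ₀ + s) * √(posteriorVar k v (policyPoints π y) p) <
      |T.f p ω - posteriorMean k v (policyPoints π y) (fun i => (y i).2) p|} with hA
  have hset : T.toPath ⁻¹' {a | ((a, y), s) ∈ T.badSet k v κ₀ π D n} =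
      ⋃ p : ((Finset.univ : Finset X) ×ˢ D : Finset (X × Ω)), A p := by
    ext ω
    simp only [badSet, Set.mem_preimage, Set.mem_ofPred_eq, Set.mem_iUnion, hA, Subtype.exists,
      exists_prop]
    rfl
  rw [hset]
  refine (lintegral_iUnion_le _ _).trans ?_
  rw [tsum_fintype]
  refine (Finset.sum_le_sum fun p _ => hpt p.1).trans ?_
  rw [Finset.sum_const, nsmul_eq_mul, ← mul_assoc]
  gcongr
  rw [← ENNReal.ofReal_natCast, ← ENNReal.ofReal_mul (by positivity)]
  apply ENNReal.ofReal_le_ofReal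
  have hexp : Real.exp (-(2 * Real.log κ₀ + s) / 2) = κ₀⁻¹ * Real.exp (-s / 2) := by
    rw [show -(2 * Real.log κ₀ + s) / 2 = -Real.log κ₀ + -s / 2 by ring, Real.exp_add,
      Real.exp_neg, Real.exp_log (by linarith)]
  have hcard : ((Finset.univ : Finset ((Finset.univ : Finset X) ×ˢ D : Finset (X × Ω))).card : ℝ)
      ≤ κ₀ := by
    rw [Finset.card_univ, Fintype.card_coe, Finset.card_product, Finset.card_univ]
    push_cast
    linarith
  rw [hexp, ← mul_assoc]
  refine mul_le_of_le_one_left (Real.exp_pos _).le ?_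
  rwa [mul_inv_le_iff₀ (by linarith), one_mul]

/-- The largest robustness measure of the discretized functions minus the one of the estimated
solution. -/
noncomputable def gap (T : Run S X Ω) (ρ : (Ω → ℝ) → ℝ) (rnd : ℕ → Ω → Ω) (n : ℕ) (ω : S) : ℝ :=
  (⨆ x, ρ (T.path ω x ∘ rnd n)) - ρ (T.path ω (T.xhat n ω) ∘ rnd n)

/-- The argument of the width bound at the evaluated point, halved. -/
noncomputable def scaledStd (T : Run S X Ω) (k : X × Ω → X × Ω → ℝ) (v : ℝ) (κ : ℕ → ℝ) (n : ℕ)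
    (ω : S) : ℝ :=
  √(T.beta κ (n + 1) ω) * T.std k v n ω (T.x (n + 1) ω) (T.w (n + 1) ω)

lemma IsModel.lintegral_gap_le [IsProbabilityMeasure P] [Nonempty (X × Ω)]
    (h : T.IsModel P k v) (hv : 0 < v) (hΩ : MeasurableSet Ω)
    (halg : T.IsAlgorithm k v ρ rnd) (hρ : T.IsAdmissible P ρ 𝒟 rnd)
    (hbound : T.IsBound P k v ρ 𝒟 rnd κ) {q : QFun} (hwidth : T.WidthBound P k v κ q)
    {n : ℕ} (hκ : 1 ≤ κ (n + 1)) {D : Finset Ω} (hD : (D.card : ℝ) * Fintype.card X ≤ κ (n + 1))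
    (hrnd : IsNearestPointMap D (rnd (n + 1))) {Φ : ℝ → ℝ} (hΦm : Measurable Φ)
    (hΦ : ∀ᵐ ω ∂P, 2 * q.eval (2 * T.scaledStd k v κ n ω) ≤ Φ (T.scaledStd k v κ n ω)) :
    ∫⁻ ω, ENNReal.ofReal (T.gap ρ rnd (n + 1) ω) ∂P ≤
      ∫⁻ ω, ENNReal.ofReal (Φ (T.scaledStd k v κ n ω)) ∂P := by
  have : Nonempty X := ⟨(Classical.arbitrary (X × Ω)).1⟩
  obtain ⟨π, hπm, hπ⟩ := halg.exists_policy hΩ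
  obtain ⟨g, hgm, hg⟩ := halg.exists_estimator n
  have hexp := h.isAdaptiveExperiment hπm hπ
  have hpts : (fun ω => policyPoints π (T.data n ω)) = fun ω (i : Fin n) =>
      (T.x (i + 1) ω, T.w (i + 1) ω) := by
    ext1 ω
    ext1 i
    exact policyPoints_data hπ n ω i
  have hstep := hρ.measurable_step (n + 1) (by omega)
  -- The gap as a function of the path and the past data only. The bound `B` may depend on the
  -- current `ξ`, also through the evaluated point.
  set W : T.PathSpace × (Fin n → ℝ × ℝ) → ℝ := fun z =>
    (⨆ x, ρ ((fun w => T.pathFun z.1 (x, w)) ∘ rnd (n + 1))) -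
      ρ ((fun w => T.pathFun z.1 (g z.2, w)) ∘ rnd (n + 1)) with hW
  set B : (Fin n → ℝ × ℝ) × ℝ → ℝ := fun z =>
    Φ (√(2 * Real.log (κ (n + 1)) + z.2) * √(posteriorVar k v (policyPoints π z.1) (π n z)))
    with hB
  have hρm : ∀ x, Measurable fun a : T.PathSpace =>
      ρ ((fun w => T.pathFun a (x, w)) ∘ rnd (n + 1)) := fun x =>
    hstep.comp (measurable_pi_lambda _ fun w => T.measurable_f_pathSpace (x, w))
  have hWm : Measurable W := by
    refine (Measurable.iSup fun x => (hρm x).comp measurable_fst).sub ?_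
    have h2 : Measurable fun z : T.PathSpace × X =>
        ρ ((fun w => T.pathFun z.1 (z.2, w)) ∘ rnd (n + 1)) :=
      measurable_from_prod_countable_left hρm
    exact h2.comp (measurable_fst.prodMk (hgm.comp measurable_snd))
  have hBm : Measurable B := by
    refine hΦm.comp ((measurable_snd.const_add _).sqrt.mul
      (measurable_posteriorVar h.measurable_kernel v (fun i => ?_) (hπm n)).sqrt)
    exact (measurable_policyPoints hπm i).comp measurable_fst
  have key := hexp.lintegral_le (W := W) (B := B) hv.ne' n hWm hBm
    (h.measurableSet_badSet hπm (κ (n + 1)) D n)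
    (fun y s hs => h.lintegral_badSet_le hv hπm hκ hD y hs) ?_
  · have e1 : ∀ ω, W (T.toPath ω, T.data n ω) = T.gap ρ rnd (n + 1) ω := by
      intro ω
      simp only [hW, gap, hg]
      rfl
    have e2 : ∀ ω, B (T.data n ω, T.ξ (n + 1) ω) = Φ (T.scaledStd k v κ n ω) := by
      intro ω
      simp only [hB, scaledStd, ← hπ, beta, std, var, ← congrFun hpts ω]
    simpa only [e1, e2] using key
  · filter_upwards [hbound, hwidth, hΦ] with ω h1 h2 h3 h4
    have hgood : ∀ x w, |T.path ω x (rnd (n + 1) w) - T.mean k v n ω x (rnd (n + 1) w)| ≤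
        √(T.beta κ (n + 1) ω) * T.std k v n ω x (rnd (n + 1) w) := by
      -- Rounded points lie in `D`, so failure of the band anywhere puts the outcome into the finite
      -- union defining the bad set.
      intro x w
      by_contra hcon
      refine h4 (mem_iUnion₂.2 ⟨(x, rnd (n + 1) w),
        Finset.mem_product.2 ⟨Finset.mem_univ _, (hrnd w).1⟩, ?_⟩)
      have hp := congrFun hpts ω
      simp only [Set.mem_ofPred_eq, hp]
      exact not_le.1 hcon
    have hgap := halg.gap_le hρ (h1 n) hgood
    have h5 := h2 n
    rw [halg.iSup_std, mul_assoc] at h5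
    obtain ⟨x, hx⟩ := exists_eq_ciSup_of_finite (f := fun x => ρ (T.path ω x ∘ rnd (n + 1)))
    have e1 : W (T.toPath ω, T.data n ω) = T.gap ρ rnd (n + 1) ω := by
      simp only [hW, gap, hg]
      rfl
    have e2 : B (T.data n ω, T.ξ (n + 1) ω) = Φ (T.scaledStd k v κ n ω) := by
      simp only [hB, scaledStd, ← hπ, beta, std, var, ← congrFun hpts ω]
    rw [e1, e2, gap, ← hx]
    have h6 := hgap x
    simp only [scaledStd] at h3 ⊢
    linarith

end Run

end RobustBO

namespace RobustBO

/-! ### Summing the widths over the rounds -/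

/-- Hölder's inequality twice with the same exponents: in the integral, then for the counting
measure on the rounds. -/
lemma sum_lintegral_mul_rpow_le {α : Type*} [MeasurableSpace α] {μ : Measure α} (t : ℕ)
    {a b : ℕ → α → ℝ≥0∞} (ha : ∀ n, AEMeasurable (a n) μ) (hb : ∀ n, AEMeasurable (b n) μ) {p r : ℝ}
    (hp : 0 ≤ p) (hr : 0 ≤ r) (hpr : p + r = 1) :
    ∑ n ∈ Finset.range t, ∫⁻ x, a n x ^ p * b n x ^ r ∂μ ≤
      (∑ n ∈ Finset.range t, ∫⁻ x, a n x ∂μ) ^ p * (∑ n ∈ Finset.range t, ∫⁻ x, b n x ∂μ) ^ r := by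
  refine (Finset.sum_le_sum fun n _ =>
    ENNReal.lintegral_mul_norm_pow_le (ha n) (hb n) hp hr hpr).trans ?_
  have h := ENNReal.lintegral_mul_norm_pow_le (μ := Measure.count)
    (f := fun i : Fin t => ∫⁻ x, a i x ∂μ) (g := fun i : Fin t => ∫⁻ x, b i x ∂μ)
    (measurable_of_finite _).aemeasurable (measurable_of_finite _).aemeasurable hp hr hpr
  simp only [lintegral_count, tsum_fintype] at h
  simpa only [Finset.sum_range] using h

/-- As `s ≤ 1`, the exponent `ν / 2` of the variance may be lowered to `min ν 1 / 2`. The inner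
exponent of `β` is chosen so that the two outer exponents sum to `1`, ready for Hölder. -/
lemma sqrt_mul_rpow_le {β s ν : ℝ} (hβ : 0 ≤ β) (hs : 0 ≤ s) (hs1 : s ≤ 1) (hν : 0 < ν) :
    (√β * √s) ^ ν ≤ (β ^ (ν / (2 - min ν 1))) ^ (1 - min ν 1 / 2) * s ^ (min ν 1 / 2) := by
  have hν' : 0 < min ν 1 := lt_min hν one_pos
  have hν1 : min ν 1 ≤ 1 := min_le_right _ _
  rw [Real.mul_rpow (Real.sqrt_nonneg _) (Real.sqrt_nonneg _), ← Real.rpow_mul hβ,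
    Real.sqrt_eq_rpow, Real.sqrt_eq_rpow, ← Real.rpow_mul hβ, ← Real.rpow_mul hs]
  have e : ν / (2 - min ν 1) * (1 - min ν 1 / 2) = 1 / 2 * ν := by
    have : (2 - min ν 1) ≠ 0 := by linarith
    field_simp
  rw [e]
  refine mul_le_mul_of_nonneg_left ?_ (Real.rpow_nonneg hβ _)
  refine Real.rpow_le_rpow_of_exponent_ge' hs hs1 (by positivity) ?_
  linarith [min_le_left ν 1]

/-- If the `ν`-th moments of `2 u` are summably bounded, then `q(2 u)` has an affine majorant in
these moments whose integrals add up to the value of the bound at the averages. -/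
lemma QFun.exists_majorant (q : QFun) {α : Type*} [MeasurableSpace α] {μ : Measure α}
    [IsProbabilityMeasure μ] {t : ℕ} (ht : 0 < t) {u : ℕ → α → ℝ} (hum : ∀ n, Measurable (u n))
    (hu : ∀ n x, 0 ≤ u n x) {Y : (i : Fin q.n) → Fin (q.s i) → ℝ} (hY0 : ∀ i j, 0 ≤ Y i j)
    (hY : ∀ i j, ∑ n ∈ Finset.range t, ∫⁻ x, ENNReal.ofReal (u n x ^ q.ν i j) ∂μ ≤
      ENNReal.ofReal (Y i j)) :
    ∃ Φ : ℝ → ℝ, Measurable Φ ∧ (∀ n < t, ∀ᵐ x ∂μ, 2 * q.eval (2 * u n x) ≤ Φ (u n x)) ∧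
      ∑ n ∈ Finset.range t, ∫⁻ x, ENNReal.ofReal (Φ (u n x)) ∂μ ≤ ENNReal.ofReal
        (2 * t * ∑ i, q.ζ i * q.h i (1 / t * ∑ j, 2 ^ q.ν i j * q.lam i j * Y i j)) := by
  have ht' : (0 : ℝ) < t := by exact_mod_cast ht
  have hpow0 : ∀ n i j x, 0 ≤ u n x ^ q.ν i j := fun n i j x => Real.rpow_nonneg (hu n x) _
  have hpowm : ∀ n i j, Measurable fun x => u n x ^ q.ν i j := fun n i j =>
    (hum n).pow_const _
  have hint : ∀ n < t, ∀ i j, Integrable (fun x => u n x ^ q.ν i j) μ := by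
    intro n hn i j
    refine ⟨(hpowm n i j).aestronglyMeasurable, ?_⟩
    rw [hasFiniteIntegral_iff_ofReal (ae_of_all _ (hpow0 n i j))]
    refine lt_of_le_of_lt ?_ (ENNReal.ofReal_lt_top (r := Y i j))
    exact (Finset.single_le_sum (f := fun n => ∫⁻ x, ENNReal.ofReal (u n x ^ q.ν i j) ∂μ)
      (fun _ _ => zero_le) (Finset.mem_range.2 hn)).trans (hY i j)
  have hsum : ∀ i j, ∑ n ∈ Finset.range t, ∫ x, u n x ^ q.ν i j ∂μ ≤ Y i j := by
    intro i j
    have h1 := hY i j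
    rw [Finset.sum_congr rfl fun n hn => (ofReal_integral_eq_lintegral_ofReal
      (hint n (Finset.mem_range.1 hn) i j) (ae_of_all _ (hpow0 n i j))).symm,
      ← ENNReal.ofReal_sum_of_nonneg fun n _ => integral_nonneg (hpow0 n i j)] at h1
    exact (ENNReal.ofReal_le_ofReal_iff (hY0 i j)).1 h1
  set M : Fin q.n → ℝ := fun i => 1 / t * ∑ j, 2 ^ q.ν i j * q.lam i j * Y i j with hM
  have hterm : ∀ i j, 0 ≤ (2 : ℝ) ^ q.ν i j * q.lam i j * Y i j := fun i j =>
    mul_nonneg (mul_nonneg (Real.rpow_nonneg zero_le_two _) (q.lam_nonneg i j)) (hY0 i j)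
  have hM0 : ∀ i, 0 ≤ M i := fun i =>
    mul_nonneg (by positivity) (Finset.sum_nonneg fun j _ => hterm i j)
  choose c hc hmaj using fun i => (q.h_mod i).exists_affine_majorant (hM0 i)
  set Φ : ℝ → ℝ := fun a =>
    2 * ∑ i, q.ζ i * (q.h i (M i) + c i * (∑ j, q.lam i j * (2 * a) ^ q.ν i j - M i)) with hΦ
  have hΦle : ∀ n < t, ∀ᵐ x ∂μ, 2 * q.eval (2 * u n x) ≤ Φ (u n x) := by
    intro n hn
    -- Handles the degenerate touching point: when `M i = 0` the majorant is valid only at `0`, and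
    -- vanishing moments force the inner sum to vanish almost surely.
    have hzero : ∀ᵐ x ∂μ, ∀ i j, Y i j = 0 → u n x ^ q.ν i j = 0 := by
      refine ae_all_iff.2 fun i => ae_all_iff.2 fun j => ?_
      by_cases h0 : Y i j = 0
      · have h1 : ∫ x, u n x ^ q.ν i j ∂μ ≤ 0 := by
          refine le_trans ?_ (h0 ▸ hsum i j)
          exact Finset.single_le_sum (f := fun n => ∫ x, u n x ^ q.ν i j ∂μ)
            (fun _ _ => integral_nonneg (hpow0 _ i j)) (Finset.mem_range.2 hn)
        have h2 := (integral_eq_zero_iff_of_nonneg (hpow0 n i j) (hint n hn i j)).1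
          (le_antisymm h1 (integral_nonneg (hpow0 n i j)))
        filter_upwards [h2] with x hx _ using hx
      · exact ae_of_all _ fun x h => absurd h h0
    filter_upwards [hzero] with x hx
    refine mul_le_mul_of_nonneg_left (Finset.sum_le_sum fun i _ =>
      mul_le_mul_of_nonneg_left (hmaj i _ (q.inner_nonneg (by linarith [hu n x]) i) fun h0 => ?_)
        (q.ζ_nonneg i)) zero_le_two
    have h1 : ∑ j, 2 ^ q.ν i j * q.lam i j * Y i j = 0 := by
      rcases mul_eq_zero.1 h0 with h | h
      · exact absurd h (by positivity)
      · exact h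
    refine Finset.sum_eq_zero fun j _ => ?_
    have h2 := (Finset.sum_eq_zero_iff_of_nonneg fun j _ => hterm i j).1 h1 j (Finset.mem_univ j)
    rw [Real.mul_rpow zero_le_two (hu n x)]
    rcases mul_eq_zero.1 h2 with h | h
    · rw [(mul_eq_zero.1 h).resolve_left (Real.rpow_pos_of_pos two_pos _).ne', zero_mul]
    · rw [hx i j h, mul_zero, mul_zero]
  have hΦeq : ∀ a, 0 ≤ a → Φ a = 2 * ∑ i, q.ζ i * (q.h i (M i) +
      c i * (∑ j, 2 ^ q.ν i j * q.lam i j * a ^ q.ν i j - M i)) := by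
    intro a ha
    simp only [hΦ]
    congr! 7 with i _ j _
    rw [Real.mul_rpow zero_le_two ha]
    ring
  have hinner : ∀ n < t, ∀ i, Integrable
      (fun x => ∑ j, 2 ^ q.ν i j * q.lam i j * u n x ^ q.ν i j) μ := fun n hn i =>
    integrable_finsetSum _ fun j _ => (hint n hn i j).const_mul _
  have hdev : ∀ n < t, ∀ i, Integrable
      (fun x => c i * (∑ j, 2 ^ q.ν i j * q.lam i j * u n x ^ q.ν i j - M i)) μ := fun n hn i =>
    ((hinner n hn i).sub (integrable_const _)).const_mul _
  have haff : ∀ n < t, ∀ i, Integrable (fun x => q.ζ i * (q.h i (M i) +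
      c i * (∑ j, 2 ^ q.ν i j * q.lam i j * u n x ^ q.ν i j - M i))) μ := fun n hn i =>
    ((integrable_const _).add (hdev n hn i)).const_mul _
  have hΦint : ∀ n < t, Integrable (fun x => Φ (u n x)) μ := by
    intro n hn
    simp only [fun x => hΦeq _ (hu n x)]
    exact (integrable_finsetSum _ fun i _ => haff n hn i).const_mul _
  have hΦI : ∀ n < t, ∫ x, Φ (u n x) ∂μ = 2 * ∑ i, q.ζ i * (q.h i (M i) +
      c i * (∑ j, 2 ^ q.ν i j * q.lam i j * ∫ x, u n x ^ q.ν i j ∂μ - M i)) := by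
    intro n hn
    simp only [fun x => hΦeq _ (hu n x)]
    rw [integral_const_mul, integral_finsetSum _ fun i _ => haff n hn i]
    congr! 2 with i _
    rw [integral_const_mul, integral_add (integrable_const _) (hdev n hn i), integral_const_mul,
      integral_sub (hinner n hn i) (integrable_const _),
      integral_finsetSum _ fun j _ => (hint n hn i j).const_mul _]
    simp only [integral_const_mul, integral_const, probReal_univ, one_smul]
  refine ⟨Φ, ?_, hΦle, ?_⟩
  · refine (Finset.measurable_fun_sum _ fun i _ => ?_).const_mul _
    refine (((Finset.measurable_fun_sum _ fun j _ => ?_).sub_const _).const_mul _).const_add _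
      |>.const_mul _
    exact ((measurable_id.const_mul 2).pow_const _).const_mul _
  · have hΦ0 : ∀ n < t, ∀ᵐ x ∂μ, 0 ≤ Φ (u n x) := by
      intro n hn
      filter_upwards [hΦle n hn] with x hx
      exact (mul_nonneg zero_le_two (q.eval_nonneg (by linarith [hu n x]))).trans hx
    rw [Finset.sum_congr rfl fun n hn => (ofReal_integral_eq_lintegral_ofReal
      (hΦint n (Finset.mem_range.1 hn)) (hΦ0 n (Finset.mem_range.1 hn))).symm,
      ← ENNReal.ofReal_sum_of_nonneg fun n hn =>
        integral_nonneg_of_ae (hΦ0 n (Finset.mem_range.1 hn))]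
    refine ENNReal.ofReal_le_ofReal ?_
    rw [Finset.sum_congr rfl fun n hn => hΦI n (Finset.mem_range.1 hn), ← Finset.mul_sum,
      Finset.sum_comm, mul_assoc]
    refine mul_le_mul_of_nonneg_left ?_ zero_le_two
    rw [Finset.mul_sum]
    refine Finset.sum_le_sum fun i _ => ?_
    rw [← Finset.mul_sum, Finset.sum_add_distrib, Finset.sum_const, Finset.card_range, nsmul_eq_mul,
      ← Finset.mul_sum, Finset.sum_sub_distrib, Finset.sum_const, Finset.card_range, nsmul_eq_mul,
      Finset.sum_comm]
    have h1 : ∑ j, ∑ n ∈ Finset.range t, 2 ^ q.ν i j * q.lam i j * ∫ x, u n x ^ q.ν i j ∂μ ≤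
        t * M i := by
      have : (t : ℝ) * M i = ∑ j, 2 ^ q.ν i j * q.lam i j * Y i j := by
        simp only [hM]
        field_simp
      rw [this]
      refine Finset.sum_le_sum fun j _ => ?_
      rw [← Finset.mul_sum]
      exact mul_le_mul_of_nonneg_left (hsum i j)
        (mul_nonneg (Real.rpow_nonneg zero_le_two _) (q.lam_nonneg i j))
    have h2 := mul_nonneg (hc i) (sub_nonneg.2 h1)
    have h3 := q.ζ_nonneg i
    nlinarith

end RobustBO

namespace RobustBO

/-! ### The size of the discretization -/

section Tau

variable {a b r : ℝ} {d m : ℕ}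

lemma le_tau (t : ℕ) :
    b * d * r * (t : ℝ) ^ 2 * (√(Real.log (a * d * m)) + √Real.pi / 2) ≤ tau a b r d m t :=
  Nat.le_ceil _

lemma tau_pos (hb : 0 < b) (hd : 0 < d) (hr : 0 < r) {t : ℕ} (ht : 1 ≤ t) :
    0 < tau a b r d m t := by
  have h1 : (0 : ℝ) < d := by exact_mod_cast hd
  have h2 : (0 : ℝ) < t := by exact_mod_cast ht
  have h3 : 0 < √Real.pi := Real.sqrt_pos.2 Real.pi_pos
  exact Nat.ceil_pos.2 (by positivity)

lemma tau_mono (hb : 0 < b) (hr : 0 < r) {s t : ℕ} (hst : s ≤ t) :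
    tau a b r d m s ≤ tau a b r d m t := by
  have h2 : (s : ℝ) ≤ t := by exact_mod_cast hst
  refine Nat.ceil_mono ?_
  gcongr

lemma one_le_kappa (hb : 0 < b) (hd : 0 < d) (hr : 0 < r) (hm : 0 < m) {t : ℕ} (ht : 1 ≤ t) :
    1 ≤ kappa a b r d m t := by
  have h1 : (1 : ℝ) ≤ tau a b r d m t := by exact_mod_cast tau_pos hb hd hr ht
  have h2 : (1 : ℝ) ≤ m := by exact_mod_cast hm
  exact one_le_mul_of_one_le_of_one_le (one_le_pow₀ h1) h2

lemma kappa_mono (hb : 0 < b) (hr : 0 < r) {s t : ℕ} (hst : s ≤ t) :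
    kappa a b r d m s ≤ kappa a b r d m t := by
  have h1 : (tau a b r d m s : ℝ) ≤ tau a b r d m t := by exact_mod_cast tau_mono hb hr hst
  unfold kappa
  gcongr

end Tau

/-- A box that contains a set with non-empty interior has positive side length. -/
lemma pos_of_interior_nonempty {d : ℕ} (hd : 0 < d) {r : ℝ} {Ω : Set (EuclideanSpace ℝ (Fin d))}
    (hΩ_int : (interior Ω).Nonempty) (hΩ_box : ∀ w ∈ Ω, ∀ j, w j ∈ Set.Icc 0 r) : 0 < r := by
  obtain ⟨w, hw⟩ := hΩ_int
  set e : EuclideanSpace ℝ (Fin d) := EuclideanSpace.single ⟨0, hd⟩ 1 with he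
  have hcont : Continuous fun s : ℝ => w + s • e := by fun_prop
  have hev : ∀ᶠ s in 𝓝 (0 : ℝ), w + s • e ∈ interior Ω :=
    hcont.continuousAt.eventually_mem (isOpen_interior.mem_nhds (by simpa using hw))
  obtain ⟨δ, hδ, hball⟩ := Metric.eventually_nhds_iff.1 hev
  have h1 := hball (y := δ / 2) (by rw [dist_zero_right, Real.norm_of_nonneg] <;> linarith)
  have h2 := (hΩ_box _ (interior_subset h1) ⟨0, hd⟩).2
  have h3 := (hΩ_box _ (interior_subset hw) ⟨0, hd⟩).1
  have h4 : (w + (δ / 2) • e) ⟨0, hd⟩ = w ⟨0, hd⟩ + δ / 2 := by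
    simp [he]
  linarith

namespace Run

variable {S X : Type*} {d : ℕ} {Ω : Set (EuclideanSpace ℝ (Fin d))} {T : Run S X Ω}
  [Fintype X] [MeasurableSpace X] [MeasurableSingletonClass X] [MeasurableSpace S] {P : Measure S}
  [IsProbabilityMeasure P]
  {k : X × Ω → X × Ω → ℝ} {v : ℝ≥0} {ρ : (Ω → ℝ) → ℝ} {𝒟 : Set (Ω → ℝ)} {rnd : ℕ → Ω → Ω}
  {κ : ℕ → ℝ}

/-! ### Moments -/

lemma IsAlgorithm.measurable_data [Nonempty (X × Ω)] (halg : T.IsAlgorithm k v ρ rnd)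
    (h : T.IsModel P k v) (hΩ : MeasurableSet Ω) (n : ℕ) : Measurable (T.data n) := by
  obtain ⟨π, hπm, hπ⟩ := halg.exists_policy hΩ
  exact (h.isAdaptiveExperiment hπm hπ).measurable_data n

lemma IsAlgorithm.measurable_point [Nonempty (X × Ω)] (halg : T.IsAlgorithm k v ρ rnd)
    (h : T.IsModel P k v) (hΩ : MeasurableSet Ω) (n : ℕ) :
    Measurable fun ω => (T.x (n + 1) ω, T.w (n + 1) ω) := by
  obtain ⟨π, hπm, hπ⟩ := halg.exists_policy hΩ
  simp only [hπ]
  exact (hπm n).comp ((halg.measurable_data h hΩ n).prodMk (h.measurable_xi _ (by omega)))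

lemma IsAlgorithm.measurable_estimate [Nonempty (X × Ω)] (halg : T.IsAlgorithm k v ρ rnd)
    (h : T.IsModel P k v) (hΩ : MeasurableSet Ω) (n : ℕ) : Measurable (T.xhat (n + 1)) := by
  have : Nonempty X := ⟨(Classical.arbitrary (X × Ω)).1⟩
  obtain ⟨g, hgm, hg⟩ := halg.exists_estimator n
  rw [show T.xhat (n + 1) = fun ω => g (T.data n ω) from funext hg]
  exact hgm.comp (halg.measurable_data h hΩ n)

lemma IsAlgorithm.measurable_var [Nonempty (X × Ω)] (halg : T.IsAlgorithm k v ρ rnd)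
    (h : T.IsModel P k v) (hΩ : MeasurableSet Ω) (n : ℕ) :
    Measurable fun ω => T.var k v n ω (T.x (n + 1) ω) (T.w (n + 1) ω) :=
  measurable_posteriorVar h.measurable_kernel v (fun _ => halg.measurable_point h hΩ _)
    (halg.measurable_point h hΩ n)

omit [Fintype X] [MeasurableSpace X] [MeasurableSingletonClass X] [IsProbabilityMeasure P] in
lemma IsModel.measurable_beta (h : T.IsModel P k v) (n : ℕ) : Measurable (T.beta κ (n + 1)) :=
  (h.measurable_xi (n + 1) (by omega)).const_add _

lemma IsAlgorithm.measurable_scaledStd [Nonempty (X × Ω)] (halg : T.IsAlgorithm k v ρ rnd)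
    (h : T.IsModel P k v) (hΩ : MeasurableSet Ω) (n : ℕ) :
    Measurable (T.scaledStd k v κ n) :=
  (h.measurable_beta n).sqrt.mul (halg.measurable_var h hΩ n).sqrt

omit [Fintype X] [MeasurableSpace X] [MeasurableSingletonClass X] [IsProbabilityMeasure P] in
lemma IsModel.beta_nonneg (h : T.IsModel P k v) {n : ℕ} (hκ : 1 ≤ κ (n + 1)) :
    ∀ᵐ ω ∂P, 0 ≤ T.beta κ (n + 1) ω := by
  have h1 := (h.xi_law (n + 1) (by omega)).ae_iff (p := fun s => 0 ≤ s) (by fun_prop)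
  filter_upwards [h1.2 chiSquared_two_ae_nonneg] with ω hω
  have := Real.log_nonneg hκ
  unfold beta
  linarith

-- All `ξ` share one law and `κ` grows, so the moment at the last round dominates the earlier ones.
-- Integrability ensures that the Bochner integral on the right is not the default value `0`.
omit [Fintype X] [MeasurableSpace X] [MeasurableSingletonClass X] [IsProbabilityMeasure P] in
lemma IsModel.lintegral_beta_rpow_le (h : T.IsModel P k v) {n t : ℕ} (hκ : 1 ≤ κ (n + 1))
    (ht : 1 ≤ t) (hκt : κ (n + 1) ≤ κ t) {p : ℝ} (hp : 0 ≤ p) :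
    ∫⁻ ω, ENNReal.ofReal (T.beta κ (n + 1) ω ^ p) ∂P ≤
      ENNReal.ofReal (∫ ω, T.beta κ t ω ^ p ∂P) := by
  have hl := Real.log_nonneg hκ
  have hlt := Real.log_le_log (by linarith) hκt
  have h1 := (h.xi_law (n + 1) (by omega)).lintegral_comp
    (f := fun s => ENNReal.ofReal ((2 * Real.log (κ (n + 1)) + s) ^ p)) (by fun_prop)
  have h2 := (h.xi_law t ht).integral_comp
    (f := fun s => (2 * Real.log (κ t) + s) ^ p)
    (integrable_add_rpow_chiSquared_two (by linarith) hp).aestronglyMeasurable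
  simp only [Function.comp_def] at h2
  simp only [beta]
  rw [h1, h2, ofReal_integral_eq_lintegral_ofReal
    (integrable_add_rpow_chiSquared_two (by linarith) hp)]
  · refine lintegral_mono_ae ?_
    filter_upwards [chiSquared_two_ae_nonneg] with s hs
    refine ENNReal.ofReal_le_ofReal (Real.rpow_le_rpow (by linarith) (by linarith) hp)
  · filter_upwards [chiSquared_two_ae_nonneg] with s hs
    exact Real.rpow_nonneg (by linarith) _

omit [Fintype X] [MeasurableSpace X] [MeasurableSingletonClass X] [IsProbabilityMeasure P] in
lemma IsModel.integral_beta_rpow_nonneg (h : T.IsModel P k v) {t : ℕ} (ht : 1 ≤ t)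
    (hκ : 1 ≤ κ t) (p : ℝ) : 0 ≤ ∫ ω, T.beta κ t ω ^ p ∂P := by
  obtain ⟨s, rfl⟩ : ∃ s, t = s + 1 := ⟨t - 1, by omega⟩
  refine integral_nonneg_of_ae ?_
  filter_upwards [h.beta_nonneg hκ] with ω hω using Real.rpow_nonneg hω _

omit [Fintype X] [MeasurableSpace X] [MeasurableSingletonClass X] [IsProbabilityMeasure P] in
lemma IsModel.infoGain_bound_nonneg (h : T.IsModel P k v) (hv : 0 < v) [Nonempty (X × Ω)]
    (t : ℕ) : 0 ≤ 2 / Real.log (1 + (v : ℝ)⁻¹) * maxInfoGain k v t :=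
  (Finset.sum_nonneg fun _ _ => h.isPosSemidefKernel.posteriorVar_nonneg hv _ _).trans
    (h.isPosSemidefKernel.sum_posteriorVar_le h.kernel_le_one hv
      (fun _ => Classical.arbitrary (X × Ω)) t)

lemma IsAlgorithm.sum_lintegral_scaledStd_rpow_le [Nonempty (X × Ω)]
    (halg : T.IsAlgorithm k v ρ rnd) (h : T.IsModel P k v) (hv : 0 < v) (hΩ : MeasurableSet Ω)
    {t : ℕ} (ht : 1 ≤ t) (hκ1 : ∀ n, 1 ≤ κ (n + 1)) (hκt : ∀ n < t, κ (n + 1) ≤ κ t) {ν : ℝ}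
    (hν : 0 < ν) :
    ∑ n ∈ Finset.range t, ∫⁻ ω, ENNReal.ofReal (T.scaledStd k v κ n ω ^ ν) ∂P ≤
      ENNReal.ofReal ((t * ∫ ω, T.beta κ t ω ^ (ν / (2 - min ν 1)) ∂P) ^ (1 - min ν 1 / 2) *
        (2 / Real.log (1 + (v : ℝ)⁻¹) * maxInfoGain k v t) ^ (min ν 1 / 2)) := by
  have hν' : 0 < min ν 1 := lt_min hν one_pos
  have hν1 : min ν 1 ≤ 1 := min_le_right _ _
  have hv' : (0 : ℝ) < v := hv
  have hk := h.isPosSemidefKernel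
  set p := ν / (2 - min ν 1) with hp
  have hp0 : 0 ≤ p := div_nonneg hν.le (by linarith)
  set G := 2 / Real.log (1 + (v : ℝ)⁻¹) * maxInfoGain k v t with hG
  set C := ∫ ω, T.beta κ t ω ^ p ∂P with hC
  have hvar0 : ∀ n ω, 0 ≤ T.var k v n ω (T.x (n + 1) ω) (T.w (n + 1) ω) := fun n ω =>
    hk.posteriorVar_nonneg hv' _ _
  have hvar1 : ∀ n ω, T.var k v n ω (T.x (n + 1) ω) (T.w (n + 1) ω) ≤ 1 := fun n ω =>
    (hk.posteriorVar_le hv' _ _).trans (h.kernel_le_one _)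
  have hsum : ∀ ω, ∑ n ∈ Finset.range t, T.var k v n ω (T.x (n + 1) ω) (T.w (n + 1) ω) ≤ G :=
    fun ω => hk.sum_posteriorVar_le h.kernel_le_one hv'
      (fun n => (T.x (n + 1) ω, T.w (n + 1) ω)) t
  have hG0 : 0 ≤ G := h.infoGain_bound_nonneg hv t
  have hκt1 : 1 ≤ κ t := by
    have := hκ1 (t - 1)
    rwa [Nat.sub_add_cancel ht] at this
  have hC0 : 0 ≤ C := h.integral_beta_rpow_nonneg ht hκt1 p
  have hstep : ∀ n, ∫⁻ ω, ENNReal.ofReal (T.scaledStd k v κ n ω ^ ν) ∂P ≤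
      ∫⁻ ω, ENNReal.ofReal (T.beta κ (n + 1) ω ^ p) ^ (1 - min ν 1 / 2) *
        ENNReal.ofReal (T.var k v n ω (T.x (n + 1) ω) (T.w (n + 1) ω)) ^ (min ν 1 / 2) ∂P := by
    intro n
    refine lintegral_mono_ae ?_
    filter_upwards [h.beta_nonneg (hκ1 n)] with ω hω
    rw [ENNReal.ofReal_rpow_of_nonneg (Real.rpow_nonneg hω _) (by linarith),
      ENNReal.ofReal_rpow_of_nonneg (hvar0 n ω) (by linarith),
      ← ENNReal.ofReal_mul (Real.rpow_nonneg (Real.rpow_nonneg hω _) _)]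
    exact ENNReal.ofReal_le_ofReal (sqrt_mul_rpow_le hω (hvar0 n ω) (hvar1 n ω) hν)
  refine (Finset.sum_le_sum fun n _ => hstep n).trans ?_
  refine (sum_lintegral_mul_rpow_le t
    (fun n => ((h.measurable_beta n).pow_const p).ennreal_ofReal.aemeasurable)
    (fun n => (halg.measurable_var h hΩ n).ennreal_ofReal.aemeasurable)
    (by linarith) (by linarith) (by ring)).trans ?_
  rw [ENNReal.ofReal_mul (by positivity), ← ENNReal.ofReal_rpow_of_nonneg (by positivity)
    (by linarith), ← ENNReal.ofReal_rpow_of_nonneg hG0 (by linarith)]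
  gcongr
  · linarith
  · refine (Finset.sum_le_sum fun n hn => h.lintegral_beta_rpow_le (hκ1 n) ht
      (hκt n (Finset.mem_range.1 hn)) hp0).trans ?_
    rw [Finset.sum_const, Finset.card_range, nsmul_eq_mul, ENNReal.ofReal_mul (by positivity),
      ENNReal.ofReal_natCast]
  · rw [← lintegral_finsetSum _ fun n _ => (halg.measurable_var h hΩ n).ennreal_ofReal]
    refine (lintegral_mono fun ω => ?_).trans (by rw [lintegral_const, measure_univ, mul_one])
    simp only
    rw [← ENNReal.ofReal_sum_of_nonneg fun n _ => hvar0 n ω]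
    exact ENNReal.ofReal_le_ofReal (hsum ω)

/-! ### The discretization error -/

omit [MeasurableSpace X] [MeasurableSingletonClass X] in
lemma HasDerivTail.lintegral_lipConst_le [Nonempty Ω] [Nonempty X] (hd : 0 < d)
    (hΩ_convex : Convex ℝ Ω) (hΩ_int : (interior Ω).Nonempty)
    (hfm : ∀ p, Measurable (T.f p)) (hcont : ∀ ω x, Continuous (T.path ω x))
    {a b : ℝ} (ha : 0 < a) (hb : 0 < b) (h : T.HasDerivTail P a b) :
    (∀ᵐ ω ∂P, lipConst (T.path ω) ≠ ⊤) ∧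
    ∫⁻ ω, lipConst (T.path ω) ∂P ≤
      ENNReal.ofReal (b * (√(Real.log (a * d * Fintype.card X)) + √Real.pi / 2)) := by
  have hm : Measurable fun ω => lipConst (T.path ω) := measurable_lipConst fun x w => hfm (x, w)
  have hA : 0 < a * d * Fintype.card X := by
    have h1 : (0 : ℝ) < d := by exact_mod_cast hd
    have h2 : (0 : ℝ) < Fintype.card X := by exact_mod_cast Fintype.card_pos
    positivity
  have htail : ∀ L, 0 < L → P {ω | ENNReal.ofReal L < lipConst (T.path ω)} ≤
      ENNReal.ofReal (a * d * Fintype.card X * Real.exp (-(L / b) ^ 2)) := by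
    intro L hL
    -- If all partial derivatives of all paths stay below `L`, then so does the Lipschitz constant.
    -- The union over `X × Fin d` produces the prefactor `a d |X|`.
    have hsub : {ω | ENNReal.ofReal L < lipConst (T.path ω)} ≤ᵐ[P]
        ⋃ p : X × Fin d, {ω | ∃ w ∈ interior Ω, L < |partialDeriv (T.path ω p.1) p.2 w|} := by
      filter_upwards [h.differentiable] with ω hω hlt
      by_contra hcon
      refine absurd hlt (not_lt.2 (lipConst_le fun x w w' => ?_))
      refine abs_sub_le_of_partialDeriv_le hΩ_convex hΩ_int (hcont ω x) (hω x)
        (fun j w hw => not_lt.1 fun hlt => hcon ?_) w w'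
      exact mem_iUnion.2 ⟨(x, j), w, hw, hlt⟩
    refine (measure_mono_ae hsub).trans ((measure_iUnion_le _).trans ?_)
    rw [tsum_fintype]
    refine (Finset.sum_le_sum fun p _ => h.tail p.1 p.2 L hL).trans ?_
    rw [Finset.sum_const, nsmul_eq_mul, ← ENNReal.ofReal_natCast,
      ← ENNReal.ofReal_mul (by positivity)]
    refine ENNReal.ofReal_le_ofReal (le_of_eq ?_)
    simp only [Finset.card_univ, Fintype.card_prod, Fintype.card_fin]
    push_cast
    ring
  exact ⟨ae_ne_top_of_tail hb htail, lintegral_le_of_tail hm hA hb htail⟩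

end Run

end RobustBO

namespace RobustBO

/-! ### Rounding errors and the decomposition of the regret. -/

namespace Run

variable {S X : Type*} {d : ℕ} {Ω : Set (EuclideanSpace ℝ (Fin d))} {T : Run S X Ω}
  [Fintype X] [MeasurableSpace S] {P : Measure S}
  {ρ : (Ω → ℝ) → ℝ} {rnd : ℕ → Ω → Ω}

omit [Fintype X] in
lemma DiscretizationBound.abs_sub_le [Nonempty Ω] {r : ℝ}
    (hcont : ∀ ω x, Continuous (T.path ω x)) (hfin : ∀ᵐ ω ∂P, lipConst (T.path ω) ≠ ⊤)
    {τ : ℕ → ℕ} (hτ : ∀ t, 1 ≤ t → 0 < τ t) {D : ℕ → Finset Ω}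
    (hD : ∀ t, 1 ≤ t → IsGridDiscretization Ω r (τ t) (D t))
    (hrnd : ∀ t, 1 ≤ t → IsNearestPointMap (D t) (rnd t)) {q₂ : ℝ → ℝ} (hq₂ : IsConcaveModulus q₂)
    (hdisc : T.DiscretizationBound P ρ rnd q₂) :
    ∀ᵐ ω ∂P, ∀ t, 1 ≤ t → ∀ x, |ρ (T.path ω x) - ρ (T.path ω x ∘ rnd t)| ≤
      q₂ ((lipConst (T.path ω)).toReal * (d * r / τ t)) := by
  filter_upwards [hdisc, hfin] with ω h1 h2 t ht x
  have h3 : ∀ w, |T.path ω x w - T.path ω x (rnd t w)| ≤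
      (lipConst (T.path ω)).toReal * (d * r / τ t) := fun w =>
    (abs_sub_le_lipConst (hcont ω) h2 x w _).trans (mul_le_mul_of_nonneg_left
      (l1dist_rnd_le (hτ t ht) (hD t ht) (hrnd t ht) w) ENNReal.toReal_nonneg)
  have h4 : 0 ≤ ⨆ w, |T.path ω x w - T.path ω x (rnd t w)| := Real.iSup_nonneg fun _ => abs_nonneg _
  exact (h1 t ht x).trans (hq₂.mono h4 (h4.trans (ciSup_le h3)) (ciSup_le h3))

omit [MeasurableSpace S] in
lemma regret_le_gap [Nonempty X] {ω : S} {n : ℕ} {δ : ℝ}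
    (hδ : ∀ x, |ρ (T.path ω x) - ρ (T.path ω x ∘ rnd n)| ≤ δ) (x : X) :
    ρ (T.path ω x) - ρ (T.path ω (T.xhat n ω)) ≤ 2 * δ + T.gap ρ rnd n ω := by
  have h1 := abs_le.1 (hδ x)
  have h2 := abs_le.1 (hδ (T.xhat n ω))
  have h3 := le_ciSup (Set.finite_range fun x => ρ (T.path ω x ∘ rnd n)).bddAbove x
  unfold gap
  linarith

omit [MeasurableSpace S] in
lemma sum_inv_sq_le (t : ℕ) : ∑ n ∈ Finset.range t, 1 / ((n : ℝ) + 1) ^ 2 ≤ Real.pi ^ 2 / 6 := by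
  have h1 := hasSum_zeta_two
  -- The zeta series starts at index `0`, whose term `1 / 0 ^ 2` is `0`.
  have h2 := sum_le_hasSum (Finset.range (t + 1)) (fun _ _ => by positivity) h1
  rw [Finset.sum_range_succ'] at h2
  simpa using h2

/-- The discretization part of the regret, summed over the rounds. -/
lemma sum_lintegral_discretization_le [IsProbabilityMeasure P] {Z : S → ℝ} (hZ0 : ∀ ω, 0 ≤ Z ω)
    (hZ : Integrable Z P) {η : ℕ → ℝ} (hη0 : ∀ n, 0 ≤ η n)
    (hη : ∀ n : ℕ, (∫ ω, Z ω ∂P) * η n ≤ 1 / ((n : ℝ) + 1) ^ 2) {q₂ : ℝ → ℝ}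
    (hq₂ : IsConcaveModulus q₂) {t : ℕ} (ht : 1 ≤ t) :
    ∃ c, (∀ n ω, q₂ (Z ω * η n) ≤ q₂ (Real.pi ^ 2 / (6 * t)) +
        c * (Z ω * η n - Real.pi ^ 2 / (6 * t))) ∧
      ∑ n ∈ Finset.range t, ∫⁻ ω, ENNReal.ofReal (2 * (q₂ (Real.pi ^ 2 / (6 * t)) +
        c * (Z ω * η n - Real.pi ^ 2 / (6 * t)))) ∂P ≤
      ENNReal.ofReal (2 * t * q₂ (Real.pi ^ 2 / (6 * t))) := by
  have ht' : (0 : ℝ) < t := by exact_mod_cast ht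
  -- An upper bound for the average over the rounds of the mean errors, and the touching point of
  -- the affine majorant.
  set m := Real.pi ^ 2 / (6 * t) with hm
  have hm0 : 0 < m := by have := Real.pi_pos; positivity
  obtain ⟨c, hc, hmaj⟩ := hq₂.exists_affine_majorant hm0.le
  have hle : ∀ n ω, q₂ (Z ω * η n) ≤ q₂ m + c * (Z ω * η n - m) := fun n ω =>
    hmaj _ (mul_nonneg (hZ0 ω) (hη0 n)) fun h => absurd h hm0.ne'
  refine ⟨c, hle, ?_⟩
  have hdev : ∀ n, Integrable (fun ω => c * (Z ω * η n - m)) P := fun n =>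
    ((hZ.mul_const _).sub (integrable_const _)).const_mul _
  have hint : ∀ n, Integrable (fun ω => 2 * (q₂ m + c * (Z ω * η n - m))) P := fun n =>
    ((integrable_const _).add (hdev n)).const_mul _
  have h0 : ∀ n ω, 0 ≤ 2 * (q₂ m + c * (Z ω * η n - m)) := fun n ω =>
    mul_nonneg zero_le_two ((hq₂.nonneg (mul_nonneg (hZ0 ω) (hη0 n))).trans (hle n ω))
  have hI : ∀ n, ∫ ω, 2 * (q₂ m + c * (Z ω * η n - m)) ∂P =
      2 * (q₂ m + c * ((∫ ω, Z ω ∂P) * η n - m)) := by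
    intro n
    rw [integral_const_mul, integral_add (integrable_const _) (hdev n), integral_const_mul,
      integral_sub (hZ.mul_const _) (integrable_const _), integral_mul_const]
    simp
  rw [Finset.sum_congr rfl fun n _ => (ofReal_integral_eq_lintegral_ofReal (hint n)
    (ae_of_all _ (h0 n))).symm,
    ← ENNReal.ofReal_sum_of_nonneg fun n _ => integral_nonneg (h0 n)]
  refine ENNReal.ofReal_le_ofReal ?_
  simp only [hI]
  have h1 : ∑ n ∈ Finset.range t, (∫ ω, Z ω ∂P) * η n ≤ t * m := by
    refine (Finset.sum_le_sum fun n _ => hη n).trans ((sum_inv_sq_le t).trans (le_of_eq ?_))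
    rw [hm]
    field_simp
  rw [← Finset.mul_sum, Finset.sum_add_distrib, ← Finset.mul_sum, Finset.sum_sub_distrib]
  simp only [Finset.sum_const, Finset.card_range, nsmul_eq_mul]
  nlinarith [mul_nonneg hc (sub_nonneg.2 h1)]

end Run

end RobustBO

end

/-! ### The regret bound. -/

open MeasureTheory RobustBO in
theorem mainTheorem9 {S X : Type*} [MeasurableSpace S] {P : Measure S} [IsProbabilityMeasure P]
    [Fintype X] [MeasurableSpace X] [MeasurableSingletonClass X]
    {d : ℕ} (hd : 0 < d) {r : ℝ} {Ω : Set (EuclideanSpace ℝ (Fin d))}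
    (hΩ_compact : IsCompact Ω) (hΩ_convex : Convex ℝ Ω) (hΩ_int : (interior Ω).Nonempty)
    (hΩ_box : ∀ w ∈ Ω, ∀ j, w j ∈ Set.Icc 0 r)
    (k : X × Ω → X × Ω → ℝ) {v : NNReal} (hv : 0 < v)
    (T : Run S X Ω) (hmodel : T.IsModel P k v)
    {a₂ b₂ : ℝ} (ha₂ : 0 < a₂) (hb₂ : 0 < b₂) (htail : T.HasDerivTail P a₂ b₂)
    (Ωt : ℕ → Finset Ω)
    (hΩt : ∀ t, 1 ≤ t →
      IsGridDiscretization Ω r (tau a₂ b₂ r d (Fintype.card X) t) (Ωt t))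
    (rnd : ℕ → Ω → Ω) (hrnd : ∀ t, 1 ≤ t → IsNearestPointMap (Ωt t) (rnd t))
    (ρ : (Ω → ℝ) → ℝ) (𝒟 : Set (Ω → ℝ)) (hρ : T.IsAdmissible P ρ 𝒟 rnd)
    (κ : ℕ → ℝ) (hκ : ∀ t, κ t = kappa a₂ b₂ r d (Fintype.card X) t)
    (hbound : T.IsBound P k v ρ 𝒟 rnd κ)
    {q₂ : ℝ → ℝ} (hq₂ : IsConcaveModulus q₂) (hdisc : T.DiscretizationBound P ρ rnd q₂)
    (q : QFun) (hwidth : T.WidthBound P k v κ q)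
    (halg : T.IsAlgorithm k v ρ rnd)
    (xstar : S → X) (hxstar : ∀ ω x, ρ (T.path ω x) ≤ ρ (T.path ω (xstar ω)))
    (t : ℕ) (ht : 1 ≤ t) :
    Integrable (T.cumRegret ρ xstar t) P ∧
    ∫ ω, T.cumRegret ρ xstar t ω ∂P ≤
      2 * t * q₂ (Real.pi ^ 2 / (6 * t)) +
      2 * t * ∑ i, q.ζ i * q.h i (1 / t * ∑ j,
        2 ^ q.ν i j * q.lam i j *
          (t * ∫ ω, T.beta κ t ω ^ (q.ν i j / (2 - min (q.ν i j) 1)) ∂P)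
            ^ (1 - min (q.ν i j) 1 / 2) *
          (2 / Real.log (1 + (v : ℝ)⁻¹) * maxInfoGain k v t) ^ (min (q.ν i j) 1 / 2)) := by
  classical
  have hS : Nonempty S := P.nonempty_of_neZero
  have hX : Nonempty X := ⟨xstar (Classical.arbitrary S)⟩
  have hΩne : Nonempty Ω := (hΩ_int.mono interior_subset).to_subtype
  have hΩm : MeasurableSet Ω := hΩ_compact.isClosed.measurableSet
  have hr : 0 < r := pos_of_interior_nonempty hd hΩ_int hΩ_box
  have hm : 0 < Fintype.card X := Fintype.card_pos
  have hκ1 : ∀ n, 1 ≤ κ (n + 1) := fun n => by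
    rw [hκ]
    exact one_le_kappa hb₂ hd hr hm (by omega)
  have hκt : ∀ n < t, κ (n + 1) ≤ κ t := fun n hn => by
    rw [hκ, hκ]
    exact kappa_mono hb₂ hr (by omega)
  have hcard : ∀ n, ((Ωt (n + 1)).card : ℝ) * Fintype.card X ≤ κ (n + 1) := fun n => by
    obtain ⟨_, _, _, _, h, _⟩ := hΩt (n + 1) (by omega)
    rw [hκ, kappa]
    exact mul_le_mul_of_nonneg_right (by exact_mod_cast h) (by positivity)
  have hτ : ∀ s, 1 ≤ s → 0 < tau a₂ b₂ r d (Fintype.card X) s := fun s hs =>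
    tau_pos hb₂ hd hr hs
  -- the discretization error
  obtain ⟨hfin, hlip⟩ := htail.lintegral_lipConst_le hd hΩ_convex hΩ_int hmodel.measurable_f
    hmodel.continuous_path ha₂ hb₂
  have hlipm : Measurable fun ω => lipConst (T.path ω) :=
    measurable_lipConst fun x w => hmodel.measurable_f (x, w)
  have herr := Run.DiscretizationBound.abs_sub_le (rnd := rnd) hmodel.continuous_path hfin hτ hΩt hrnd
    hq₂ hdisc
  set Z : S → ℝ := fun ω => (lipConst (T.path ω)).toReal with hZdef
  have hZ : Integrable Z P :=
    integrable_toReal_of_lintegral_ne_top hlipm.aemeasurable (hlip.trans_lt ENNReal.ofReal_lt_top).ne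
  set A : ℝ := b₂ * (√(Real.log (a₂ * d * Fintype.card X)) + √Real.pi / 2) with hA
  have hA0 : 0 ≤ A := by positivity
  have hZA : ∫ ω, Z ω ∂P ≤ A := by
    rw [hZdef, integral_toReal hlipm.aemeasurable (hfin.mono fun _ h => lt_top_iff_ne_top.2 h)]
    exact ENNReal.toReal_le_of_le_ofReal hA0 hlip
  set η : ℕ → ℝ := fun n => d * r / tau a₂ b₂ r d (Fintype.card X) (n + 1) with hηdef
  have hη0 : ∀ n, 0 ≤ η n := fun n => by positivity
  -- This is what `τ` is designed for: `A d r (n + 1)² ≤ τ_{n+1}`.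
  have hη : ∀ n : ℕ, (∫ ω, Z ω ∂P) * η n ≤ 1 / ((n : ℝ) + 1) ^ 2 := by
    intro n
    have h1 := le_tau (a := a₂) (b := b₂) (r := r) (d := d) (m := Fintype.card X) (n + 1)
    have h2 : (0 : ℝ) < tau a₂ b₂ r d (Fintype.card X) (n + 1) := by
      exact_mod_cast hτ (n + 1) (by omega)
    push_cast at h1
    refine (mul_le_mul_of_nonneg_right hZA (hη0 n)).trans ?_
    rw [hηdef, mul_div_assoc', div_le_div_iff₀ h2 (by positivity), one_mul]
    refine le_of_eq_of_le ?_ h1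
    rw [hA]
    ring
  obtain ⟨c, hc, hcsum⟩ := Run.sum_lintegral_discretization_le
    (Z := Z) (fun ω => ENNReal.toReal_nonneg) hZ hη0 hη hq₂ ht
  -- the gap of the discretized problem
  set Y : (i : Fin q.n) → Fin (q.s i) → ℝ := fun i j =>
    (t * ∫ ω, T.beta κ t ω ^ (q.ν i j / (2 - min (q.ν i j) 1)) ∂P)
      ^ (1 - min (q.ν i j) 1 / 2) *
    (2 / Real.log (1 + (v : ℝ)⁻¹) * maxInfoGain k v t) ^ (min (q.ν i j) 1 / 2) with hYdef
  have hG0 := hmodel.infoGain_bound_nonneg hv t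
  have hκt1 : 1 ≤ κ t := by
    rw [hκ]
    exact one_le_kappa hb₂ hd hr hm ht
  have hY0 : ∀ i j, 0 ≤ Y i j := fun i j => mul_nonneg (Real.rpow_nonneg (mul_nonneg
    (Nat.cast_nonneg _) (hmodel.integral_beta_rpow_nonneg ht hκt1 _)) _) (Real.rpow_nonneg hG0 _)
  obtain ⟨Φ, hΦm, hΦ, hΦsum⟩ := q.exists_majorant (μ := P) ht
    (u := T.scaledStd k v κ) (fun n => halg.measurable_scaledStd hmodel hΩm n)
    (fun n ω => mul_nonneg (Real.sqrt_nonneg _) (Real.sqrt_nonneg _)) hY0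
    (fun i j => halg.sum_lintegral_scaledStd_rpow_le hmodel hv hΩm ht hκ1 hκt (q.ν_pos i j))
  have hgap : ∑ n ∈ Finset.range t, ∫⁻ ω, ENNReal.ofReal (T.gap ρ rnd (n + 1) ω) ∂P ≤
      ENNReal.ofReal
        (2 * t * ∑ i, q.ζ i * q.h i (1 / t * ∑ j, 2 ^ q.ν i j * q.lam i j * Y i j)) :=
    (Finset.sum_le_sum fun n hn => hmodel.lintegral_gap_le hv hΩm halg hρ hbound hwidth (hκ1 n)
      (hcard n) (hrnd (n + 1) (by omega)) hΦm (hΦ n (Finset.mem_range.1 hn))).trans hΦsum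
  -- the regret of one round
  set R : ℕ → S → ℝ := fun n ω =>
    ρ (T.path ω (xstar ω)) - ρ (T.path ω (T.xhat (n + 1) ω)) with hR
  have hRm : ∀ n, AEMeasurable (R n) P := by
    intro n
    -- The maximizer `xstar` need not be measurable, but its value is a finite supremum of
    -- measurable functions.
    have h1 : (fun ω => ρ (T.path ω (xstar ω))) = fun ω => ⨆ x, ρ (T.path ω x) := by
      ext1 ω
      exact le_antisymm (le_ciSup (Set.finite_range fun x => ρ (T.path ω x)).bddAbove (xstar ω))
        (ciSup_le (hxstar ω))
    have h2 : (fun ω => ρ (T.path ω (T.xhat (n + 1) ω))) = fun ω =>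
        ∑ x, (T.xhat (n + 1) ⁻¹' {x}).indicator (fun ω => ρ (T.path ω x)) ω := by
      ext1 ω
      rw [Finset.sum_eq_single_of_mem (T.xhat (n + 1) ω) (Finset.mem_univ _)
        fun x _ hx => Set.indicator_of_notMem (by simpa using hx.symm) _,
        Set.indicator_of_mem (by simp)]
    refine AEMeasurable.sub ?_ ?_
    · rw [h1]
      exact AEMeasurable.iSup hρ.aemeasurable_path
    · rw [h2]
      exact Finset.aemeasurable_fun_sum _ fun x _ => (hρ.aemeasurable_path x).indicator
        (halg.measurable_estimate hmodel hΩm n (measurableSet_singleton x))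
  have hRle : ∀ n, ∫⁻ ω, ENNReal.ofReal (R n ω) ∂P ≤
      ∫⁻ ω, ENNReal.ofReal (2 * (q₂ (Real.pi ^ 2 / (6 * t)) +
        c * (Z ω * η n - Real.pi ^ 2 / (6 * t)))) ∂P +
      ∫⁻ ω, ENNReal.ofReal (T.gap ρ rnd (n + 1) ω) ∂P := by
    intro n
    have hZm : Measurable Z := hlipm.ennreal_toReal
    rw [← lintegral_add_left (by fun_prop)]
    refine lintegral_mono_ae ?_
    filter_upwards [herr] with ω hω
    refine (ENNReal.ofReal_le_ofReal ?_).trans ENNReal.ofReal_add_le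
    exact Run.regret_le_gap (fun x => (hω (n + 1) (by omega) x).trans (hc n ω)) _
  have hcum : T.cumRegret ρ xstar t = fun ω => ∑ n ∈ Finset.range t, R n ω := by
    ext1 ω
    rw [Run.cumRegret, show Finset.Icc 1 t = Finset.Ico 1 (t + 1) by ext; simp,
      Finset.sum_Ico_eq_sum_range]
    simp only [Nat.add_sub_cancel, hR, add_comm]
  have hcum0 : ∀ ω, 0 ≤ T.cumRegret ρ xstar t ω := fun ω =>
    Finset.sum_nonneg fun i _ => sub_nonneg.2 (hxstar ω _)
  have hcumm : AEMeasurable (T.cumRegret ρ xstar t) P := by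
    rw [hcum]
    exact Finset.aemeasurable_fun_sum _ fun n _ => hRm n
  have hB0 : 0 ≤ 2 * t * ∑ i, q.ζ i * q.h i (1 / t * ∑ j, 2 ^ q.ν i j * q.lam i j * Y i j) := by
    refine mul_nonneg (by positivity) (Finset.sum_nonneg fun i _ => mul_nonneg (q.ζ_nonneg i)
      ((q.h_mod i).nonneg (mul_nonneg (by positivity) (Finset.sum_nonneg fun j _ => ?_))))
    exact mul_nonneg (mul_nonneg (Real.rpow_nonneg zero_le_two _) (q.lam_nonneg i j)) (hY0 i j)
  have hD0 : 0 ≤ 2 * t * q₂ (Real.pi ^ 2 / (6 * t)) :=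
    mul_nonneg (by positivity) (hq₂.nonneg (by positivity))
  have hlint : ∫⁻ ω, ENNReal.ofReal (T.cumRegret ρ xstar t ω) ∂P ≤
      ENNReal.ofReal (2 * t * q₂ (Real.pi ^ 2 / (6 * t)) +
        2 * t * ∑ i, q.ζ i * q.h i (1 / t * ∑ j, 2 ^ q.ν i j * q.lam i j * Y i j)) := by
    have h1 : ∀ ω, ENNReal.ofReal (T.cumRegret ρ xstar t ω) =
        ∑ n ∈ Finset.range t, ENNReal.ofReal (R n ω) := fun ω => by
      rw [hcum, ENNReal.ofReal_sum_of_nonneg fun n _ => sub_nonneg.2 (hxstar ω _)]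
    simp only [h1]
    rw [lintegral_finsetSum' _ fun n _ => (hRm n).ennreal_ofReal, ENNReal.ofReal_add hD0 hB0]
    refine (Finset.sum_le_sum fun n _ => hRle n).trans ?_
    rw [Finset.sum_add_distrib]
    exact add_le_add hcsum hgap
  have hint : Integrable (T.cumRegret ρ xstar t) P := by
    refine ⟨hcumm.aestronglyMeasurable, ?_⟩
    rw [hasFiniteIntegral_iff_ofReal (Filter.Eventually.of_forall hcum0)]
    exact hlint.trans_lt ENNReal.ofReal_lt_top
  refine ⟨hint, ?_⟩
  rw [integral_eq_lintegral_of_nonneg_ae (Filter.Eventually.of_forall hcum0)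
    hcumm.aestronglyMeasurable]
  refine (ENNReal.toReal_le_of_le_ofReal (add_nonneg hD0 hB0) hlint).trans (le_of_eq ?_)
  simp only [hYdef, mul_assoc]
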